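/- All graphs are finite and simple. The spectrum of a graph is the multiset of eigenvalues of its adjacency matrix, counted with multiplicity; two graphs are cospectral if their spectra coincide. Let $\mathcal G$ be the set of connected graphs having one eigenvalue $r>1$, one eigenvalue $s<-1$, and all other eigenvalues equal to $\pm1$. Let $J$, $I$, $O$, $\mathbf 1$ denote all-one, identity and zero matrices and the all-one vector, and let $R_{n}$ be the reverse identity matrix of order $n$ (so $R_{2k}$ is the adjacency matrix of $kK_2$, the disjoint union of $k$ edges). A graph is said to be of one of the following types if, for a suitable ordering of its vertices, it has the given adjacency matrix: - type (i) with parameter $m\ge 3$: $\begin{pmatrix} O & J-I_m\\ J-I_m & O\end{pmatrix}$; - type (ii) with parameters $a\ge1$, $k\ge2$: $\begin{pmatrix} J-I_a & J\\ J & R_{2k}\end{pmatrix}$; - type (iii) with parameters $\ell\ge m\ge2$: $\begin{pmatrix} R_{2\ell} & J\\ J & R_{2m}\end{pmatrix}$; - type (iv): $\begin{pmatrix} O & N\\ N^\top & O\end{pmatrix}$, where $N=\begin{pmatrix}1&\mathbf 1^\top\\ \mathbf 1& I_4\end{pmatrix}$ (first graph) or $N=\begin{pmatrix}J-I_3&J\\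 O&J-I_3\end{pmatrix}$ (second graph); - type (vi) with parameters $(a,m)=(3,5)$ or $(4,4)$: $\begin{pmatrix} J-I_a & J & O\\ J & O & J-I_m\\ O & J-I_m & O\end{pmatrix}$. **Theorem.** Suppose $G$ and $G'$ are nonisomorphic cospectral graphs with at most two eigenvalues (counted with multiplicity) different from $\pm1$. Then there are integers $\alpha,\alpha'\ge0$ and graphs $H,H'\in\mathcal G$ such that $G\cong H+\alpha K_2$ and $G'\cong H'+\alpha'K_2$ (where $+$ is disjoint union), and $H$ and $H'$ form, in some order, one of the following pairs: - both are of type (iii), with parameters $(\ell,m)$ and $(\ell',m')$ satisfying $\ell m=\ell'm'$; - one is of type (iii) with parameters $(\ell,m)$, and the other is of type (ii) with $a=2$ and $k=\ell m$; - one is the first graph of type (iv) and the other is of type (i) with $m=4$, or one is the second graph of type (iv) and the other is of type (i) with $m=5$; - one is of type (ii) with $(a,k)=(1,16)$ and the other is of type (vi) with $(a,m)=(3,5)$, or one is of type (ii) with $(a,k)=(2,7)$ and the other is of type (vi) with $(a,m)=(4,4)$. -/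

import Mathlib

/-! Finite simple graphs, their adjacency spectra, and the families of connected graphs
with all but two adjacency eigenvalues equal to `1` or `-1`. -/

namespace TwoEig

open Classical in
/-- The spectrum of a finite graph: the multiset of eigenvalues of its adjacency matrix, counted
with multiplicity. (The matrix is real symmetric, so all eigenvalues are real.) -/
noncomputable def adjSpectrum {V : Type*} [Fintype V] (G : SimpleGraph V) : Multiset ℝ :=
  (G.adjMatrix ℝ).charpoly.roots

/-- Two finite graphs are cospectral if they have the same spectrum, with multiplicities. -/
def Cospectral {V V' : Type*} [Fintype V] [Fintype V']
    (G : SimpleGraph V) (G' : SimpleGraph V') : Prop :=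
  adjSpectrum G = adjSpectrum G'

open Classical in
/-- The eigenvalues different from `1` and `-1`, with multiplicity. -/
noncomputable def exceptionalEigenvalues {V : Type*} [Fintype V] (G : SimpleGraph V) :
    Multiset ℝ :=
  (adjSpectrum G).filter (fun x => x ≠ 1 ∧ x ≠ -1)

/-- The class `𝒢`: connected graphs with an eigenvalue `r > 1` and an eigenvalue `s < -1`,
all other eigenvalues being `1` or `-1`. -/
def InClassG {V : Type*} [Fintype V] (H : SimpleGraph V) : Prop :=
  H.Connected ∧ ∃ r s : ℝ, 1 < r ∧ s < -1 ∧ exceptionalEigenvalues H = {r, s}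

/-- The graph `α K₂`: the disjoint union of `α` edges. -/
def copiesK2 (α : ℕ) : SimpleGraph (Fin α × Fin 2) where
  Adj x y := x.1 = y.1 ∧ x.2 ≠ y.2
  symm := ⟨fun _ _ h => ⟨h.1.symm, h.2.symm⟩⟩
  loopless := ⟨fun _ h => h.2 rfl⟩

open Classical in
/-- `M` is the adjacency matrix of `G` for some ordering of the vertices of `G`. -/
def HasAdjMatrix {V ι : Type*} (G : SimpleGraph V) (M : Matrix ι ι ℝ) : Prop :=
  ∃ e : V ≃ ι, G.adjMatrix ℝ = M.submatrix e e

/-- The all-one matrix `J` of size `p × q`. -/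
def J (p q : ℕ) : Matrix (Fin p) (Fin q) ℝ := Matrix.of fun _ _ => 1

/-- The matrix `J - I` of order `n`. -/
def JI (n : ℕ) : Matrix (Fin n) (Fin n) ℝ := J n n - 1

/-- The reverse identity matrix of order `n`. -/
def R (n : ℕ) : Matrix (Fin n) (Fin n) ℝ := Matrix.of fun i j => if j = i.rev then 1 else 0

/-- The bipartite adjacency matrix `[O, N; Nᵀ, O]`. -/
def bip {ι κ : Type*} (N : Matrix ι κ ℝ) : Matrix (ι ⊕ κ) (ι ⊕ κ) ℝ :=
  Matrix.fromBlocks 0 N N.transpose 0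

/-- Type (i): `[O, J-I; J-I, O]`, with blocks of order `m ≥ 3`. -/
def IsTypeI {V : Type*} (m : ℕ) (H : SimpleGraph V) : Prop :=
  3 ≤ m ∧ HasAdjMatrix H (Matrix.fromBlocks 0 (JI m) (JI m) 0)

/-- Type (ii): `[J-I_a, J; J, R_{2k}]`, with `a ≥ 1` and `k ≥ 2`. -/
def IsTypeII {V : Type*} (a k : ℕ) (H : SimpleGraph V) : Prop :=
  1 ≤ a ∧ 2 ≤ k ∧
    HasAdjMatrix H (Matrix.fromBlocks (JI a) (J a (2 * k)) (J (2 * k) a) (R (2 * k)))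

/-- Type (iii): `[R_{2l}, J; J, R_{2m}]`, with `l ≥ m ≥ 2`. -/
def IsTypeIII {V : Type*} (l m : ℕ) (H : SimpleGraph V) : Prop :=
  m ≤ l ∧ 2 ≤ m ∧
    HasAdjMatrix H
      (Matrix.fromBlocks (R (2 * l)) (J (2 * l) (2 * m)) (J (2 * m) (2 * l)) (R (2 * m)))

/-- Type (iv), first graph: `[O, N; Nᵀ, O]` with `N = [1, 1ᵀ; 1, I_4]`. -/
def IsTypeIVFirst {V : Type*} (H : SimpleGraph V) : Prop :=
  HasAdjMatrix H (bip (Matrix.fromBlocks (J 1 1) (J 1 4) (J 4 1) (1 : Matrix (Fin 4) (Fin 4) ℝ)))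

/-- Type (iv), second graph: `[O, N; Nᵀ, O]` with `N = [J-I_3, J; O, J-I_3]`. -/
def IsTypeIVSecond {V : Type*} (H : SimpleGraph V) : Prop :=
  HasAdjMatrix H (bip (Matrix.fromBlocks (JI 3) (J 3 3) 0 (JI 3)))

/-- Type (vi): `[J-I_a, J, O; J, O, J-I_m; O, J-I_m, O]`, with `(a, m) = (3, 5)` or `(4, 4)`. -/
def IsTypeVI {V : Type*} (a m : ℕ) (H : SimpleGraph V) : Prop :=
  ((a = 3 ∧ m = 5) ∨ (a = 4 ∧ m = 4)) ∧
    HasAdjMatrix H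
      (Matrix.fromBlocks
        (Matrix.fromBlocks (JI a) (J a m) (J m a) 0)
        (Matrix.fromRows (0 : Matrix (Fin a) (Fin m) ℝ) (JI m))
        (Matrix.fromCols (0 : Matrix (Fin m) (Fin a) ℝ) (JI m))
        0)

/-- The list of pairs of graphs; the order within a pair is as written. -/
def ListedPair {V V' : Type*} (H : SimpleGraph V) (H' : SimpleGraph V') : Prop :=
  (∃ l m l' m' : ℕ, IsTypeIII l m H ∧ IsTypeIII l' m' H' ∧ l * m = l' * m') ∨
  (∃ l m : ℕ, IsTypeIII l m H ∧ IsTypeII 2 (l * m) H') ∨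
  (IsTypeIVFirst H ∧ IsTypeI 4 H') ∨
  (IsTypeIVSecond H ∧ IsTypeI 5 H') ∨
  (IsTypeII 1 16 H ∧ IsTypeVI 3 5 H') ∨
  (IsTypeII 2 7 H ∧ IsTypeVI 4 4 H')

end TwoEig

/-!
Let `A` be the adjacency matrix of a graph with at most two eigenvalues different from `±1`.

If no eigenvalue is below `-1`, then `A + 1` is positive semidefinite, the graph is a disjoint union
of complete graphs, and the traces of the powers of `A + 1` determine the sizes of the components.
So cospectral graphs of this kind are isomorphic (`nonempty_iso_of_neg_one_le`), and the graphs of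
the theorem have an eigenvalue `s < -1`. By the Rayleigh principle there is also an eigenvalue
`r > 1`, and all other eigenvalues are `±1`.

Then `A² - 1` is positive semidefinite of rank two: it is the Gram matrix of vectors in the plane,
one for each vertex. The diagonal entries are the degrees minus one and the other entries count
common neighbours. Vertices of degree one have the zero vector, hence they form components `K₂`. Two
further components would give a plane on which `A - 1` is positive definite, against the uniqueness
of `r`; this is the decomposition `exists_reduction`.

A connected graph of the class is classified by means of the Gram vectors (`Admissible.classify`).
Since `A + 1` has one negative eigenvalue, two adjacent vertices with nonadjacent common neighbours
are closed twins, and a vanishing Gram determinant shows that every triangle contains two closed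
twins (`Admissible.triangle`). Modulo twins the graph is therefore triangle-free. The Gram
determinant of a path of length two modulo twins is a polynomial in the sizes of the twin classes
and the numbers of common and private neighbours (`Admissible.pathPoly_eq_zero`), and most terms are
nonnegative. Solving this equation in the possible combinations of twin classes of size one and of larger size
gives types (ii), (iii), (vi) and three paths of cliques. If there are no twins, adjacent vertices
have orthogonal vectors, so the graph is bipartite with parallel vectors on each side, and the
equality case of the Cauchy–Schwarz inequality leaves types (i) and (iv).

Finally, eigenvectors that are constant on the blocks give `r + s` and `r * s` for each family, both
integers. Cospectral graphs share these two numbers, and comparing them leaves the listed pairs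
(`Classified.eq_or_listedPair`); isomorphic graphs `H` and `H'` would make `G` and `G'` isomorphic,
because they have the same number of vertices.
-/

namespace TwoEig

/-! ### Gram vectors and closed twins -/

section Combinatorics
open scoped Classical
open Finset

variable {V : Type*} [Fintype V]
set_option linter.unusedSectionVars false

/-- The number of elements with the property `p`, as an integer. -/
noncomputable def num (p : V → Prop) : ℤ := (#{w | p w} : ℤ)

/-- The number of common neighbours of `u` and `v`; for `u = v` this is the degree of `v`. -/
noncomputable def cn (G : SimpleGraph V) (u v : V) : ℤ :=
  num fun w => G.Adj u w ∧ G.Adj v w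

/-- The combinatorial facts about a graph in the class `𝒢` that the classification uses: with
`A` the adjacency matrix, `A² - 1` is the Gram matrix of vectors in the plane, two adjacent
vertices with two nonadjacent common neighbours are closed twins, and every degree is at least `2`.
-/
structure Admissible (G : SimpleGraph V) : Prop where
  connected : G.Connected
  gram : ∃ x y : V → ℝ, ∀ u v, (cn G u v : ℝ) - (if u = v then 1 else 0) = x u * x v + y u * y v
  diamond : ∀ u v a b c, G.Adj u v → G.Adj u a → G.Adj v a → G.Adj u b → G.Adj v b → a ≠ b →
    ¬ G.Adj a b → G.Adj u c → c ≠ v → G.Adj v c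
  two_le_degree : ∀ v, 2 ≤ cn G v v

/-- Closed twins: the closed neighbourhoods of `u` and `v` coincide. -/
def Tw (G : SimpleGraph V) (u v : V) : Prop :=
  ∀ w, (w = u ∨ G.Adj u w) ↔ (w = v ∨ G.Adj v w)

/-- The weight of a vertex: the number of its closed twins, itself included. A vertex is called light
if its weight is `1` and heavy if its weight is at least `2`. -/
noncomputable def wt (G : SimpleGraph V) (v : V) : ℤ := num fun w => Tw G v w

variable {G : SimpleGraph V}

theorem Tw.refl (u : V) : Tw G u u := fun _ => Iff.rfl

theorem Tw.symm {u v : V} (h : Tw G u v) : Tw G v u := fun w => (h w).symm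

theorem Tw.trans {u v w : V} (h : Tw G u v) (h' : Tw G v w) : Tw G u w :=
  fun x => (h x).trans (h' x)

theorem Tw.adj {u v : V} (h : Tw G u v) (hne : u ≠ v) : G.Adj u v := by
  have := (h u).1 (Or.inl rfl)
  rcases this with h1 | h1
  · exact absurd h1 hne
  · exact h1.symm

theorem Tw.adj_of_adj {u v w : V} (h : Tw G u v) (hw : G.Adj u w) (hne : w ≠ v) : G.Adj v w := by
  rcases (h w).1 (Or.inr hw) with h1 | h1
  · exact absurd h1 hne
  · exact h1

theorem num_nonneg (p : V → Prop) : 0 ≤ num p := by unfold num; positivity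

theorem not_of_num_eq_zero {p : V → Prop} (h : num p = 0) (w : V) : ¬ p w := by
  intro hw
  have h0 : #{w | p w} = 0 := by unfold num at h; exact_mod_cast h
  have : w ∈ (univ.filter p) := by simpa using hw
  rw [Finset.card_eq_zero] at h0
  rw [h0] at this
  simp at this

theorem num_eq_zero {p : V → Prop} (h : ∀ w, ¬ p w) : num p = 0 := by
  simp [num, h]

theorem exists_of_num_pos {p : V → Prop} (h : 0 < num p) : ∃ w, p w := by
  by_contra hcon
  push Not at hcon
  simp [num, hcon] at h

theorem one_le_num {p : V → Prop} {w : V} (h : p w) : 1 ≤ num p := by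
  have : 0 < #{w | p w} := Finset.card_pos.2 ⟨w, by simpa using h⟩
  unfold num
  exact_mod_cast this

theorem num_congr {p q : V → Prop} (h : ∀ w, p w ↔ q w) : num p = num q := by
  have : p = q := funext fun w => propext (h w)
  rw [this]

theorem num_mono {p q : V → Prop} (h : ∀ w, p w → q w) : num p ≤ num q := by
  unfold num
  exact_mod_cast Finset.card_le_card (Finset.monotone_filter_right _ fun w _ => h w)

theorem num_or {p q : V → Prop} (h : ∀ w, p w → ¬ q w) :
    num (fun w => p w ∨ q w) = num p + num q := by
  unfold num
  rw [← Nat.cast_add, ← Finset.card_union_of_disjoint]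
  · congr 2; ext w; simp
  · rw [Finset.disjoint_filter]; intro w _ h1; exact h w h1

theorem num_single (a : V) : num (fun w => w = a) = 1 := by
  unfold num
  rw [Finset.filter_eq' univ a]; simp

theorem num_split (p q : V → Prop) :
    num p = num (fun w => p w ∧ q w) + num (fun w => p w ∧ ¬ q w) := by
  rw [← num_or (by tauto)]
  exact num_congr fun w => by tauto

theorem eq_of_num_eq_one {p : V → Prop} (h : num p = 1) {u v : V} (hu : p u) (hv : p v) :
    u = v := by
  have h2 : #{w | p w} = 1 := by unfold num at h; exact_mod_cast h
  obtain ⟨a, ha⟩ := Finset.card_eq_one.1 h2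
  have hu : u ∈ univ.filter p := by simpa using hu
  have hv : v ∈ univ.filter p := by simpa using hv
  rw [ha] at hu hv
  simp at hu hv
  rw [hu, hv]

theorem cn_comm (u v : V) : cn G u v = cn G v u := num_congr fun _ => and_comm

theorem cn_nonneg (u v : V) : 0 ≤ cn G u v := num_nonneg _

theorem one_le_wt (v : V) : 1 ≤ wt G v := one_le_num (Tw.refl v)

theorem wt_congr {u v : V} (h : Tw G u v) : wt G u = wt G v :=
  num_congr fun _ => ⟨fun h' => h.symm.trans h', fun h' => h.trans h'⟩

theorem eq_of_tw {u v : V} (h1 : wt G u = 1) (h : Tw G u v) : v = u :=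
  eq_of_num_eq_one h1 h (Tw.refl u)

/-- The Gram determinant of three vectors in the plane vanishes. -/
theorem Admissible.det (hG : Admissible G) {u v w : V} (huv : u ≠ v) (huw : u ≠ w) (hvw : v ≠ w) :
    (cn G u u - 1) * ((cn G v v - 1) * (cn G w w - 1) - cn G v w ^ 2)
      - cn G u v * (cn G u v * (cn G w w - 1) - cn G v w * cn G u w)
      + cn G u w * (cn G u v * cn G v w - (cn G v v - 1) * cn G u w) = 0 := by
  obtain ⟨x, y, h⟩ := hG.gram
  have e1 := h u u
  have e2 := h v v
  have e3 := h w w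
  have e4 := h u v
  have e5 := h u w
  have e6 := h v w
  simp only [if_true, huv, huw, hvw, if_false, sub_zero] at e1 e2 e3 e4 e5 e6
  have : ((cn G u u - 1 : ℝ)) * ((cn G v v - 1) * (cn G w w - 1) - cn G v w ^ 2)
      - cn G u v * (cn G u v * (cn G w w - 1) - cn G v w * cn G u w)
      + cn G u w * (cn G u v * cn G v w - (cn G v v - 1) * cn G u w) = 0 := by
    rw [e1, e2, e3, e4, e5, e6]; ring
  exact_mod_cast this

/-- Cauchy–Schwarz for the Gram vectors. -/
theorem Admissible.cauchy (hG : Admissible G) {u v : V} (huv : u ≠ v) :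
    cn G u v ^ 2 ≤ (cn G u u - 1) * (cn G v v - 1) := by
  obtain ⟨x, y, h⟩ := hG.gram
  have e1 := h u u
  have e2 := h v v
  have e4 := h u v
  simp only [if_true, huv, if_false, sub_zero] at e1 e2 e4
  have : (cn G u v : ℝ) ^ 2 ≤ (cn G u u - 1) * (cn G v v - 1) := by
    rw [e1, e2, e4]; nlinarith [sq_nonneg (x u * y v - y u * x v)]
  exact_mod_cast this

/-- The squared distance of the Gram vectors of two vertices is nonnegative. -/
theorem Admissible.dist (hG : Admissible G) {u v : V} (huv : u ≠ v) :
    2 * cn G u v ≤ (cn G u u - 1) + (cn G v v - 1) := by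
  have h := hG.cauchy huv
  have h1 := hG.two_le_degree u
  have h2 := hG.two_le_degree v
  have h3 := cn_nonneg (G := G) u v
  nlinarith [sq_nonneg (cn G u u - cn G v v)]

/-- Two common neighbours of adjacent vertices that are not twins are adjacent: otherwise the four
vertices form a diamond. -/
theorem Admissible.common_adj (hG : Admissible G) {u v a b : V} (huv : G.Adj u v)
    (hT : ¬ Tw G u v) (hua : G.Adj u a) (hva : G.Adj v a) (hub : G.Adj u b) (hvb : G.Adj v b)
    (hab : a ≠ b) : G.Adj a b := by
  by_contra hn
  apply hT
  intro w
  constructor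
  · rintro (rfl | h)
    · exact Or.inr huv.symm
    · by_cases hw : w = v
      · exact Or.inl hw
      · exact Or.inr (hG.diamond u v a b w huv hua hva hub hvb hab hn h hw)
  · rintro (rfl | h)
    · exact Or.inr huv
    · by_cases hw : w = u
      · exact Or.inl hw
      · exact Or.inr (hG.diamond v u a b w huv.symm hva hua hvb hub hab hn h hw)

/-- The determinant of `τ + 1` times the all-one matrix of order three plus the diagonal matrix with
entries `a`, `b`, `c` vanishes only if two of the entries do. -/
theorem two_eq_zero_of_gram_eq_zero {τ a b c : ℤ} (hτ : 0 ≤ τ) (ha : 0 ≤ a) (hb : 0 ≤ b)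
    (hc : 0 ≤ c)
    (h : (τ + 2 + a - 1) * ((τ + 2 + b - 1) * (τ + 2 + c - 1) - (τ + 1) ^ 2)
      - (τ + 1) * ((τ + 1) * (τ + 2 + c - 1) - (τ + 1) * (τ + 1))
      + (τ + 1) * ((τ + 1) * (τ + 1) - (τ + 2 + b - 1) * (τ + 1)) = 0) :
    (a = 0 ∧ b = 0) ∨ (b = 0 ∧ c = 0) ∨ (a = 0 ∧ c = 0) := by
  have hsum : (τ + 1) * (a * b + a * c + b * c) + a * b * c = 0 := by linear_combination h
  have q1 : 0 ≤ a * b := mul_nonneg ha hb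
  have q2 : 0 ≤ a * c := mul_nonneg ha hc
  have q3 : 0 ≤ b * c := mul_nonneg hb hc
  have q4 : 0 ≤ a * b * c := mul_nonneg q1 hc
  have z : a * b + a * c + b * c = 0 := by nlinarith
  have z1 : a * b = 0 := by linarith
  have z2 : a * c = 0 := by linarith
  have z3 : b * c = 0 := by linarith
  rcases mul_eq_zero.1 z1 with a | a <;> rcases mul_eq_zero.1 z2 with b | b <;>
    rcases mul_eq_zero.1 z3 with c | c <;> simp [a, b, c]

theorem Admissible.cn_of_triangle (hG : Admissible G) {a b c : V} (hab : G.Adj a b)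
    (hbc : G.Adj b c) (hac : G.Adj a c) (hT : ¬ Tw G a b) :
    cn G a b = num (fun x => G.Adj a x ∧ G.Adj b x ∧ G.Adj c x) + 1 := by
  unfold cn
  rw [num_congr (q := fun x => (G.Adj a x ∧ G.Adj b x ∧ G.Adj c x) ∨ x = c), num_or,
    num_single]
  · rintro x ⟨_, _, hx⟩ rfl
    exact G.loopless.irrefl _ hx
  · intro x
    constructor
    · rintro ⟨hx, hx'⟩
      by_cases hxc : x = c
      · exact Or.inr hxc
      · exact Or.inl ⟨hx, hx', (hG.common_adj hab hT hac hbc hx hx' (Ne.symm hxc))⟩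
    · rintro (⟨hx, hx', _⟩ | rfl)
      · exact ⟨hx, hx'⟩
      · exact ⟨hac, hbc⟩

theorem degree_of_triangle {a b c : V} (hab : G.Adj a b) (hbc : G.Adj b c) (hac : G.Adj a c) :
    cn G a a = num (fun x => G.Adj a x ∧ G.Adj b x ∧ G.Adj c x) + 2 +
      num (fun x => G.Adj a x ∧ x ≠ b ∧ x ≠ c ∧ ¬ (G.Adj b x ∧ G.Adj c x)) := by
  unfold cn
  rw [num_congr (q := fun x => ((G.Adj a x ∧ G.Adj b x ∧ G.Adj c x) ∨ (x = b ∨ x = c)) ∨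
    (G.Adj a x ∧ x ≠ b ∧ x ≠ c ∧ ¬ (G.Adj b x ∧ G.Adj c x))), num_or, num_or,
    num_or, num_single, num_single]
  · ring
  · rintro x rfl; exact hbc.ne
  · rintro x ⟨_, hb, hc⟩ (rfl | rfl)
    · exact G.loopless.irrefl _ hb
    · exact G.loopless.irrefl _ hc
  · rintro x (⟨_, hb⟩ | (h | h)) h'
    · exact h'.2.2.2 hb
    · exact h'.2.1 h
    · exact h'.2.2.1 h
  · intro x
    constructor
    · rintro ⟨hx, _⟩
      by_cases e1 : x = b
      · exact Or.inl (Or.inr (Or.inl e1))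
      by_cases e2 : x = c
      · exact Or.inl (Or.inr (Or.inr e2))
      by_cases e3 : G.Adj b x ∧ G.Adj c x
      · exact Or.inl (Or.inl ⟨hx, e3⟩)
      · exact Or.inr ⟨hx, e1, e2, e3⟩
    · rintro ((⟨hx, _⟩ | (rfl | rfl)) | ⟨hx, _⟩)
      · exact ⟨hx, hx⟩
      · exact ⟨hab, hab⟩
      · exact ⟨hac, hac⟩
      · exact ⟨hx, hx⟩

theorem tw_of_triangle {a b c : V} (hab : G.Adj a b) (hbc : G.Adj b c) (hac : G.Adj a c)
    (ha : num (fun x => G.Adj a x ∧ x ≠ b ∧ x ≠ c ∧ ¬ (G.Adj b x ∧ G.Adj c x)) = 0)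
    (hb : num (fun x => G.Adj b x ∧ x ≠ a ∧ x ≠ c ∧ ¬ (G.Adj a x ∧ G.Adj c x)) = 0) :
    Tw G a b := by
  intro x
  have ha' := not_of_num_eq_zero ha x
  have hb' := not_of_num_eq_zero hb x
  have : G.Adj b a := hab.symm
  by_cases e1 : x = a
  · subst e1; simp [this]
  by_cases e2 : x = b
  · subst e2; simp [hab]
  by_cases e3 : x = c
  · subst e3; simp [hbc, hac]
  simp only [e1, e2, false_or]
  tauto

/-- Among three mutually adjacent vertices two are closed twins: otherwise the Gram matrix of
the three vectors is a positive multiple of the all-one matrix plus a diagonal matrix with at least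
two positive entries, so it is nonsingular. -/
theorem Admissible.triangle (hG : Admissible G) {u v w : V} (huv : G.Adj u v) (hvw : G.Adj v w)
    (huw : G.Adj u w) : Tw G u v ∨ Tw G v w ∨ Tw G u w := by
  by_contra hcon
  push Not at hcon
  obtain ⟨h1, h2, h3⟩ := hcon
  have kuv := hG.cn_of_triangle huv hvw huw h1
  have kvw := hG.cn_of_triangle hvw huw.symm huv.symm h2
  have kuw := hG.cn_of_triangle huw hvw.symm huv h3
  have du := degree_of_triangle huv hvw huw
  have dv := degree_of_triangle huv.symm huw hvw
  have dw := degree_of_triangle huw.symm huv hvw.symm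
  have e1 : num (fun x => G.Adj v x ∧ G.Adj w x ∧ G.Adj u x) =
      num (fun x => G.Adj u x ∧ G.Adj v x ∧ G.Adj w x) := num_congr (fun _ => by tauto)
  have e2 : num (fun x => G.Adj u x ∧ G.Adj w x ∧ G.Adj v x) =
      num (fun x => G.Adj u x ∧ G.Adj v x ∧ G.Adj w x) := num_congr (fun _ => by tauto)
  have e3 : num (fun x => G.Adj v x ∧ G.Adj u x ∧ G.Adj w x) =
      num (fun x => G.Adj u x ∧ G.Adj v x ∧ G.Adj w x) := num_congr (fun _ => by tauto)
  have e4 : num (fun x => G.Adj w x ∧ G.Adj u x ∧ G.Adj v x) =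
      num (fun x => G.Adj u x ∧ G.Adj v x ∧ G.Adj w x) := num_congr (fun _ => by tauto)
  rw [e1] at kvw
  rw [e2] at kuw
  rw [e3] at dv
  rw [e4] at dw
  have hdet := hG.det huv.ne huw.ne hvw.ne
  have t1 := tw_of_triangle huv hvw huw
  have t2 := tw_of_triangle hvw huw.symm huv.symm
  have t3 := tw_of_triangle huw hvw.symm huv
  have e5 : num (fun x => G.Adj w x ∧ x ≠ v ∧ x ≠ u ∧ ¬ (G.Adj v x ∧ G.Adj u x)) =
      num (fun x => G.Adj w x ∧ x ≠ u ∧ x ≠ v ∧ ¬ (G.Adj u x ∧ G.Adj v x)) :=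
    num_congr (fun _ => by tauto)
  have e6 : num (fun x => G.Adj v x ∧ x ≠ w ∧ x ≠ u ∧ ¬ (G.Adj w x ∧ G.Adj u x)) =
      num (fun x => G.Adj v x ∧ x ≠ u ∧ x ≠ w ∧ ¬ (G.Adj u x ∧ G.Adj w x)) :=
    num_congr (fun _ => by tauto)
  have e7 : num (fun x => G.Adj u x ∧ x ≠ w ∧ x ≠ v ∧ ¬ (G.Adj w x ∧ G.Adj v x)) =
      num (fun x => G.Adj u x ∧ x ≠ v ∧ x ≠ w ∧ ¬ (G.Adj v x ∧ G.Adj w x)) :=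
    num_congr (fun _ => by tauto)
  rw [e5, e6] at t2
  rw [e7] at t3
  rw [kuv, kvw, kuw, du, dv, dw] at hdet
  rcases two_eq_zero_of_gram_eq_zero (num_nonneg _) (num_nonneg _) (num_nonneg _) (num_nonneg _) hdet
    with ⟨a, b⟩ | ⟨a, b⟩ | ⟨a, b⟩
  · exact h1 (t1 a b)
  · exact h2 (t2 a b)
  · exact h3 (t3 a b)

end Combinatorics

/-! ### The Gram determinant of a path modulo twins -/

section Combinatorics
open scoped Classical
open Finset

variable {V : Type*} [Fintype V]
set_option linter.unusedSectionVars false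
variable {G : SimpleGraph V}

/-- Two vertices are linked if they are adjacent and not closed twins. By
`Admissible.not_adj_of_link` the linked pairs form a triangle-free graph on the twin classes. -/
def Link (G : SimpleGraph V) (u v : V) : Prop := G.Adj u v ∧ ¬ Tw G u v

/-- For a path `z - v - y`, the number of common neighbours of `z` and `y` that are not twins
of `v`. -/
noncomputable def kap (G : SimpleGraph V) (v z y : V) : ℤ :=
  num fun w => G.Adj z w ∧ G.Adj y w ∧ ¬ Tw G v w

/-- The number of neighbours of `z` that are neither twins of `z` nor neighbours of `y`. -/
noncomputable def prv (G : SimpleGraph V) (z y : V) : ℤ :=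
  num fun w => G.Adj z w ∧ ¬ G.Adj y w ∧ ¬ Tw G z w

/-- The number of neighbours of `v` that are twins of none of `v`, `z`, `y`. -/
noncomputable def rst (G : SimpleGraph V) (v z y : V) : ℤ :=
  num fun w => G.Adj v w ∧ ¬ Tw G v w ∧ ¬ Tw G z w ∧ ¬ Tw G y w

theorem Link.symm {u v : V} (h : Link G u v) : Link G v u := ⟨h.1.symm, fun t => h.2 t.symm⟩

theorem Link.congr_left {u u' v : V} (h : Link G u v) (t : Tw G u u') : Link G u' v := by
  refine ⟨t.adj_of_adj h.1 ?_, fun t' => h.2 (t.trans t')⟩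
  rintro rfl
  exact h.2 t

theorem Link.congr_right {u v v' : V} (h : Link G u v) (t : Tw G v v') : Link G u v' :=
  (h.symm.congr_left t).symm

theorem Link.ne {u v : V} (h : Link G u v) : u ≠ v := h.1.ne

theorem not_tw_ne {u v : V} (h : ¬ Tw G u v) : u ≠ v := by
  rintro rfl; exact h (Tw.refl _)

theorem Admissible.not_adj_of_link (hG : Admissible G) {v z y : V} (hz : Link G v z)
    (hy : Link G v y) (hzy : ¬ Tw G z y) : ¬ G.Adj z y := by
  intro h
  rcases hG.triangle hz.1 h hy.1 with t | t | t
  · exact hz.2 t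
  · exact hzy t
  · exact hy.2 t

theorem num_tw_ne (v : V) : num (fun w => Tw G v w ∧ w ≠ v) = wt G v - 1 := by
  have h := num_split (fun w => Tw G v w) (fun w => w = v)
  have h1 : num (fun w => Tw G v w ∧ w = v) = 1 := by
    rw [← num_single v]
    exact num_congr fun w => ⟨fun h => h.2, fun h => ⟨by rw [h]; exact Tw.refl _, h⟩⟩
  unfold wt
  rw [h, h1]; ring

/-- The common neighbours of linked vertices are the other twins of the two. -/
theorem Admissible.cn_link (hG : Admissible G) {v z : V} (h : Link G v z) :
    cn G v z = wt G v + wt G z - 2 := by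
  have e : cn G v z = num (fun w => (Tw G v w ∧ w ≠ v) ∨ (Tw G z w ∧ w ≠ z)) := by
    refine num_congr fun w => ⟨?_, ?_⟩
    · rintro ⟨h1, h2⟩
      rcases hG.triangle h.1 h2 h1 with t | t | t
      · exact absurd t h.2
      · exact Or.inr ⟨t, h2.ne'⟩
      · exact Or.inl ⟨t, h1.ne'⟩
    · rintro (⟨t, hne⟩ | ⟨t, hne⟩)
      · exact ⟨t.adj hne.symm, (h.congr_left t).1.symm⟩
      · exact ⟨(h.congr_right t).1, t.adj hne.symm⟩
  rw [e, num_or, num_tw_ne, num_tw_ne]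
  · ring
  · rintro w ⟨t, _⟩ ⟨t', _⟩
    exact h.2 (t.trans t'.symm)

theorem cn_ends {v z y : V} (hz : Link G v z) (hy : Link G v y) :
    cn G z y = wt G v + kap G v z y := by
  unfold cn wt kap
  rw [← num_or]
  · refine num_congr fun w => ⟨fun h => ?_, ?_⟩
    · by_cases t : Tw G v w
      · exact Or.inl t
      · exact Or.inr ⟨h.1, h.2, t⟩
    · rintro (t | h)
      · exact ⟨(hz.congr_left t).1.symm, (hy.congr_left t).1.symm⟩
      · exact ⟨h.1, h.2.1⟩
  · intro w t h
    exact h.2.2 t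

theorem degree_end {z y : V} (hzy : ¬ G.Adj z y) (hne : z ≠ y) :
    cn G z z = wt G z - 1 + cn G z y + prv G z y := by
  rw [← num_tw_ne]
  unfold cn prv
  rw [← num_or, ← num_or]
  · refine num_congr fun w => ⟨fun h => ?_, ?_⟩
    · by_cases h1 : G.Adj y w
      · exact Or.inl (Or.inr ⟨h.1, h1⟩)
      · by_cases t : Tw G z w
        · exact Or.inl (Or.inl ⟨t, h.1.ne'⟩)
        · exact Or.inr ⟨h.1, h1, t⟩
    · rintro ((⟨t, h⟩ | h) | h)
      · exact ⟨t.adj h.symm, t.adj h.symm⟩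
      · exact ⟨h.1, h.1⟩
      · exact ⟨h.1, h.1⟩
  · rintro w (⟨t, h⟩ | h) h'
    · exact h'.2.2 t
    · exact h'.2.1 h.2
  · rintro w ⟨t, h⟩ h'
    exact hzy (t.symm.adj_of_adj h'.2.symm hne.symm)

theorem degree_center {v z y : V} (hz : Link G v z) (hy : Link G v y) (hzy : ¬ Tw G z y) :
    cn G v v = wt G v - 1 + wt G z + wt G y + rst G v z y := by
  rw [← num_tw_ne]
  unfold cn rst wt
  rw [← num_or, ← num_or, ← num_or]
  · refine num_congr fun w => ⟨fun h => ?_, ?_⟩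
    · by_cases t1 : Tw G v w
      · exact Or.inl (Or.inl (Or.inl ⟨t1, h.1.ne'⟩))
      by_cases t2 : Tw G z w
      · exact Or.inl (Or.inl (Or.inr t2))
      by_cases t3 : Tw G y w
      · exact Or.inl (Or.inr t3)
      · exact Or.inr ⟨h.1, t1, t2, t3⟩
    · rintro (((⟨t, h⟩ | t) | t) | h)
      · exact ⟨t.adj h.symm, t.adj h.symm⟩
      · exact ⟨(hz.congr_right t).1, (hz.congr_right t).1⟩
      · exact ⟨(hy.congr_right t).1, (hy.congr_right t).1⟩
      · exact ⟨h.1, h.1⟩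
  · rintro w ((⟨t, h⟩ | t) | t) h'
    · exact h'.2.1 t
    · exact h'.2.2.1 t
    · exact h'.2.2.2 t
  · rintro w (⟨t, h⟩ | t) t'
    · exact hy.2 (t.trans t'.symm)
    · exact hzy (t.trans t'.symm)
  · rintro w ⟨t, h⟩ t'
    exact hz.2 (t.trans t'.symm)

/-- The polynomial whose vanishing expresses that the Gram determinant of a path is zero. The
weights of the centre and the ends are `n`, `a + 2`, `b + 2`; the ends have `n + k` common
neighbours and `p`, `q` private ones, and the centre has `m` further neighbours. -/
def pathPoly (n a b k p q m : ℤ) : ℤ :=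
  n * (a + q) * (m + 2 + k) + a * (m + 2) * (k + q) + k * q * (m + a + 2)
    + p * ((n + b) * (m + a + 2 + k + q) + (m + a + 2) * (k + q))
    + b * ((n + a + k) * (m + a + 2 + k + q) - (a - k) ^ 2)

theorem pathPoly_symm (n a b k p q m : ℤ) :
    pathPoly n a b k p q m = pathPoly n b a k q p m := by
  unfold pathPoly; ring

/-- The source of all numerical restrictions: the Gram determinant of two linked pairs `v z` and `v
y` is a polynomial in weights and neighbour counts. -/
theorem Admissible.pathPoly_eq_zero (hG : Admissible G) {v z y : V} (hz : Link G v z)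
    (hy : Link G v y) (hzy : ¬ Tw G z y) :
    pathPoly (wt G v) (wt G z - 2) (wt G y - 2) (kap G v z y) (prv G z y) (prv G y z)
      (rst G v z y) = 0 := by
  have hadj := hG.not_adj_of_link hz hy hzy
  have hne := not_tw_ne hzy
  have h := hG.det hz.ne hy.ne hne
  have e1 := hG.cn_link hz
  have e2 := hG.cn_link hy
  have e3 := cn_ends hz hy
  have e4 := degree_end hadj hne
  have e5 := degree_end (fun h => hadj h.symm) hne.symm
  have e6 := degree_center hz hy hzy
  rw [cn_comm y z] at e5
  rw [e4, e5, e6, e1, e2, e3] at h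
  unfold pathPoly
  linear_combination h

/-- The squared distance of the vectors of two ends of a path. -/
theorem Admissible.ends_dist (hG : Admissible G) {v z y : V} (hz : Link G v z)
    (hy : Link G v y) (hzy : ¬ Tw G z y) :
    4 ≤ wt G z + wt G y + prv G z y + prv G y z := by
  have hadj := hG.not_adj_of_link hz hy hzy
  have hne := not_tw_ne hzy
  have h := hG.dist hne
  have e4 := degree_end hadj hne
  have e5 := degree_end (fun h => hadj h.symm) hne.symm
  rw [cn_comm y z] at e5
  linarith

end Combinatorics

section Arithmetic

variable {n a b k p q m : ℤ}

/-- Two heavy ends have weight two and no private neighbours. -/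
theorem pathPoly_heavy_heavy (hn : 1 ≤ n) (ha : 0 ≤ a) (hb : 0 ≤ b) (hk : 0 ≤ k) (hp : 0 ≤ p)
    (hq : 0 ≤ q) (hm : 0 ≤ m) (h : pathPoly n a b k p q m = 0) :
    a = 0 ∧ b = 0 ∧ p = 0 ∧ q = 0 := by
  obtain ⟨n, rfl⟩ : ∃ n', n = n' + 1 := ⟨n - 1, by ring⟩
  have hn : 0 ≤ n := by linarith
  have key : ∀ {a b p q : ℤ}, 0 ≤ a → 0 ≤ b → 0 ≤ p → 0 ≤ q →
      pathPoly (n + 1) a b k p q m = 0 → a = 0 ∧ q = 0 := by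
    intro a b p q ha hb hp hq h
    have e : pathPoly (n + 1) a b k p q m = 2 * (a + q) + ((a + q) * (n * (m + 2 + k) + m + k)
      + a * (m + 2) * (k + q) + k * q * (m + a + 2)
      + p * ((n + 1 + b) * (m + a + 2 + k + q) + (m + a + 2) * (k + q))
      + b * ((n + 1) * (m + a + 2 + k + q) + (a + k) * (m + 2 + q) + 4 * a * k)) := by
      unfold pathPoly; ring
    have : 0 ≤ (a + q) * (n * (m + 2 + k) + m + k)
      + a * (m + 2) * (k + q) + k * q * (m + a + 2)
      + p * ((n + 1 + b) * (m + a + 2 + k + q) + (m + a + 2) * (k + q))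
      + b * ((n + 1) * (m + a + 2 + k + q) + (a + k) * (m + 2 + q) + 4 * a * k) := by positivity
    constructor <;> linarith
  obtain ⟨h1, h2⟩ := key ha hb hp hq h
  rw [pathPoly_symm] at h
  obtain ⟨h3, h4⟩ := key hb ha hq hp h
  exact ⟨h1, h3, h4, h2⟩

/-- A heavy centre between two light ends. -/
theorem pathPoly_light_light (hn : 2 ≤ n) (hk : 0 ≤ k) (hp : 0 ≤ p) (hq : 0 ≤ q) (hm : 0 ≤ m)
    (hpq : 2 ≤ p + q) (h : pathPoly n (-1) (-1) k p q m = 0) :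
    (p = 1 ∧ q = 1) ∨ (p = 0 ∧ k = 0 ∧ m ≤ 1) ∨ (q = 0 ∧ k = 0 ∧ m ≤ 1) := by
  have e : pathPoly n (-1) (-1) k p q m = (p - 1 + (q - 1)) * (n * (m + 2 + k) - 1 + m * k)
      + (p - 1) * (q - 1) * (n + m) := by unfold pathPoly; ring
  rw [e] at h
  have hmk : 0 ≤ m * k := mul_nonneg hm hk
  have hL : 0 < n * (m + 2 + k) - 1 + m * k := by nlinarith
  -- a private neighbour on one side only leaves a divisibility that bounds `k` and `m`
  have key : ∀ q : ℤ, 2 ≤ q → (0 - 1 + (q - 1)) * (n * (m + 2 + k) - 1 + m * k)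
      + (0 - 1) * (q - 1) * (n + m) = 0 → k = 0 ∧ m ≤ 1 := by
    intro q hq h
    have h1 : (q - 2) * (n * (m + 2 + k) - 1 + m * k - (n + m)) = n + m := by linarith
    obtain ⟨t, rfl⟩ : ∃ t, q = t + 2 := ⟨q - 2, by ring⟩
    obtain ⟨N, rfl⟩ : ∃ N, n = N + 2 := ⟨n - 2, by ring⟩
    have hN : 0 ≤ N := by linarith
    have ht : 1 ≤ t := by
      rcases (show 0 ≤ t by linarith).lt_or_eq with h' | h'
      · exact h'
      · rw [← h'] at h1; linarith
    have h2 : t * ((N + 1) * (m + 1) + (N + 2 + m) * k) = N + 2 + m := by linarith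
    have hk0 : k = 0 := by
      by_contra hk0
      have hk1 : 1 ≤ k := by omega
      have : 0 ≤ (t - 1) * ((N + 1) * (m + 1) + (N + 2 + m) * k) := by
        apply mul_nonneg (by linarith); positivity
      nlinarith [mul_nonneg hN hm, mul_nonneg (show 0 ≤ N + 2 + m by linarith)
        (show 0 ≤ k - 1 by linarith)]
    refine ⟨hk0, ?_⟩
    rw [hk0] at h2
    by_contra hm2
    have hm2 : 2 ≤ m := by omega
    rcases ht.lt_or_eq with ht | ht
    · nlinarith [mul_nonneg (show 0 ≤ t - 2 by linarith)
        (show 0 ≤ (N + 1) * (m + 1) by positivity), mul_nonneg hN hm]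
    · rw [← ht] at h2
      have : N * m = 1 := by linarith
      have h3 : N = 0 ∨ 1 ≤ N := by omega
      rcases h3 with h3 | h3
      · rw [h3] at this; norm_num at this
      · nlinarith
  rcases (show p = 0 ∨ 1 ≤ p by omega) with h0 | h0
  · rw [h0] at h
    exact Or.inr (Or.inl ⟨h0, key q (by linarith) h⟩)
  rcases (show q = 0 ∨ 1 ≤ q by omega) with h1 | h1
  · rw [h1] at h
    exact Or.inr (Or.inr ⟨h1, key p (by linarith) (by linarith)⟩)
  · have h2 : 0 ≤ (p - 1) * (q - 1) * (n + m) :=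
      mul_nonneg (mul_nonneg (by linarith) (by linarith)) (by linarith)
    have h3 : 0 ≤ (p - 1 + (q - 1)) * (n * (m + 2 + k) - 1 + m * k) :=
      mul_nonneg (by linarith) hL.le
    have h4 : (p - 1 + (q - 1)) * (n * (m + 2 + k) - 1 + m * k) = 0 := by linarith
    rcases mul_eq_zero.1 h4 with h5 | h5
    · left; constructor <;> linarith
    · exact absurd h5 hL.ne'

/-- A light end and an end of weight two. -/
theorem pathPoly_light_two (hn : 1 ≤ n) (hk : 0 ≤ k) (hp : 0 ≤ p) (hq : 0 ≤ q) (hm : 0 ≤ m)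
    (h : pathPoly n (-1) 0 k p q m = 0) :
    (q = 0 ∧ p = 2 ∧ m = 0 ∧ k = 0) ∨
      (q = 2 ∧ p = 0 ∧ ((n = 2 ∧ k = 0) ∨ (n = 1 ∧ m = 0 ∧ k = 2))) := by
  have hmk : 0 ≤ m * k := mul_nonneg hm hk
  obtain ⟨N, rfl⟩ : ∃ N, n = N + 1 := ⟨n - 1, by ring⟩
  have hN : 0 ≤ N := by linarith
  rcases (show q = 0 ∨ q = 1 ∨ q = 2 ∨ 3 ≤ q by omega) with rfl | rfl | rfl | h3
  · have e : pathPoly (N + 1) (-1) 0 k p 0 m = -(N + 1) * (m + 2 + k) - (m + 2) * k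
      + p * ((N + 1) * (m + 1 + k) + (m + 1) * k) := by unfold pathPoly; ring
    rw [e] at h
    rcases (show p = 0 ∨ p = 1 ∨ p = 2 ∨ 3 ≤ p by omega) with rfl | rfl | rfl | h3
    · exfalso; nlinarith [mul_nonneg hN hk, mul_nonneg hN hm]
    · exfalso; nlinarith
    · have h1 : N * (m + k) + m * k + (m + k) = 0 := by linarith
      have h2 : 0 ≤ N * (m + k) := by positivity
      exact Or.inl ⟨rfl, rfl, by linarith, by linarith⟩
    · exfalso
      obtain ⟨t, rfl⟩ : ∃ t, p = t + 3 := ⟨p - 3, by ring⟩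
      have ht : 0 ≤ t := by linarith
      have h4 : 0 ≤ t * ((N + 1) * (m + 1 + k) + (m + 1) * k) := by positivity
      nlinarith [mul_nonneg hN hk, mul_nonneg hN hm]
  · exfalso
    have e : pathPoly (N + 1) (-1) 0 k p 1 m = -(m + 2) - k
      + p * ((N + 1) * (m + 2 + k) + (m + 1) * (k + 1)) := by unfold pathPoly; ring
    rw [e] at h
    rcases (show p = 0 ∨ 1 ≤ p by omega) with rfl | h1
    · linarith
    · obtain ⟨t, rfl⟩ : ∃ t, p = t + 1 := ⟨p - 1, by ring⟩
      have ht : 0 ≤ t := by linarith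
      have h4 : 0 ≤ t * ((N + 1) * (m + 2 + k) + (m + 1) * (k + 1)) := by positivity
      nlinarith [mul_nonneg hN hk, mul_nonneg hN hm]
  · have e : pathPoly (N + 1) (-1) 0 k p 2 m = (N - 1) * (m + 2) + k * (N + 1 + m)
      + p * ((N + 1) * (m + 3 + k) + (m + 1) * (k + 2)) := by unfold pathPoly; ring
    rw [e] at h
    have hp0 : p = 0 := by
      by_contra hp0
      obtain ⟨t, rfl⟩ : ∃ t, p = t + 1 := ⟨p - 1, by ring⟩
      have ht : 0 ≤ t := by omega
      have h4 : 0 ≤ t * ((N + 1) * (m + 3 + k) + (m + 1) * (k + 2)) := by positivity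
      nlinarith [mul_nonneg hN hk, mul_nonneg hN hm]
    subst hp0
    refine Or.inr ⟨rfl, rfl, ?_⟩
    rcases (show N = 0 ∨ N = 1 ∨ 2 ≤ N by omega) with rfl | rfl | h2
    · right
      have h1 : (k - 1) * (1 + m) = 1 := by linarith
      have hk1 : 2 ≤ k := by
        by_contra hk1
        have : (k - 1) * (1 + m) ≤ 0 := mul_nonpos_of_nonpos_of_nonneg (by omega) (by linarith)
        linarith
      have : m = 0 := by nlinarith
      subst this
      exact ⟨rfl, rfl, by linarith⟩
    · left
      have : k * (2 + m) = 0 := by linarith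
      rcases mul_eq_zero.1 this with h1 | h1
      · exact ⟨rfl, h1⟩
      · linarith
    · exfalso
      nlinarith [mul_nonneg (show 0 ≤ N - 2 by linarith) hm, mul_nonneg hk
        (show 0 ≤ N + 1 + m by linarith)]
  · exfalso
    obtain ⟨s, rfl⟩ : ∃ s, q = s + 3 := ⟨q - 3, by ring⟩
    have hs : 0 ≤ s := by linarith
    have e : pathPoly (N + 1) (-1) 0 k p (s + 3) m =
      N * (s + 2) * (m + 2 + k) - (m + 2) + k * ((m + 2) * (s + 2) - 1)
      + p * ((N + 1) * (m + 4 + k + s) + (m + 1) * (k + s + 3)) := by unfold pathPoly; ring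
    rw [e] at h
    have h1 : 0 ≤ k * ((m + 2) * (s + 2) - 1) := by
      apply mul_nonneg hk; nlinarith [mul_nonneg hm hs]
    have h2 : 0 ≤ N * (s + 2) * (m + 2 + k) := by positivity
    rcases (show p = 0 ∨ 1 ≤ p by omega) with rfl | h3
    · rcases (show N = 0 ∨ 1 ≤ N by omega) with rfl | h4
      · rcases (show k = 0 ∨ 1 ≤ k by omega) with rfl | h5
        · linarith
        · nlinarith [mul_nonneg hm hs, mul_nonneg (show 0 ≤ k - 1 by linarith)
            (show 0 ≤ (m + 2) * (s + 2) - 1 by nlinarith [mul_nonneg hm hs])]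
      · obtain ⟨M, rfl⟩ : ∃ M, N = M + 1 := ⟨N - 1, by ring⟩
        have hM : 0 ≤ M := by linarith
        have : 0 ≤ M * (s + 2) * (m + 2 + k) := by positivity
        nlinarith [mul_nonneg hs hk, mul_nonneg hs hm]
    · obtain ⟨t, rfl⟩ : ∃ t, p = t + 1 := ⟨p - 1, by ring⟩
      have ht : 0 ≤ t := by linarith
      have h4 : 0 ≤ t * ((N + 1) * (m + 4 + k + s) + (m + 1) * (k + s + 3)) := by positivity
      have h5 : 0 ≤ N * (m + 4 + k + s) + (m + 1) * (k + s) := by positivity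
      nlinarith

/-- A light centre, a light end and another end that is heavy and has a private neighbour: the
ends then have a common neighbour besides the centre. -/
theorem pathPoly_light_center (hb : 0 ≤ b) (hp : 0 ≤ p) (hq : 0 ≤ q) (hm : 0 ≤ m)
    (h : pathPoly 1 (-1) b 0 p q m = 0) : q = 0 := by
  have e : pathPoly 1 (-1) b 0 p q m =
      -(m + 2) - b + p * ((1 + b) * (m + 1 + q) + (m + 1) * q) := by unfold pathPoly; ring
  rw [e] at h
  by_contra hq0
  obtain ⟨s, rfl⟩ : ∃ s, q = s + 1 := ⟨q - 1, by ring⟩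
  have hs : 0 ≤ s := by omega
  rcases (show p = 0 ∨ 1 ≤ p by omega) with rfl | h1
  · linarith
  · obtain ⟨t, rfl⟩ : ∃ t, p = t + 1 := ⟨p - 1, by ring⟩
    have ht : 0 ≤ t := by linarith
    have : 0 ≤ t * ((1 + b) * (m + 1 + (s + 1)) + (m + 1) * (s + 1)) := by positivity
    nlinarith [mul_nonneg hb hm, mul_nonneg hb hs, mul_nonneg hm hs]

end Arithmetic

/-! ### Linked vertices with heavy neighbours only -/

section Combinatorics
open scoped Classical
open Finset

variable {V : Type*} [Fintype V]
set_option linter.unusedSectionVars false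
variable {G : SimpleGraph V}

theorem mem_of_connected (hG : G.Connected) {P : V → Prop} {v : V} (hv : P v)
    (h : ∀ u w, P u → G.Adj u w → P w) (w : V) : P w := by
  obtain ⟨p⟩ := hG.preconnected v w
  induction p with
  | nil => exact hv
  | cons e p ih => exact ih (h _ _ hv e)

theorem existsUnique_tw {v : V} (h : wt G v = 2) : ∃! w, Tw G v w ∧ w ≠ v := by
  have h1 : num (fun w => Tw G v w ∧ w ≠ v) = 1 := by rw [num_tw_ne, h]; norm_num
  obtain ⟨w, hw⟩ := exists_of_num_pos (h1 ▸ one_pos)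
  exact ⟨w, hw, fun u hu => eq_of_num_eq_one h1 hu hw⟩

theorem prv_nonneg (z y : V) : 0 ≤ prv G z y := num_nonneg _
theorem kap_nonneg (v z y : V) : 0 ≤ kap G v z y := num_nonneg _
theorem rst_nonneg (v z y : V) : 0 ≤ rst G v z y := num_nonneg _

/-- Without private neighbours of `z`, the links of `z` are links of `y`. -/
theorem link_of_prv_eq_zero {z y w : V} (h : prv G z y = 0) (hzy : ¬ Tw G z y)
    (hadj : ¬ G.Adj z y) (hw : Link G z w) : Link G y w := by
  have h1 := not_of_num_eq_zero h w
  have h2 : G.Adj y w := by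
    by_contra h2
    exact h1 ⟨hw.1, h2, hw.2⟩
  refine ⟨h2, fun t => ?_⟩
  have hzne : z ≠ y := not_tw_ne hzy
  exact hadj (t.symm.adj_of_adj hw.1.symm hzne).symm

/-- Two heavy neighbours of a vertex have weight two and the same neighbours. -/
theorem Admissible.heavy_heavy (hG : Admissible G) {v z y : V} (hz : Link G v z) (hy : Link G v y)
    (hzy : ¬ Tw G z y) (wz : 2 ≤ wt G z) (wy : 2 ≤ wt G y) :
    wt G z = 2 ∧ wt G y = 2 ∧ ∀ w, Link G z w ↔ Link G y w := by
  have h := hG.pathPoly_eq_zero hz hy hzy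
  obtain ⟨h1, h2, h3, h4⟩ := pathPoly_heavy_heavy (one_le_wt v) (by linarith) (by linarith)
    (kap_nonneg v z y) (prv_nonneg z y) (prv_nonneg y z) (rst_nonneg v z y) h
  have hadj := hG.not_adj_of_link hz hy hzy
  exact ⟨by linarith, by linarith, fun w => ⟨fun hw => link_of_prv_eq_zero h3 hzy hadj hw,
    fun hw => link_of_prv_eq_zero h4 (fun t => hzy t.symm) (fun h => hadj h.symm) hw⟩⟩

/-- The structure of a blown-up complete bipartite graph with sides `Link x` and `Link y`. -/
structure BipBlowup (G : SimpleGraph V) (x y : V) : Prop where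
  link : Link G x y
  left : ∀ y', Link G x y' → ∀ w, Link G y' w ↔ Link G y w
  right : ∀ x', Link G y x' → ∀ w, Link G x' w ↔ Link G x w

theorem BipBlowup.symm {x y : V} (h : BipBlowup G x y) : BipBlowup G y x :=
  ⟨h.link.symm, h.right, h.left⟩

theorem BipBlowup.cover {x y : V} (h : BipBlowup G x y) (hG : G.Connected) (v : V) :
    Link G x v ∨ Link G y v := by
  refine mem_of_connected hG (v := x) (P := fun v => Link G x v ∨ Link G y v)
    (Or.inr h.link.symm) ?_ v
  rintro u w (hu | hu) huw
  · by_cases t : Tw G u w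
    · exact Or.inl (hu.congr_right t)
    · exact Or.inr ((h.left u hu w).1 ⟨huw, t⟩)
  · by_cases t : Tw G u w
    · exact Or.inr (hu.congr_right t)
    · exact Or.inl ((h.right u hu w).1 ⟨huw, t⟩)

theorem BipBlowup.not_both (hG : Admissible G) {x y v : V} (h : BipBlowup G x y)
    (h1 : Link G x v) (h2 : Link G y v) : False :=
  hG.not_adj_of_link h1 h.link (fun t => h2.2 t.symm) h2.1.symm

/-- The structural form of type (ii): a clique joined to a matching. -/
structure IsCone (G : SimpleGraph V) (P : V → Prop) : Prop where
  nonempty : ∃ v, P v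
  join : ∀ u v, P u → u ≠ v → G.Adj u v
  matching : ∀ v, ¬ P v → ∃! w, ¬ P w ∧ G.Adj v w

/-- The structural form of type (iii): the join of two matchings. -/
structure IsMatchingJoin (G : SimpleGraph V) (P : V → Prop) : Prop where
  join : ∀ u v, P u → ¬ P v → G.Adj u v
  matching : ∀ v, ∃! w, (P w ↔ P v) ∧ G.Adj v w
  left : ∃ u v, P u ∧ P v ∧ u ≠ v ∧ ¬ G.Adj u v
  right : ∃ u v, ¬ P u ∧ ¬ P v ∧ u ≠ v ∧ ¬ G.Adj u v

/-- If one side of a blown-up complete bipartite graph is a single twin class and the other consists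
of classes of size two, then the graph is a cone over a matching. -/
theorem BipBlowup.isCone (hG : Admissible G) {x y : V} (h : BipBlowup G x y)
    (hX : ∀ x', Link G y x' → Tw G x x') (hY : ∀ y', Link G x y' → wt G y' = 2) :
    IsCone G (Tw G x) := by
  have cov : ∀ v, Link G x v ∨ Tw G x v := fun v =>
    (h.cover hG.connected v).imp_right (hX v)
  refine ⟨⟨x, Tw.refl x⟩, fun u v hu huv => ?_, fun v hv => ?_⟩
  · rcases cov v with hv | hv
    · exact (hv.congr_left hu).1
    · exact (hu.symm.trans hv).adj huv
  · have lv := (cov v).resolve_right hv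
    obtain ⟨w, hw, hu⟩ := existsUnique_tw (hY v lv)
    refine ⟨w, ⟨fun t => hv (t.trans hw.1.symm), hw.1.adj hw.2.symm⟩, ?_⟩
    rintro u ⟨hu1, hu2⟩
    refine hu u ⟨?_, hu2.ne'⟩
    by_contra t
    exact hu1 (hX u ((h.left v lv u).1 ⟨hu2, t⟩))

/-- A side with several twin classes consists of classes of size two; the graph being incomplete, at
least one side is of this kind. -/
theorem BipBlowup.classify (hG : Admissible G) (hN : ∃ u v, u ≠ v ∧ ¬ G.Adj u v) {x y : V}
    (h : BipBlowup G x y)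
    (hX : (∃ x', Link G y x' ∧ ¬ Tw G x x') → ∀ x', Link G y x' → wt G x' = 2)
    (hY : (∃ y', Link G x y' ∧ ¬ Tw G y y') → ∀ y', Link G x y' → wt G y' = 2) :
    (∃ P, IsCone G P) ∨ ∃ P, IsMatchingJoin G P := by
  by_cases mX : ∃ x', Link G y x' ∧ ¬ Tw G x x'
  · by_cases mY : ∃ y', Link G x y' ∧ ¬ Tw G y y'
    · right
      refine ⟨Link G y, fun u v hu hv => ?_, fun v => ?_, ?_, ?_⟩
      · have := (h.cover hG.connected v).resolve_right hv
        exact ((h.right u hu v).2 this).1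
      · have hw2 : wt G v = 2 := (h.cover hG.connected v).elim (hY mY v) (hX mX v)
        obtain ⟨w, hw, hu⟩ := existsUnique_tw hw2
        refine ⟨w, ⟨⟨fun l => l.congr_right hw.1.symm, fun l => l.congr_right hw.1⟩,
          hw.1.adj hw.2.symm⟩, ?_⟩
        rintro u ⟨hu1, hu2⟩
        refine hu u ⟨?_, hu2.ne'⟩
        by_contra t
        by_cases hv : Link G y v
        · exact h.not_both hG ((h.right v hv u).1 ⟨hu2, t⟩) (hu1.2 hv)
        · have hv' := (h.cover hG.connected v).resolve_right hv
          exact hv (hu1.1 ((h.left v hv' u).1 ⟨hu2, t⟩))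
      · obtain ⟨x', h1, h2⟩ := mX
        exact ⟨x, x', h.link.symm, h1, not_tw_ne h2, hG.not_adj_of_link h.link.symm h1 h2⟩
      · obtain ⟨y', h1, h2⟩ := mY
        exact ⟨y, y', fun l => l.ne rfl, fun l => h.not_both hG h1 l, not_tw_ne h2,
          hG.not_adj_of_link h.link h1 h2⟩
    · left
      refine ⟨_, h.symm.isCone hG (fun y' hy' => ?_) (hX mX)⟩
      by_contra t
      exact mY ⟨y', hy', t⟩
  · have hX' : ∀ x', Link G y x' → Tw G x x' := fun x' hx' => by
      by_contra t
      exact mX ⟨x', hx', t⟩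
    by_cases mY : ∃ y', Link G x y' ∧ ¬ Tw G y y'
    · exact Or.inl ⟨_, h.isCone hG hX' (hY mY)⟩
    · exfalso
      have hY' : ∀ y', Link G x y' → Tw G y y' := fun y' hy' => by
        by_contra t
        exact mY ⟨y', hy', t⟩
      obtain ⟨u, v, huv, hadj⟩ := hN
      apply hadj
      rcases h.cover hG.connected u with hu | hu <;> rcases h.cover hG.connected v with hv | hv
      · exact ((hY' u hu).symm.trans (hY' v hv)).adj huv
      · exact (hu.symm.congr_right (hX' v hv)).1
      · exact (hv.congr_left (hX' u hu)).1
      · exact ((hX' u hu).symm.trans (hX' v hv)).adj huv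

/-- If all neighbours of `x` are heavy, they have the same neighbours. -/
theorem Admissible.left_of_heavy (hG : Admissible G) {x y : V} (hxy : Link G x y)
    (hx : ∀ w, Link G x w → 2 ≤ wt G w) (y' : V) (hy' : Link G x y') (w : V) :
    Link G y' w ↔ Link G y w := by
  by_cases t : Tw G y y'
  · exact ⟨fun l => l.congr_left t.symm, fun l => l.congr_left t⟩
  · exact ((hG.heavy_heavy hxy hy' t (hx _ hxy) (hx _ hy')).2.2 w).symm

theorem Admissible.weight_of_heavy (hG : Admissible G) {x y : V} (hxy : Link G x y)
    (hx : ∀ w, Link G x w → 2 ≤ wt G w) (hm : ∃ y', Link G x y' ∧ ¬ Tw G y y') (z : V)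
    (hz : Link G x z) : wt G z = 2 := by
  obtain ⟨y', hy', t⟩ := hm
  by_cases t' : Tw G y z
  · have := (hG.heavy_heavy hxy hy' t (hx _ hxy) (hx _ hy')).1
    rwa [wt_congr t'] at this
  · exact (hG.heavy_heavy hxy hz t' (hx _ hxy) (hx _ hz)).2.1

/-- Two linked vertices all of whose neighbours are heavy. -/
theorem Admissible.classify_heavy (hG : Admissible G) (hN : ∃ u v, u ≠ v ∧ ¬ G.Adj u v) {x y : V}
    (hxy : Link G x y) (hx : ∀ w, Link G x w → 2 ≤ wt G w) (hy : ∀ w, Link G y w → 2 ≤ wt G w) :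
    (∃ P, IsCone G P) ∨ ∃ P, IsMatchingJoin G P :=
  BipBlowup.classify hG hN
    ⟨hxy, hG.left_of_heavy hxy hx, hG.left_of_heavy hxy.symm hy⟩
    (hG.weight_of_heavy hxy.symm hy) (hG.weight_of_heavy hxy hx)

/-! ### Heavy vertices with a light and a heavy neighbour -/

theorem wt_eq_one_or (v : V) : wt G v = 1 ∨ 2 ≤ wt G v := by
  have := one_le_wt (G := G) v
  omega

theorem not_tw_of_wt_ne {u v : V} (h : wt G u ≠ wt G v) : ¬ Tw G u v := fun t => h (wt_congr t)

theorem kap_comm (v z y : V) : kap G v z y = kap G v y z :=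
  num_congr fun _ => ⟨fun h => ⟨h.2.1, h.1, h.2.2⟩, fun h => ⟨h.2.1, h.1, h.2.2⟩⟩

theorem rst_comm (v z y : V) : rst G v z y = rst G v y z :=
  num_congr fun _ => ⟨fun h => ⟨h.1, h.2.1, h.2.2.2, h.2.2.1⟩,
    fun h => ⟨h.1, h.2.1, h.2.2.2, h.2.2.1⟩⟩

/-- A light end and an end of weight two. -/
theorem Admissible.light_two (hG : Admissible G) {v z y : V} (hz : Link G v z) (hy : Link G v y)
    (hzy : ¬ Tw G z y) (wz : wt G z = 1) (wy : wt G y = 2) :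
    (prv G y z = 0 ∧ prv G z y = 2 ∧ rst G v z y = 0 ∧ kap G v z y = 0) ∨
      (prv G y z = 2 ∧ prv G z y = 0 ∧
        ((wt G v = 2 ∧ kap G v z y = 0) ∨ (wt G v = 1 ∧ rst G v z y = 0 ∧ kap G v z y = 2))) := by
  have h := hG.pathPoly_eq_zero hz hy hzy
  rw [wz, wy] at h
  exact pathPoly_light_two (one_le_wt v) (kap_nonneg v z y) (prv_nonneg z y) (prv_nonneg y z)
    (rst_nonneg v z y) h

/-- In a path with a light centre, a light end and a heavy end, the latter has no private neighbour
if all common neighbours of the ends are twins of the centre. -/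
theorem Admissible.light_center (hG : Admissible G) {v z y : V} (hz : Link G v z)
    (hy : Link G v y) (hzy : ¬ Tw G z y) (wv : wt G v = 1) (wz : wt G z = 1) (wy : 2 ≤ wt G y)
    (hk : kap G v z y = 0) : prv G y z = 0 := by
  have h := hG.pathPoly_eq_zero hz hy hzy
  rw [wz, wv, hk] at h
  exact pathPoly_light_center (b := wt G y - 2) (by linarith) (prv_nonneg z y) (prv_nonneg y z)
    (rst_nonneg v z y) h

/-- If a heavy vertex `h` has, up to twins, only the neighbours `z` and `y`, then a light `z` has
no private neighbour. -/
theorem Admissible.no_private (hG : Admissible G) {h z y w : V} (hz : Link G h z)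
    (hy : Link G h y) (hzy : ¬ Tw G z y) (wh : 2 ≤ wt G h) (wz : wt G z = 1)
    (hr : rst G h z y = 0) (hw : Link G z w) (hyw : ¬ G.Adj y w) : False := by
  have hhw : ¬ Tw G w h := fun t => hyw (hy.congr_left t.symm).1.symm
  rcases wt_eq_one_or (G := G) w with ww | ww
  · have hna := hG.not_adj_of_link hw hz.symm hhw
    have hk : kap G z w h = 0 := by
      refine num_eq_zero fun u hu => ?_
      have h1 : ¬ Tw G h u := by
        intro t
        exact hna (t.symm.adj_of_adj hu.1.symm (not_tw_ne hhw)).symm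
      have h2 : Tw G y u := by
        by_contra h2
        exact not_of_num_eq_zero hr u ⟨hu.2.1, h1, hu.2.2, h2⟩
      refine hyw (h2.symm.adj_of_adj hu.1.symm ?_)
      rintro rfl
      exact hna hy.1.symm
    have := hG.light_center hw hz.symm hhw wz ww wh hk
    exact not_of_num_eq_zero this y ⟨hy.1, fun h => hyw h.symm, hy.2⟩
  · have := (hG.heavy_heavy hw hz.symm hhw ww wh).2.2 y
    exact hyw (this.2 hy).1.symm

/-- An end of a path without private neighbours, and without common neighbours with the other end
beyond the twins of the centre, is linked to twins of the centre only. -/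
theorem leaf_of_prv_kap {h z y w : V} (hp : prv G z y = 0) (hk : kap G h z y = 0)
    (hw : Link G z w) : Tw G h w := by
  have h1 : G.Adj y w := by
    by_contra h1
    exact not_of_num_eq_zero hp w ⟨hw.1, h1, hw.2⟩
  by_contra h2
  exact not_of_num_eq_zero hk w ⟨hw.1, h1, h2⟩

/-- A heavy vertex does not have both a light neighbour and one of weight two. -/
theorem Admissible.no_light_two (hG : Admissible G) {h z y : V} (hz : Link G h z)
    (hy : Link G h y) (wh : 2 ≤ wt G h) (wz : wt G z = 1) (wy : wt G y = 2) : False := by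
  have hzy : ¬ Tw G z y := not_tw_of_wt_ne (by rw [wz, wy]; norm_num)
  rcases hG.light_two hz hy hzy wz wy with ⟨-, h2, h3, -⟩ | ⟨h1, h2, h3⟩
  · obtain ⟨w, hw⟩ := exists_of_num_pos (show 0 < prv G z y by rw [h2]; norm_num)
    exact hG.no_private hz hy hzy wh wz h3 ⟨hw.1, hw.2.2⟩ hw.2.1
  obtain ⟨h4, h5⟩ : wt G h = 2 ∧ kap G h z y = 0 := by
    rcases h3 with h3 | h3
    · exact h3
    · rw [h3.1] at wh; norm_num at wh
  obtain ⟨w, hw⟩ := exists_of_num_pos (show 0 < prv G y z by rw [h1]; norm_num)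
  have lw : Link G y w := ⟨hw.1, hw.2.2⟩
  have hwh : ¬ Tw G w h := fun t => hw.2.1 (hz.congr_left t.symm).1.symm
  rcases wt_eq_one_or (G := G) w with ww | ww
  swap
  · exact hw.2.1 (((hG.heavy_heavy lw hy.symm hwh ww wh).2.2 z).2 hz).1.symm
  have hq : prv G h w = 2 := by
    rcases hG.light_two lw hy.symm hwh ww h4 with ⟨h6, -⟩ | ⟨h6, -⟩
    · exact absurd ⟨hz.1, fun h => hw.2.1 h.symm, hz.2⟩ (not_of_num_eq_zero h6 z)
    · exact h6
  -- a second private neighbour of `h` would be a leaf with the same neighbours as `z`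
  obtain ⟨z', hz', hne⟩ : ∃ z', (G.Adj h z' ∧ ¬ G.Adj w z' ∧ ¬ Tw G h z') ∧ z' ≠ z := by
    by_contra hcon
    have h7 : prv G h w ≤ 1 := by
      rw [← num_single z]
      refine num_mono fun u hu => ?_
      by_contra hne
      exact hcon ⟨u, hu, hne⟩
    linarith
  have lz' : Link G h z' := ⟨hz'.1, hz'.2.2⟩
  have hzz' : ¬ Tw G z z' := fun t => hne (eq_of_tw wz t)
  have hz'y : ¬ Tw G z' y := fun t => hz'.2.1 (lw.congr_left t.symm).1.symm
  rcases wt_eq_one_or (G := G) z' with wz' | wz'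
  swap
  · exact hz'.2.1 (((hG.heavy_heavy lz' hy hz'y wz' (by linarith)).2.2 w).2 lw).1.symm
  rcases hG.light_two lz' hy hz'y wz' wy with ⟨-, -, h8, -⟩ | ⟨-, h8, h9⟩
  · exact not_of_num_eq_zero h8 z ⟨hz.1, hz.2, fun t => hzz' t.symm, fun t => hzy t.symm⟩
  have h10 : kap G h z' y = 0 := by
    rcases h9 with h9 | h9
    · exact h9.2
    · rw [h9.1] at h4; norm_num at h4
  have e1 : prv G z z' = 0 := num_eq_zero fun u hu =>
    hu.2.1 (lz'.congr_left (leaf_of_prv_kap h2 h5 ⟨hu.1, hu.2.2⟩)).1.symm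
  have e2 : prv G z' z = 0 := num_eq_zero fun u hu =>
    hu.2.1 (hz.congr_left (leaf_of_prv_kap h8 h10 ⟨hu.1, hu.2.2⟩)).1.symm
  have := hG.ends_dist hz lz' hzz'
  rw [wz, wz', e1, e2] at this
  norm_num at this

/-- A heavy centre, a light end and an end of weight at least three. -/
theorem pathPoly_light_heavy {n b k p q m : ℤ} (hn : 2 ≤ n) (hb : 1 ≤ b) (hk : 0 ≤ k)
    (hp : 0 ≤ p) (hq : 0 ≤ q) (hm : 0 ≤ m) (h : pathPoly n (-1) b k p q m = 0) :
    (q = 0 ∨ n = 2) ∧ (1 ≤ m → p = 0) := by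
  obtain ⟨N, rfl⟩ : ∃ N, n = N + 2 := ⟨n - 2, by ring⟩
  obtain ⟨B, rfl⟩ : ∃ B, b = B + 1 := ⟨b - 1, by ring⟩
  have hN : 0 ≤ N := by linarith
  have hB : 0 ≤ B := by linarith
  rcases (show q = 0 ∨ 1 ≤ q by omega) with rfl | h1
  · refine ⟨Or.inl rfl, fun h2 => ?_⟩
    obtain ⟨M, rfl⟩ : ∃ M, m = M + 1 := ⟨m - 1, by ring⟩
    have hM : 0 ≤ M := by linarith
    rcases (show p = 0 ∨ 1 ≤ p by omega) with rfl | h1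
    · rfl
    · exfalso
      obtain ⟨P, rfl⟩ : ∃ P, p = P + 1 := ⟨p - 1, by ring⟩
      have hP : 0 ≤ P := by linarith
      have e : pathPoly (N + 2) (-1) (B + 1) k (P + 1) 0 (M + 1) =
          (N + 1) * (1 + k) + (N + 2 + k) * M + B * ((N + 2 + k) * (M + 1) + (N + 1) * (1 + k))
          + P * ((N + 2 + B + 1) * (M + 2 + k) + (M + 2) * k) := by unfold pathPoly; ring
      rw [e] at h
      have : 0 ≤ N + k + N * k + (N + 2 + k) * M + B * ((N + 2 + k) * (M + 1) + (N + 1) * (1 + k))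
          + P * ((N + 2 + B + 1) * (M + 2 + k) + (M + 2) * k) := by positivity
      linarith
  · obtain ⟨Q, rfl⟩ : ∃ Q, q = Q + 1 := ⟨q - 1, by ring⟩
    have hQ : 0 ≤ Q := by linarith
    have e : pathPoly (N + 2) (-1) (B + 1) k p (Q + 1) m =
        N * Q * (m + 2 + k) + N * (m + 2 + k + Q) * (B + 1) + Q * (m + 3)
        + k * (3 * Q + Q * (m + 1)) - 1
        + B * (1 + k) * (m + 1 + Q) + k * m
        + p * ((N + 2 + B + 1) * (m + 1 + k + Q + 1) + (m + 1) * (k + Q + 1)) := by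
      unfold pathPoly; ring
    rw [e] at h
    have h0 : 0 ≤ p * ((N + 2 + B + 1) * (m + 1 + k + Q + 1) + (m + 1) * (k + Q + 1)) := by
      positivity
    have h2 : 0 ≤ N * Q * (m + 2 + k) := by positivity
    have h3 : 0 ≤ Q * (m + 3) := by positivity
    have h4 : 0 ≤ k * (3 * Q + Q * (m + 1)) := by positivity
    have h5 : 0 ≤ B * (1 + k) * (m + 1 + Q) := by positivity
    have h6 : 0 ≤ k * m := by positivity
    have h7 : 0 ≤ N * (m + 2 + k + Q) * B := by positivity
    have h8 : 0 ≤ N * (m + k + Q) := by positivity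
    refine ⟨Or.inr (by linarith [show N = 0 by linarith]), fun h2 => ?_⟩
    by_contra hp0
    obtain ⟨P, rfl⟩ : ∃ P, p = P + 1 := ⟨p - 1, by ring⟩
    have hP : 0 ≤ P := by omega
    have : 0 ≤ P * ((N + 2 + B + 1) * (m + 1 + k + Q + 1) + (m + 1) * (k + Q + 1)) := by positivity
    have : 0 ≤ (N + 2 + B) * (m + 1 + k + Q + 1) + (m + 1) * (k + Q) := by positivity
    linarith

/-- A heavy vertex with a light neighbour `z` and a heavy neighbour `y`: it has no others, and
the two have the same neighbours. -/
theorem Admissible.light_heavy (hG : Admissible G) {h z y : V} (hz : Link G h z)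
    (hy : Link G h y) (wh : 2 ≤ wt G h) (wz : wt G z = 1) (wy : 2 ≤ wt G y) :
    3 ≤ wt G y ∧ prv G z y = 0 ∧ prv G y z = 0 ∧ rst G h z y = 0 := by
  have wy3 : 3 ≤ wt G y := by
    by_contra hcon
    exact hG.no_light_two hz hy wh wz (by omega)
  have hnt : ∀ {z}, wt G z = 1 → ¬ Tw G z y := fun wz => not_tw_of_wt_ne (by rw [wz]; omega)
  have key : ∀ {z}, Link G h z → wt G z = 1 →
      prv G y z = 0 ∧ (1 ≤ rst G h z y → prv G z y = 0) := by
    intro z hz wz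
    have e := hG.pathPoly_eq_zero hz hy (hnt wz)
    rw [wz] at e
    obtain ⟨h1, h2⟩ := pathPoly_light_heavy wh (b := wt G y - 2) (by linarith) (kap_nonneg h z y)
      (prv_nonneg z y) (prv_nonneg y z) (rst_nonneg h z y) e
    refine ⟨?_, h2⟩
    rcases h1 with h1 | h1
    · exact h1
    by_contra hne
    obtain ⟨w, hw⟩ := exists_of_num_pos (lt_of_le_of_ne (prv_nonneg y z) (Ne.symm hne))
    have hwh : ¬ Tw G w h := fun t => hw.2.1 (hz.congr_left t.symm).1.symm
    rcases wt_eq_one_or (G := G) w with ww | ww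
    · exact hG.no_light_two ⟨hw.1, hw.2.2⟩ hy.symm wy ww h1
    · exact hw.2.1 (((hG.heavy_heavy ⟨hw.1, hw.2.2⟩ hy.symm hwh ww wh).2.2 z).2 hz).1.symm
  have hr : rst G h z y = 0 := by
    by_contra hne
    obtain ⟨u, hu⟩ := exists_of_num_pos (lt_of_le_of_ne (rst_nonneg h z y) (Ne.symm hne))
    have lu : Link G h u := ⟨hu.1, hu.2.1⟩
    have wu : wt G u = 1 := by
      rcases wt_eq_one_or (G := G) u with ww | ww
      · exact ww
      · have := (hG.heavy_heavy hy lu hu.2.2.2 wy ww).1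
        omega
    have p1 := (key hz wz).2 (one_le_num hu)
    have p2 : prv G u y = 0 := (key lu wu).2 (one_le_num (w := z)
      ⟨hz.1, hz.2, fun t => hu.2.2.1 t.symm, fun t => hnt wz t.symm⟩)
    have sub : ∀ {z u}, Link G h z → wt G z = 1 → prv G z y = 0 → prv G y u = 0 →
        prv G z u = 0 := by
      intro z u hz wz p1 p2
      refine num_eq_zero fun w hw => ?_
      have := link_of_prv_eq_zero p1 (hnt wz) (hG.not_adj_of_link hz hy (hnt wz)) ⟨hw.1, hw.2.2⟩
      exact not_of_num_eq_zero p2 w ⟨this.1, hw.2.1, this.2⟩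
    have := hG.ends_dist hz lu hu.2.2.1
    rw [sub hz wz p1 (key lu wu).1, sub lu wu p2 (key hz wz).1, wz, wu] at this
    norm_num at this
  refine ⟨wy3, ?_, (key hz wz).1, hr⟩
  refine num_eq_zero fun w hw => ?_
  exact hG.no_private hz hy (hnt wz) wh wz hr ⟨hw.1, hw.2.2⟩ hw.2.1

/-- The structure of a path of cliques: `P` is completely joined to `Q`, and `Q` to the single
vertex `z`. -/
structure IsCliquePath (G : SimpleGraph V) (P Q : V → Prop) (z : V) : Prop where
  cover : ∀ v, P v ∨ Q v ∨ v = z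
  disj : ∀ v, P v → ¬ Q v
  notP : ¬ P z
  notQ : ¬ Q z
  adj_P : ∀ u v, P u → P v → u ≠ v → G.Adj u v
  adj_PQ : ∀ u v, P u → Q v → G.Adj u v
  adj_Q : ∀ u v, Q u → Q v → u ≠ v → G.Adj u v
  adj_Qz : ∀ v, Q v → G.Adj v z
  not_adj_Pz : ∀ v, P v → ¬ G.Adj v z

theorem num_eq_one {p : V → Prop} {w : V} (hw : p w) (h : ∀ u, p u → u = w) : num p = 1 := by
  rw [← num_single w]
  exact num_congr fun u => ⟨h u, fun e => e ▸ hw⟩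

/-- A heavy vertex with a light and a heavy neighbour: the light vertex, the twins of `h` and the
twins of `y` form a path of cliques, and the remaining equation between the two weights has three
solutions. -/
theorem Admissible.classify_light_heavy (hG : Admissible G) {h z y : V} (hz : Link G h z)
    (hy : Link G h y) (wh : 2 ≤ wt G h) (wz : wt G z = 1) (wy : 2 ≤ wt G y) :
    ∃ P Q : V → Prop, IsCliquePath G P Q z ∧
      ((num P = 8 ∧ num Q = 3) ∨ (num P = 6 ∧ num Q = 4) ∨ (num P = 5 ∧ num Q = 6)) := by
  obtain ⟨wy3, hp, hq, hr⟩ := hG.light_heavy hz hy wh wz wy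
  have hzy : ¬ Tw G z y := not_tw_of_wt_ne (by rw [wz]; omega)
  have e := hG.pathPoly_eq_zero hz hy hzy
  rw [wz, hp, hq, hr] at e
  -- with no common neighbours of `z` and `y` beyond the twins of `h`, these classes are the whole
  -- graph; otherwise a light common neighbour `w` is in the same position with respect to `y`
  by_cases hk : kap G h z y = 0
  · have leafz : ∀ w, Link G z w → Tw G h w := fun w hw => leaf_of_prv_kap hp hk hw
    have leafy : ∀ w, Link G y w → Tw G h w := fun w hw =>
      leaf_of_prv_kap hq (by rwa [kap_comm]) hw
    have lh : ∀ w, Link G h w → Tw G y w ∨ w = z := fun w hw => by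
      by_contra hcon
      rw [not_or] at hcon
      exact not_of_num_eq_zero hr w ⟨hw.1, hw.2, fun t => hcon.2 (eq_of_tw wz t), hcon.1⟩
    refine ⟨Tw G y, Tw G h, ⟨?_, ?_, fun t => hzy t.symm, hz.2, ?_, ?_, ?_, ?_, ?_⟩, ?_⟩
    · intro v
      refine mem_of_connected hG.connected (v := z)
        (P := fun v => Tw G y v ∨ Tw G h v ∨ v = z) (Or.inr (Or.inr rfl)) ?_ v
      rintro u w (t | t | rfl) huw
      · by_cases t' : Tw G u w
        · exact Or.inl (t.trans t')
        · exact Or.inr (Or.inl (leafy w (Link.congr_left ⟨huw, t'⟩ t.symm)))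
      · by_cases t' : Tw G u w
        · exact Or.inr (Or.inl (t.trans t'))
        · exact (lh w (Link.congr_left ⟨huw, t'⟩ t.symm)).imp_right Or.inr
      · by_cases t' : Tw G u w
        · exact absurd (eq_of_tw wz t') huw.ne'
        · exact Or.inr (Or.inl (leafz w ⟨huw, t'⟩))
    · exact fun v t t' => hy.2 (t'.trans t.symm)
    · exact fun u v t t' hne => (t.symm.trans t').adj hne
    · exact fun u v t t' => ((hy.congr_left t').congr_right t).1.symm
    · exact fun u v t t' hne => (t.symm.trans t').adj hne
    · exact fun v t => (hz.congr_left t).1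
    · exact fun v t hadj => hG.not_adj_of_link hz (hy.congr_right t) (fun t' => hzy (t'.trans t.symm))
        hadj.symm
    · change (wt G y = 8 ∧ wt G h = 3) ∨ (wt G y = 6 ∧ wt G h = 4) ∨ (wt G y = 5 ∧ wt G h = 6)
      rw [hk] at e
      have e' : (wt G y - 4) * (wt G h - 2) = 4 := by
        unfold pathPoly at e; linear_combination e
      generalize wt G y = a at *
      generalize wt G h = c at *
      have hc : 1 ≤ c - 2 := by
        by_contra hcon
        have : c - 2 = 0 := by omega
        rw [this] at e'; norm_num at e'
      have ha : 1 ≤ a - 4 := by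
        by_contra hcon
        nlinarith
      have ha' : a - 4 ≤ 4 := by nlinarith
      have : a = 5 ∨ a = 6 ∨ a = 7 ∨ a = 8 := by omega
      rcases this with rfl | rfl | rfl | rfl <;> omega
  · exfalso
    obtain ⟨w, hw⟩ := exists_of_num_pos (lt_of_le_of_ne (kap_nonneg h z y) (Ne.symm hk))
    have hzny := hG.not_adj_of_link hz hy hzy
    have lw : Link G y w := ⟨hw.2.1, fun t =>
      hzny (t.symm.adj_of_adj hw.1.symm (not_tw_ne hzy)).symm⟩
    have lzw : Link G z w := ⟨hw.1, fun t => hzny ((eq_of_tw wz t) ▸ hw.2.1).symm⟩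
    have hwh : ¬ Tw G w h := fun t => hw.2.2 t.symm
    have pos : ∀ {n b k : ℤ}, 1 ≤ k → n = 2 → pathPoly n (-1) b k 0 0 0 ≠ 0 := by
      intro n b k hk hn h
      subst hn
      unfold pathPoly at h
      linarith
    have hk1 : 1 ≤ kap G h z y := one_le_num hw
    have hh3 : wt G h ≠ 2 := fun h2 => pos hk1 h2 e
    have ww : wt G w = 1 := by
      rcases wt_eq_one_or (G := G) w with ww | ww
      · exact ww
      · exact absurd (hG.heavy_heavy hy.symm lw (fun t => hwh t.symm) wh ww).1 hh3
    obtain ⟨-, hp', hq', hr'⟩ := hG.light_heavy lw hy.symm wy ww wh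
    have e' := hG.pathPoly_eq_zero lw hy.symm hwh
    have k1 : kap G h z y = 1 := num_eq_one hw fun u hu => by
      have hyu : ¬ Tw G y u := fun t =>
        hzny (t.symm.adj_of_adj hu.1.symm (not_tw_ne hzy)).symm
      by_contra hne
      exact not_of_num_eq_zero hr' u ⟨hu.2.1, hyu, fun t => hne (eq_of_tw ww t), hu.2.2⟩
    have k2 : kap G y w h = 1 := num_eq_one (w := z) ⟨hw.1.symm, hz.1, fun t => hzy t.symm⟩
      fun u hu => by
        have hhu : ¬ Tw G h u := fun t => hG.not_adj_of_link lw hy.symm hwh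
          (t.symm.adj_of_adj hu.1.symm (not_tw_ne hwh)).symm
        by_contra hne
        exact not_of_num_eq_zero hr u ⟨hu.2.1, hhu, fun t => hne (eq_of_tw wz t), hu.2.2⟩
    rw [ww, hp', hq', hr', k2] at e'
    rw [k1] at e
    unfold pathPoly at e e'
    generalize wt G y = a at *
    generalize wt G h = c at *
    -- the equations at `h` and at `y` are interchanged by exchanging the two weights
    have hac : a = c := by linarith
    subst hac
    have e3 : 2 * a * a = 11 * a - 6 := by linarith
    have : a ≤ 5 := by nlinarith
    interval_cases a <;> omega

/-- Graphs with two heavy vertices that are adjacent and not twins. -/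
theorem Admissible.classify_link_heavy (hG : Admissible G) (hN : ∃ u v, u ≠ v ∧ ¬ G.Adj u v)
    {x y : V} (hxy : Link G x y) (wx : 2 ≤ wt G x) (wy : 2 ≤ wt G y) :
    (∃ P, IsCone G P) ∨ (∃ P, IsMatchingJoin G P) ∨
      ∃ P Q z, IsCliquePath G P Q z ∧
        ((num P = 8 ∧ num Q = 3) ∨ (num P = 6 ∧ num Q = 4) ∨ (num P = 5 ∧ num Q = 6)) := by
  by_cases h1 : ∃ z, Link G x z ∧ wt G z = 1
  · obtain ⟨z, hz, wz⟩ := h1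
    obtain ⟨P, Q, h⟩ := hG.classify_light_heavy hz hxy wx wz wy
    exact Or.inr (Or.inr ⟨P, Q, z, h⟩)
  by_cases h2 : ∃ z, Link G y z ∧ wt G z = 1
  · obtain ⟨z, hz, wz⟩ := h2
    obtain ⟨P, Q, h⟩ := hG.classify_light_heavy hz hxy.symm wy wz wx
    exact Or.inr (Or.inr ⟨P, Q, z, h⟩)
  have h3 := hG.classify_heavy hN hxy
    (fun w hw => (wt_eq_one_or w).resolve_left fun h => h1 ⟨w, hw, h⟩)
    (fun w hw => (wt_eq_one_or w).resolve_left fun h => h2 ⟨w, hw, h⟩)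
  tauto

/-! ### Heavy vertices with light neighbours only -/

theorem num_eq_of_bij {p q : V → Prop} (r : V → V → Prop)
    (h1 : ∀ v, p v → ∃! w, q w ∧ r v w) (h2 : ∀ w, q w → ∃! v, p v ∧ r v w) : num p = num q := by
  unfold num
  norm_cast
  choose! f hf hf' using h1
  refine Finset.card_bij (fun v _ => f v) (fun v hv => ?_) (fun v hv v' hv' e => ?_)
    fun w hw => ?_
  · simp only [mem_filter, mem_univ, true_and] at hv ⊢
    exact (hf v hv).1
  · simp only [mem_filter, mem_univ, true_and] at hv hv'
    exact (h2 (f v) (hf v hv).1).unique ⟨hv, (hf v hv).2⟩ ⟨hv', e ▸ (hf v' hv').2⟩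
  · simp only [mem_filter, mem_univ, true_and] at hw
    obtain ⟨v, hv, -⟩ := h2 w hw
    exact ⟨v, by simpa using hv.1, (hf' v hv.1 w ⟨hw, hv.2⟩).symm⟩

/-- A family of sets that pairwise differ by exchanging one element: either an element separating
two members lies in one member only, or the members arise from one set by removing one element. -/
theorem exchange_family {ι : Type*} {S : ι → Prop} {O : ι → V → Prop}
    (h : ∀ i j, S i → S j → i ≠ j → num (fun w => O i w ∧ ¬ O j w) = 1) :
    (∀ i j w, S i → S j → O i w → ¬ O j w → ∀ k, S k → k ≠ i → ¬ O k w) ∨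
      ∃ W : V → Prop, (∀ w, W w → ∃ i, S i ∧ O i w) ∧ (∀ i, S i → ∀ w, O i w → W w) ∧
        ∀ i, S i → num (fun w => W w ∧ ¬ O i w) = 1 := by
  by_cases hc : ∀ i j w, S i → S j → O i w → ¬ O j w → ∀ k, S k → k ≠ i → ¬ O k w
  · exact Or.inl hc
  right
  push Not at hc
  obtain ⟨i, j, x, hi, hj, hix, hjx, k, hk, hki, hkx⟩ := hc
  have hij : i ≠ j := by rintro rfl; exact hjx hix
  have hkj : k ≠ j := by rintro rfl; exact hjx hkx
  have uniq : ∀ {i j u v}, S i → S j → i ≠ j → O i u → ¬ O j u → O i v → ¬ O j v → u = v :=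
    fun hi hj hij h1 h2 h3 h4 => eq_of_num_eq_one (h _ _ hi hj hij) ⟨h1, h2⟩ ⟨h3, h4⟩
  have ex : ∀ {i j}, S i → S j → i ≠ j → ∃ u, O i u ∧ ¬ O j u := fun hi hj hij =>
    exists_of_num_pos (by rw [h _ _ hi hj hij]; exact one_pos)
  obtain ⟨y, hjy, hiy⟩ := ex hj hi hij.symm
  have hky : O k y := by
    obtain ⟨u, hu1, hu2⟩ := ex hk hi hki
    have : O j u := by
      by_contra hju
      exact hu2 ((uniq hk hj hkj hkx hjx hu1 hju) ▸ hix)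
    rwa [← uniq hj hi hij.symm this hu2 hjy hiy]
  obtain ⟨e, hie, hke⟩ := ex hi hk hki.symm
  have sub : ∀ l, S l → ∀ w, O l w → O i w ∨ O j w := by
    intro l hl w hlw
    by_contra hcon
    rw [not_or] at hcon
    have hli : l ≠ i := by rintro rfl; exact hcon.1 hlw
    have hlj : l ≠ j := by rintro rfl; exact hcon.2 hlw
    have hkw : ¬ O k w := by
      intro hkw
      exact hcon.1 (uniq hk hj hkj hkx hjx hkw hcon.2 ▸ hix)
    have hlk : l ≠ k := by rintro rfl; exact hkw hlw
    have hlx : ¬ O l x := fun hlx => hcon.1 (uniq hl hj hlj hlx hjx hlw hcon.2 ▸ hix)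
    have hle : ¬ O l e := fun hle => hcon.1 (uniq hl hk hlk hle hke hlw hkw ▸ hie)
    have : x = e := uniq hi hl hli.symm hix hlx hie hle
    exact hke (this ▸ hkx)
  refine ⟨fun w => O i w ∨ O j w, ?_, fun l hl w hlw => sub l hl w hlw, ?_⟩
  · rintro w (hw | hw)
    · exact ⟨i, hi, hw⟩
    · exact ⟨j, hj, hw⟩
  · intro l hl
    have e1 : num (fun w => O i w ∨ O j w) = num (O i) + 1 := by
      rw [← h j i hj hi hij.symm, ← num_or (fun w hw hw' => hw'.2 hw)]
      exact num_congr fun w => by tauto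
    have e2 := num_split (fun w => O i w ∨ O j w) (O l)
    have e3 : num (fun w => (O i w ∨ O j w) ∧ O l w) = num (O l) :=
      num_congr fun w => ⟨fun h => h.2, fun h => ⟨sub l hl w h, h⟩⟩
    have e4 : num (O l) = num (O i) := by
      by_cases hli : l = i
      · rw [hli]
      · have a1 := num_split (O l) (O i)
        have a2 := num_split (O i) (O l)
        rw [h l i hl hi hli] at a1
        rw [h i l hi hl (Ne.symm hli)] at a2
        have a3 : num (fun w => O l w ∧ O i w) = num (fun w => O i w ∧ O l w) :=
          num_congr fun w => and_comm
        linarith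
    linarith

/-- A heavy centre between two light ends. -/
theorem Admissible.light_light (hG : Admissible G) {v z y : V} (hz : Link G v z) (hy : Link G v y)
    (hzy : ¬ Tw G z y) (wv : 2 ≤ wt G v) (wz : wt G z = 1) (wy : wt G y = 1) :
    (prv G z y = 1 ∧ prv G y z = 1) ∨ (prv G z y = 0 ∧ kap G v z y = 0 ∧ rst G v z y ≤ 1) ∨
      (prv G y z = 0 ∧ kap G v z y = 0 ∧ rst G v z y ≤ 1) := by
  have h := hG.pathPoly_eq_zero hz hy hzy
  have h2 := hG.ends_dist hz hy hzy
  rw [wz, wy] at h h2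
  exact pathPoly_light_light wv (kap_nonneg v z y) (prv_nonneg z y) (prv_nonneg y z)
    (rst_nonneg v z y) (by linarith) h

/-- Expansion of a vector in an orthogonal basis of the plane. -/
theorem Admissible.orthogonal_expansion (hG : Admissible G) {c z h w : V} (hcz : c ≠ z)
    (hch : c ≠ h) (hcw : c ≠ w) (hzh : z ≠ h) (hzw : z ≠ w) (hhw : h ≠ w) (h0 : cn G c z = 0) :
    (cn G c c - 1) * (cn G z z - 1) * cn G h w = cn G c h * (cn G z z - 1) * cn G c w
      + cn G z h * (cn G c c - 1) * cn G z w := by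
  obtain ⟨x, y, hxy⟩ := hG.gram
  have cc := hxy c c
  have zz := hxy z z
  have cz := hxy c z
  have ch := hxy c h
  have cw := hxy c w
  have zh := hxy z h
  have zw := hxy z w
  have hw := hxy h w
  simp only [if_true, if_neg hcz, if_neg hch, if_neg hcw, if_neg hzh, if_neg hzw, if_neg hhw,
    sub_zero] at cc zz cz ch cw zh zw hw
  rw [h0] at cz
  have goal : ((cn G c c : ℝ) - 1) * (cn G z z - 1) * cn G h w
      = cn G c h * (cn G z z - 1) * cn G c w + cn G z h * (cn G c c - 1) * cn G z w := by
    rw [cc, zz, ch, cw, zh, zw, hw]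
    push_cast at cz
    linear_combination ((x c * x w + y c * y w) * (x z * x h + y z * y h)
      + (x c * x h + y c * y h) * (x z * x w + y z * y w)
      - (x c * x z + y c * y z) * (x h * x w + y h * y w)) * cz
  exact_mod_cast goal

/-- A light vertex with two heavy neighbours that are not twins. -/
theorem Admissible.classify_two_heavy (hG : Admissible G) (hN : ∃ u v, u ≠ v ∧ ¬ G.Adj u v)
    (hII : ∀ u v, Link G u v → 2 ≤ wt G u → wt G v = 1) {c y y' : V} (hy : Link G c y)
    (hy' : Link G c y') (hyy : ¬ Tw G y y') (wy : 2 ≤ wt G y) (wy' : 2 ≤ wt G y') :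
    (∃ P, IsCone G P) ∨ ∃ P, IsMatchingJoin G P := by
  have heavy : ∀ {c}, Link G c y → Link G c y' → ∀ w, Link G c w → 2 ≤ wt G w := by
    intro c hy hy' w hw
    refine (wt_eq_one_or w).resolve_left fun ww => ?_
    have wy2 := (hG.heavy_heavy hy hy' hyy wy wy').1
    have hwy : ¬ Tw G w y := not_tw_of_wt_ne (by rw [ww, wy2]; norm_num)
    have hwy' : ¬ Tw G w y' := not_tw_of_wt_ne (by rw [ww]; omega)
    have hr : rst G c w y ≠ 0 := fun hr => not_of_num_eq_zero hr y' ⟨hy'.1, hy'.2, hwy', hyy⟩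
    rcases hG.light_two hw hy hwy ww wy2 with h | ⟨-, -, h | h⟩
    · exact hr h.2.2.1
    · have := hII y c hy.symm wy
      rw [h.1] at this
      norm_num at this
    · exact hr h.2.1
  have hc := heavy hy hy'
  have same := (hG.heavy_heavy hy hy' hyy wy wy').2.2
  have bl : BipBlowup G c y := by
    refine ⟨hy, hG.left_of_heavy hy hc, fun x' hx' w => ⟨fun hw => ?_, fun hw => ?_⟩⟩
    · have := hG.left_of_heavy hx'.symm (heavy hx'.symm ((same x').1 hx').symm) w hw c
      exact (this.2 hy.symm).symm
    · exact ((hG.left_of_heavy hy hc w hw x').2 hx').symm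
  refine bl.classify hG hN ?_ (hG.weight_of_heavy hy hc)
  rintro ⟨x', hx', t⟩
  exfalso
  have e : ∀ {u v}, Link G y u → Link G y v → ¬ Tw G u v → prv G u v = 0 := by
    intro u v hu hv t
    refine num_eq_zero fun w hw => ?_
    exact hw.2.1 ((bl.right v hv w).2 ((bl.right u hu w).1 ⟨hw.1, hw.2.2⟩)).1
  have := hG.ends_dist hy.symm hx' t
  rw [e hy.symm hx' t, e hx' hy.symm (fun t' => t t'.symm), hII y c hy.symm wy,
    hII y x' hx' wy] at this
  norm_num at this

/-- A heavy vertex with only one neighbour up to twins does not occur. -/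
theorem Admissible.no_heavy_leaf (hG : Admissible G) (hN : ∃ u v, u ≠ v ∧ ¬ G.Adj u v)
    (hII : ∀ u v, Link G u v → 2 ≤ wt G u → wt G v = 1)
    (hB : ∀ c y y', Link G c y → Link G c y' → 2 ≤ wt G y → 2 ≤ wt G y' → Tw G y y')
    {h c : V} (hc : Link G h c) (wh : 2 ≤ wt G h) (hl : ∀ w, Link G h w → w = c) : False := by
  have wc := hII h c hc wh
  obtain ⟨z, hz, hhz⟩ : ∃ z, Link G c z ∧ ¬ Tw G h z := by
    by_contra hcon
    push Not at hcon
    have cov : ∀ v, Tw G h v ∨ v = c := by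
      intro v
      refine mem_of_connected hG.connected (v := c) (P := fun v => Tw G h v ∨ v = c)
        (Or.inr rfl) ?_ v
      rintro u w (t | rfl) huw
      · by_cases t' : Tw G u w
        · exact Or.inl (t.trans t')
        · exact Or.inr (hl w (Link.congr_left ⟨huw, t'⟩ t.symm))
      · by_cases t' : Tw G u w
        · exact absurd (eq_of_tw wc t') huw.ne'
        · exact Or.inl (hcon w ⟨huw, t'⟩)
    obtain ⟨u, v, huv, hadj⟩ := hN
    apply hadj
    rcases cov u with hu | rfl <;> rcases cov v with hv | rfl
    · exact (hu.symm.trans hv).adj huv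
    · exact (hc.congr_left hu).1
    · exact (hc.congr_left hv).1.symm
    · exact absurd rfl huv
  have hzh : ¬ Tw G z h := fun t => hhz t.symm
  have wz : wt G z = 1 := by
    refine (wt_eq_one_or z).resolve_right fun wz => hhz (hB c h z hc.symm hz wh wz)
  have hna := hG.not_adj_of_link hz hc.symm hzh
  have nb : ∀ u, G.Adj h u → ¬ Tw G h u → u = c := fun u h1 h2 => hl u ⟨h1, h2⟩
  have hk : kap G c z h = 0 := by
    refine num_eq_zero fun u hu => hu.2.2 ?_
    have : ¬ Tw G h u := fun t => hna (t.symm.adj_of_adj hu.1.symm (not_tw_ne hzh)).symm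
    rw [nb u hu.2.1 this]
    exact Tw.refl _
  have hq : prv G h z = 0 := num_eq_zero fun u hu => by
    rw [nb u hu.1 hu.2.2] at hu
    exact hu.2.1 hz.1.symm
  have e := hG.pathPoly_eq_zero hz hc.symm hzh
  rw [wc, wz, hk, hq] at e
  have hm := rst_nonneg (G := G) c z h
  have hp : prv G z h ≠ 0 := by
    intro hp
    rw [hp] at e
    unfold pathPoly at e
    linarith
  obtain ⟨w, hw⟩ := exists_of_num_pos (lt_of_le_of_ne (prv_nonneg z h) (Ne.symm hp))
  have hcw : c ≠ w := by rintro rfl; exact hw.2.1 hc.1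
  have hcw' : ¬ G.Adj c w := by
    intro h
    have t1 : ¬ Tw G c w := fun t => hcw (eq_of_tw wc t).symm
    exact hG.not_adj_of_link hz ⟨h, t1⟩ hw.2.2 hw.1
  have hhw : h ≠ w := by rintro rfl; exact hna hw.1
  have hcz : cn G c z = 0 := by rw [hG.cn_link hz, wc, wz]; norm_num
  have hhw0 : cn G h w = 0 := by
    refine num_eq_zero fun u hu => ?_
    have t : ¬ Tw G h u := fun t => hw.2.1 (t.symm.adj_of_adj hu.2.symm hhw.symm)
    rw [nb u hu.1 t] at hu
    exact hcw' hu.2.symm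
  -- `c` and `z` are orthogonal, so the vectors of `h` and `w` can be compared in this basis
  have key := hG.orthogonal_expansion hz.ne hc.ne.symm hcw (not_tw_ne hzh) hw.1.ne hhw hcz
  rw [hhw0] at key
  have d1 := hG.two_le_degree c
  have d2 := hG.two_le_degree z
  have a1 : 1 ≤ cn G c h := by
    rw [hG.cn_link hc.symm, wc]; linarith
  have a2 : 1 ≤ cn G c w := one_le_num (w := z) ⟨hz.1, hw.1.symm⟩
  have a3 : 0 ≤ cn G z h * (cn G c c - 1) * cn G z w :=
    mul_nonneg (mul_nonneg (cn_nonneg _ _) (by linarith)) (cn_nonneg _ _)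
  have a4 : 0 < cn G c h * (cn G z z - 1) * cn G c w :=
    mul_pos (mul_pos (by linarith) (by linarith)) (by linarith)
  linarith

/-! ### The graphs of type (vi) -/

/-- The structural form of type (vi): a clique `P` joined to `Y`, and `Y`, `W` the sides of a
complete bipartite graph with a perfect matching removed. -/
structure IsTail (G : SimpleGraph V) (P Y W : V → Prop) : Prop where
  cover : ∀ v, P v ∨ Y v ∨ W v
  disj_PY : ∀ v, P v → ¬ Y v
  disj_PW : ∀ v, P v → ¬ W v
  disj_YW : ∀ v, Y v → ¬ W v
  adj_P : ∀ u v, P u → P v → u ≠ v → G.Adj u v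
  adj_PY : ∀ u v, P u → Y v → G.Adj u v
  not_adj_PW : ∀ u v, P u → W v → ¬ G.Adj u v
  not_adj_Y : ∀ u v, Y u → Y v → ¬ G.Adj u v
  not_adj_W : ∀ u v, W u → W v → ¬ G.Adj u v
  matchY : ∀ y, Y y → ∃! w, W w ∧ ¬ G.Adj y w
  matchW : ∀ w, W w → ∃! y, Y y ∧ ¬ G.Adj y w

/-- The determinant of a path `w - y - h` where `w` is missed by one neighbour of `h`: here `b + 2`
is the weight of `h`, `g` the number of its neighbours and `f` the number of further neighbours of
each of them. -/
theorem tail_arithmetic_missed {b g f ρ : ℤ} (hb : 0 ≤ b) (hg : 3 ≤ g) (hf : g - 1 ≤ f) (hρ : 0 ≤ ρ)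
    (h : pathPoly 1 (-1) b (g - 2) ρ 1 (f - 1) = 0) :
    ρ = 0 ∧ b * ((g - 2) * (f + g - 1) - (g - 1) ^ 2) = f + g - 1 := by
  have e : pathPoly 1 (-1) b (g - 2) ρ 1 (f - 1) = -(f + g - 1)
      + b * ((g - 2) * (f + g - 1) - (g - 1) ^ 2)
      + ρ * ((1 + b) * (f + g - 1) + f * (g - 1)) := by unfold pathPoly; ring
  rw [e] at h
  have h1 : 0 ≤ (g - 2) * (f + g - 1) - (g - 1) ^ 2 := by nlinarith
  have h2 := mul_nonneg hb h1
  have hρ0 : ρ = 0 := by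
    by_contra hne
    have h3 : 1 ≤ ρ := by omega
    have h4 : f + g - 1 < (1 + b) * (f + g - 1) + f * (g - 1) := by
      nlinarith [mul_nonneg hb (show 0 ≤ f + g - 1 by linarith)]
    nlinarith
  rw [hρ0] at h
  exact ⟨hρ0, by linarith⟩

/-- The same for a vertex `w` adjacent to all neighbours of `h`; this is incompatible with the
equation for the missed vertices. -/
theorem tail_arithmetic_full {b g f ρ : ℤ} (hb : 0 ≤ b) (hg : 3 ≤ g) (hf : g ≤ f) (hρ : 0 ≤ ρ)
    (h1 : b * ((g - 2) * (f + g - 1) - (g - 1) ^ 2) = f + g - 1)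
    (h : pathPoly 1 (-1) b (g - 1) ρ 0 (f - 1) = 0) : False := by
  have e : pathPoly 1 (-1) b (g - 1) ρ 0 (f - 1) = -(f * (g - 1) + g) + b * (f - g)
      + ρ * ((1 + b) * (f + g - 1) + f * (g - 1))
      + (b * ((g - 2) * (f + g - 1) - (g - 1) ^ 2) - (f + g - 1)) := by unfold pathPoly; ring
  rw [e, h1] at h
  have h2 : 0 ≤ b * (f - g) := mul_nonneg hb (by linarith)
  have h3 : f * (g - 1) + g < (1 + b) * (f + g - 1) + f * (g - 1) := by
    nlinarith [mul_nonneg hb (show 0 ≤ f + g - 1 by linarith)]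
  have h4 : 0 < f * (g - 1) + g := by nlinarith
  have hρ0 : ρ = 0 := by
    by_contra hne
    have h3 : 1 ≤ ρ := by omega
    nlinarith
  rw [hρ0] at h
  -- `b` is too small, by its defining equation
  have h5 : (g - 2) * (f + g - 1) - (g - 1) ^ 2 = (g - 1) * (g - 3) + (g - 2) * (f - g + 1) := by
    ring
  rw [h5] at h1
  have h6 : b * (f - g + 1) ≤ b * ((g - 1) * (g - 3) + (g - 2) * (f - g + 1)) := by
    apply mul_le_mul_of_nonneg_left _ hb
    nlinarith
  nlinarith

variable {h : V}

/-- The further neighbours of a neighbour `y` of the heavy vertex `h`. -/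
def Ext (G : SimpleGraph V) (h y w : V) : Prop := Link G y w ∧ ¬ Tw G h w

/-- The situation of a heavy vertex `h` with several neighbours, all of them light. -/
structure HeavyStar (G : SimpleGraph V) (h : V) : Prop where
  adm : Admissible G
  heavy : 2 ≤ wt G h
  light : ∀ y, Link G h y → wt G y = 1
  light_ext : ∀ y, Link G h y → ∀ w, Ext G h y w → wt G w = 1
  other : ∀ y, Link G h y → ∃ y', Link G h y' ∧ y' ≠ y

namespace HeavyStar

theorem not_tw (H : HeavyStar G h) {y y' : V} (hy : Link G h y) (hne : y ≠ y') : ¬ Tw G y y' :=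
  fun t => hne (eq_of_tw (H.light y hy) t).symm

theorem not_adj (H : HeavyStar G h) {y y' : V} (hy : Link G h y) (hy' : Link G h y') :
    ¬ G.Adj y y' := by
  by_cases e : y = y'
  · subst e; exact G.irrefl
  · exact H.adm.not_adj_of_link hy hy' (H.not_tw hy e)

theorem not_adj_ext (H : HeavyStar G h) {y w : V} (hy : Link G h y) (hw : Ext G h y w) :
    ¬ G.Adj h w := fun hh => H.adm.not_adj_of_link hy.symm hw.1 hw.2 hh

theorem ext_of_adj (H : HeavyStar G h) {y y' w : V} (hy : Link G h y) (hw : Ext G h y w)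
    (hy' : Link G h y') (ha : G.Adj y' w) : Ext G h y' w := by
  refine ⟨⟨ha, fun t => ?_⟩, hw.2⟩
  rw [eq_of_tw (H.light y' hy') t] at hw
  exact H.not_adj hy hy' hw.1.1

/-- A vertex at distance two from `h` has at least two neighbours among those of `h`. -/
theorem exists_other (H : HeavyStar G h) {y w : V} (hy : Link G h y) (hw : Ext G h y w) :
    ∃ y', Link G h y' ∧ y' ≠ y ∧ Ext G h y' w := by
  by_contra hcon
  push Not at hcon
  have hk : kap G y w h = 0 := by
    refine num_eq_zero fun u hu => ?_
    have t : ¬ Tw G h u := fun t =>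
      H.not_adj_ext hy hw (t.symm.adj_of_adj hu.1.symm (not_tw_ne fun t' => hw.2 t'.symm))
    have lu : Link G h u := ⟨hu.2.1, t⟩
    have ne : u ≠ y := (not_tw_ne hu.2.2).symm
    exact hcon u lu ne (H.ext_of_adj hy hw lu hu.1.symm)
  have hp := H.adm.light_center hw.1 hy.symm (fun t => hw.2 t.symm) (H.light y hy)
    (H.light_ext y hy w hw) H.heavy hk
  obtain ⟨y', hy', hne⟩ := H.other y hy
  have ha : G.Adj y' w := by
    by_contra ha
    exact not_of_num_eq_zero hp y' ⟨hy'.1, fun e => ha e.symm, hy'.2⟩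
  exact hcon y' hy' hne (H.ext_of_adj hy hw hy' ha)

theorem prv_eq (H : HeavyStar G h) {y y' : V} (hy : Link G h y) (hy' : Link G h y') :
    prv G y y' = num (fun w => Ext G h y w ∧ ¬ Ext G h y' w) := by
  refine num_congr fun w => ⟨fun hw => ⟨⟨⟨hw.1, hw.2.2⟩, fun t => ?_⟩, fun hw' => hw.2.1 hw'.1.1⟩,
    fun hw => ⟨hw.1.1.1, fun ha => hw.2 (H.ext_of_adj hy hw.1 hy' ha), hw.1.1.2⟩⟩
  exact hw.2.1 (hy'.congr_left t).1.symm

/-- Two neighbours of `h` have exactly one private neighbour each. -/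
theorem prv_eq_one (H : HeavyStar G h) {y y' : V} (hy : Link G h y) (hy' : Link G h y')
    (hne : y ≠ y') : prv G y y' = 1 := by
  -- if `y` is a leaf, two vertices with the same neighbours appear
  have key : ∀ {y y'}, Link G h y → Link G h y' → y ≠ y' → prv G y y' = 0 → kap G h y y' = 0 →
      rst G h y y' ≤ 1 → False := by
    intro y y' hy hy' hne hp hk hr
    have empty : ∀ w, ¬ Ext G h y w := fun w hw => hw.2 (leaf_of_prv_kap hp hk hw.1)
    have hd := H.adm.ends_dist hy hy' (H.not_tw hy hne)
    rw [H.light y hy, H.light y' hy', hp] at hd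
    obtain ⟨w, hw⟩ := exists_of_num_pos (show 0 < prv G y' y by linarith)
    have hw' : Ext G h y' w := by
      rw [H.prv_eq hy' hy] at hd
      refine ⟨⟨hw.1, hw.2.2⟩, fun t => hw.2.1 (hy.congr_left t).1.symm⟩
    obtain ⟨y2, hy2, hne2, hw2⟩ := H.exists_other hy' hw'
    have hr1 : rst G h y y' = 1 := by
      refine le_antisymm hr (one_le_num (w := y2) ⟨hy2.1, hy2.2, H.not_tw hy ?_, H.not_tw hy' hne2.symm⟩)
      rintro rfl; exact empty w hw2
    have only : ∀ v, Link G h v → v ≠ y' → ∀ u, Ext G h v u → v = y2 := by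
      intro v hv h1 u hu
      have h2 : v ≠ y := by rintro rfl; exact empty u hu
      refine eq_of_num_eq_one hr1 ⟨hv.1, hv.2, H.not_tw hy h2.symm, H.not_tw hy' h1.symm⟩
        ⟨hy2.1, hy2.2, H.not_tw hy ?_, H.not_tw hy' hne2.symm⟩
      rintro rfl; exact empty w hw2
    have e1 : prv G y' y2 = 0 := by
      rw [H.prv_eq hy' hy2]
      refine num_eq_zero fun u hu => ?_
      obtain ⟨v, hv, hvne, hu'⟩ := H.exists_other hy' hu.1
      rw [only v hv hvne u hu'] at hu'
      exact hu.2 hu'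
    have e2 : prv G y2 y' = 0 := by
      rw [H.prv_eq hy2 hy']
      refine num_eq_zero fun u hu => ?_
      obtain ⟨v, hv, hvne, hu'⟩ := H.exists_other hy2 hu.1
      by_cases h1 : v = y'
      · rw [h1] at hu'; exact hu.2 hu'
      · exact hvne (only v hv h1 u hu')
    have hd2 := H.adm.ends_dist hy' hy2 (H.not_tw hy' hne2.symm)
    rw [H.light y' hy', H.light y2 hy2, e1, e2] at hd2
    norm_num at hd2
  rcases H.adm.light_light hy hy' (H.not_tw hy hne) H.heavy (H.light y hy) (H.light y' hy')
    with h1 | ⟨h1, h2, h3⟩ | ⟨h1, h2, h3⟩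
  · exact h1.1
  · exact (key hy hy' hne h1 h2 h3).elim
  · exact (key hy' hy hne.symm h1 (by rwa [kap_comm]) (by rwa [rst_comm])).elim

/-- The sets of further neighbours arise from one set `W` by removing one element each. -/
theorem top (H : HeavyStar G h) {y : V} (hy : Link G h y) :
    ∃ W : V → Prop, (∀ w, W w → ∃ y, Link G h y ∧ Ext G h y w) ∧
      (∀ y, Link G h y → ∀ w, Ext G h y w → W w) ∧
        ∀ y, Link G h y → num (fun w => W w ∧ ¬ Ext G h y w) = 1 := by
  rcases exchange_family (S := Link G h) (O := Ext G h)
    (fun i j hi hj hij => (H.prv_eq hi hj).symm.trans (H.prv_eq_one hi hj hij)) with h1 | h1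
  · exfalso
    obtain ⟨y', hy', hne⟩ := H.other y hy
    have := H.prv_eq_one hy hy' hne.symm
    rw [H.prv_eq hy hy'] at this
    obtain ⟨w, hw⟩ := exists_of_num_pos (this ▸ one_pos)
    obtain ⟨v, hv, hvne, hv'⟩ := H.exists_other hy hw.1
    exact h1 y y' w hy hy' hw.1 hw.2 v hv hvne hv'
  · exact h1

/-- The set `W` has exactly one element for each neighbour of `h`, and the equation between this
number and the weight of `h` has two solutions. -/
theorem classify (H : HeavyStar G h) (hy : ∃ y, Link G h y) :
    ∃ P Y W : V → Prop, IsTail G P Y W ∧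
      ((num P = 3 ∧ num Y = 5) ∨ (num P = 4 ∧ num Y = 4)) := by
  obtain ⟨y1, hy1⟩ := hy
  obtain ⟨W, hW1, hW2, hW3⟩ := H.top hy1
  have adjExt : ∀ {y w}, Link G h y → W w → (Ext G h y w ↔ G.Adj y w) := by
    intro y w hy hw
    obtain ⟨y', hy', hw'⟩ := hW1 w hw
    exact ⟨fun h => h.1.1, fun ha => H.ext_of_adj hy' hw' hy ha⟩
  have lightW : ∀ {w}, W w → wt G w = 1 := fun hw => by
    obtain ⟨y', hy', hw'⟩ := hW1 _ hw
    exact H.light_ext y' hy' _ hw'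
  have nhW : ∀ {w}, W w → ¬ G.Adj h w ∧ ¬ Tw G h w := fun hw => by
    obtain ⟨y', hy', hw'⟩ := hW1 _ hw
    exact ⟨H.not_adj_ext hy' hw', hw'.2⟩
  have missed : ∀ {y y' w}, Link G h y → Link G h y' → W w → ¬ Ext G h y w → ¬ Ext G h y' w →
      y = y' := by
    intro y y' w hy hy' hw h1 h2
    by_contra hne
    have e := H.prv_eq_one hy hy' hne
    rw [H.prv_eq hy hy'] at e
    obtain ⟨u, hu⟩ := exists_of_num_pos (e ▸ one_pos)
    exact h1 (eq_of_num_eq_one (hW3 y' hy') ⟨hw, h2⟩ ⟨hW2 y hy u hu.1, hu.2⟩ ▸ hu.1)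
  set g := num (Link G h) with hg
  obtain ⟨f, hf⟩ : ∃ f, num W = f + 1 := ⟨num W - 1, by ring⟩
  have hfy : ∀ {y}, Link G h y → num (Ext G h y) = f := by
    intro y hy
    have := num_split W (Ext G h y)
    rw [hW3 y hy, hf] at this
    have e : num (fun w => W w ∧ Ext G h y w) = num (Ext G h y) :=
      num_congr fun w => ⟨fun h => h.2, fun h => ⟨hW2 y hy w h, h⟩⟩
    linarith
  -- the parameters of the path `w - y - h`
  have par : ∀ {y w}, Link G h y → Ext G h y w →
      kap G y w h = g - 1 - prv G h w ∧ rst G y w h = f - 1 := by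
    intro y w hy hw
    have nhw := H.not_adj_ext hy hw
    have adjw : ∀ u, G.Adj w u → ¬ Tw G h u := fun u hu t =>
      nhw (t.symm.adj_of_adj hu.symm (not_tw_ne fun t' => hw.2 t'.symm))
    constructor
    · have e : g = num (fun u => u = y) + kap G y w h + prv G h w := by
        unfold kap prv
        rw [hg, ← num_or, ← num_or]
        · refine num_congr fun u => ⟨fun hu => ?_, ?_⟩
          · by_cases h1 : G.Adj w u
            · by_cases h2 : u = y
              · exact Or.inl (Or.inl h2)
              · exact Or.inl (Or.inr ⟨h1, hu.1, H.not_tw hy (Ne.symm h2)⟩)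
            · exact Or.inr ⟨hu.1, h1, hu.2⟩
          · rintro ((rfl | hu) | hu)
            · exact hy
            · exact ⟨hu.2.1, adjw u hu.1⟩
            · exact ⟨hu.1, hu.2.2⟩
        · rintro u (rfl | hu) hu'
          · exact hu'.2.1 hw.1.1.symm
          · exact hu'.2.1 hu.1
        · rintro u rfl hu'
          exact hu'.2.2 (Tw.refl _)
      rw [num_single] at e
      linarith
    · have e : num (Ext G h y) = num (fun u => u = w) + rst G y w h := by
        unfold rst
        rw [← num_or]
        · refine num_congr fun u => ⟨fun hu => ?_, ?_⟩
          · by_cases h2 : u = w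
            · exact Or.inl h2
            · exact Or.inr ⟨hu.1.1, hu.1.2, fun t => h2 (eq_of_tw (H.light_ext y hy w hw) t), hu.2⟩
          · rintro (rfl | hu)
            · exact hw
            · exact ⟨⟨hu.1, hu.2.1⟩, hu.2.2.2⟩
        · rintro u rfl hu'
          exact hu'.2.2.1 (Tw.refl _)
      rw [num_single, hfy hy] at e
      linarith
  have eqn : ∀ {y w}, Link G h y → Ext G h y w →
      pathPoly 1 (-1) (wt G h - 2) (g - 1 - prv G h w) (prv G w h) (prv G h w) (f - 1) = 0 := by
    intro y w hy hw
    have e := H.adm.pathPoly_eq_zero hw.1 hy.symm (fun t => hw.2 t.symm)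
    rwa [H.light y hy, H.light_ext y hy w hw, (par hy hw).1, (par hy hw).2] at e
  -- `D` consists of the members of `W` that some neighbour of `h` misses
  let D : V → Prop := fun w => W w ∧ ∃ y, Link G h y ∧ ¬ Ext G h y w
  have hDg : num D = g := by
    refine (num_eq_of_bij (p := Link G h) (fun y w => ¬ Ext G h y w) (fun y hy => ?_) ?_).symm
    · obtain ⟨w, hw⟩ := exists_of_num_pos ((hW3 y hy) ▸ one_pos)
      exact ⟨w, ⟨⟨hw.1, y, hy, hw.2⟩, hw.2⟩,
        fun u hu => eq_of_num_eq_one (hW3 y hy) ⟨hu.1.1, hu.2⟩ hw⟩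
    · rintro w ⟨hw, y, hy, hyw⟩
      exact ⟨y, ⟨hy, hyw⟩, fun v hv => missed hv.1 hy hw hv.2 hyw⟩
  have hfg : g - 1 ≤ f := by
    have := num_mono (p := D) (q := W) fun w hw => hw.1
    linarith
  have prvD : ∀ {w}, D w → prv G h w = 1 := by
    rintro w ⟨hw, y, hy, hyw⟩
    refine num_eq_one (w := y) ⟨hy.1, fun ha => hyw ((adjExt hy hw).2 ha.symm), hy.2⟩
      fun u hu => ?_
    exact missed ⟨hu.1, hu.2.2⟩ hy hw (fun e => hu.2.1 e.1.1.symm) hyw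
  have exD : ∀ {w}, W w → ∃ y, Link G h y ∧ Ext G h y w := fun hw => hW1 _ hw
  obtain ⟨d, hd⟩ : ∃ d, D d := by
    obtain ⟨w, hw⟩ := exists_of_num_pos ((hW3 y1 hy1) ▸ one_pos)
    exact ⟨w, hw.1, y1, hy1, hw.2⟩
  have hb : 0 ≤ wt G h - 2 := by have := H.heavy; linarith
  have hg3 : 3 ≤ g := by
    obtain ⟨y, hy, hyd⟩ := exD hd.1
    have e := (par hy hyd).1
    rw [prvD hd] at e
    obtain ⟨y', hy', hne, hyd'⟩ := H.exists_other hy hyd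
    have : 1 ≤ kap G y d h := one_le_num (w := y') ⟨hyd'.1.1.symm, hy'.1, H.not_tw hy hne.symm⟩
    linarith
  have arD : ∀ {w}, D w → prv G w h = 0 ∧ (wt G h - 2) * ((g - 2) * (f + g - 1) - (g - 1) ^ 2)
      = f + g - 1 := by
    intro w hw
    obtain ⟨y, hy, hyw⟩ := exD hw.1
    have e := eqn hy hyw
    rw [prvD hw, show g - 1 - 1 = g - 2 by ring] at e
    exact tail_arithmetic_missed hb hg3 hfg (prv_nonneg w h) e
  -- every member of `W` is missed by some neighbour of `h`
  have hfg' : f = g - 1 := by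
    by_contra hne
    have hlt : g ≤ f := by omega
    have e := num_split W (fun w => ∃ y, Link G h y ∧ ¬ Ext G h y w)
    obtain ⟨w, hw, hw'⟩ : ∃ w, W w ∧ ¬ ∃ y, Link G h y ∧ ¬ Ext G h y w := by
      apply exists_of_num_pos
      have : num (fun w => W w ∧ ∃ y, Link G h y ∧ ¬ Ext G h y w) = g := hDg
      linarith
    obtain ⟨y, hy, hyw⟩ := exD hw
    have hp : prv G h w = 0 := num_eq_zero fun u hu =>
      hw' ⟨u, ⟨hu.1, hu.2.2⟩, fun e => hu.2.1 e.1.1.symm⟩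
    have e := eqn hy hyw
    rw [hp, sub_zero] at e
    exact tail_arithmetic_full hb hg3 hlt (prv_nonneg w h) (arD hd).2 e
  have allD : ∀ {w}, W w → D w := by
    intro w hw
    by_contra hcon
    have e := num_split W (fun w => ∃ y, Link G h y ∧ ¬ Ext G h y w)
    have e2 : num (fun w => W w ∧ ∃ y, Link G h y ∧ ¬ Ext G h y w) = g := hDg
    have e3 : 1 ≤ num (fun w => W w ∧ ¬ ∃ y, Link G h y ∧ ¬ Ext G h y w) :=
      one_le_num (w := w) ⟨hw, fun h => hcon ⟨hw, h⟩⟩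
    linarith
  have nbW : ∀ {w u}, W w → G.Adj w u → Link G h u := by
    intro w u hw hu
    have h1 : ¬ Tw G w u := fun t => hu.ne (eq_of_tw (lightW hw) t).symm
    have h2 : G.Adj h u := by
      by_contra h2
      exact not_of_num_eq_zero (arD (allD hw)).1 u ⟨hu, h2, h1⟩
    exact ⟨h2, fun t => (nhW hw).1 (t.symm.adj_of_adj hu.symm
      (not_tw_ne fun t' => (nhW hw).2 t'.symm))⟩
  refine ⟨Tw G h, Link G h, W, ⟨?_, fun v t l => l.2 t, fun v t w => (nhW w).2 t,
    fun v l w => (nhW w).1 l.1, fun u v hu hv hne => (hu.symm.trans hv).adj hne,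
    fun u v hu hv => (hv.congr_left hu).1, ?_, fun u v hu hv => H.not_adj hu hv, ?_, ?_, ?_⟩, ?_⟩
  · intro v
    refine mem_of_connected H.adm.connected (v := h)
      (P := fun v => Tw G h v ∨ Link G h v ∨ W v) (Or.inl (Tw.refl h)) ?_ v
    rintro u w (t | l | hu) huw
    · by_cases t' : Tw G u w
      · exact Or.inl (t.trans t')
      · exact Or.inr (Or.inl (Link.congr_left ⟨huw, t'⟩ t.symm))
    · by_cases t' : Tw G h w
      · exact Or.inl t'
      · exact Or.inr (Or.inr (hW2 u l w ⟨⟨huw, fun t => huw.ne (eq_of_tw (H.light u l) t).symm⟩, t'⟩))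
    · exact Or.inr (Or.inl (nbW hu huw))
  · intro u v hu hv ha
    exact (nhW hv).1 (hu.symm.adj_of_adj ha.symm.symm (by rintro rfl; exact (nhW hv).2 (Tw.refl _)))
  · intro u v hu hv ha
    exact (nhW hv).1 (nbW hu ha).1
  · intro y hy
    obtain ⟨w, hw⟩ := exists_of_num_pos ((hW3 y hy) ▸ one_pos)
    exact ⟨w, ⟨hw.1, fun ha => hw.2 ((adjExt hy hw.1).2 ha)⟩, fun u hu =>
      eq_of_num_eq_one (hW3 y hy) ⟨hu.1, fun e => hu.2 e.1.1⟩ hw⟩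
  · intro w hw
    obtain ⟨-, y, hy, hyw⟩ := allD hw
    exact ⟨y, ⟨hy, fun ha => hyw ((adjExt hy hw).2 ha)⟩, fun v hv =>
      missed hv.1 hy hw (fun e => hv.2 e.1.1) hyw⟩
  · change (wt G h = 3 ∧ g = 5) ∨ (wt G h = 4 ∧ g = 4)
    have e := (arD hd).2
    rw [hfg'] at e
    generalize wt G h = a at *
    have e' : (g - 1) * ((a - 2) * (g - 3)) = (g - 1) * 2 := by linear_combination e
    have e2 : (a - 2) * (g - 3) = 2 := mul_left_cancel₀ (by omega) e'
    have h1 : a - 2 = 1 ∨ a - 2 = 2 := by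
      have : 1 ≤ a - 2 := by
        by_contra hcon
        have : a - 2 = 0 := by omega
        rw [this] at e2; norm_num at e2
      have : a - 2 ≤ 2 := by
        by_contra hcon
        have : 1 ≤ g - 3 := by
          by_contra hcon
          nlinarith
        nlinarith
      omega
    rcases h1 with h1 | h1 <;> rw [h1] at e2
    · left; constructor <;> linarith
    · right; constructor <;> linarith

end HeavyStar

/-- Graphs with heavy vertices, no two of which are adjacent unless twins. -/
theorem Admissible.classify_heavy_star (hG : Admissible G) (hN : ∃ u v, u ≠ v ∧ ¬ G.Adj u v)
    (hII : ∀ u v, Link G u v → 2 ≤ wt G u → wt G v = 1) {h : V} (wh : 2 ≤ wt G h) :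
    (∃ P, IsCone G P) ∨ (∃ P, IsMatchingJoin G P) ∨
      ∃ P Y W, IsTail G P Y W ∧ ((num P = 3 ∧ num Y = 5) ∨ (num P = 4 ∧ num Y = 4)) := by
  by_cases hB : ∀ c y y', Link G c y → Link G c y' → 2 ≤ wt G y → 2 ≤ wt G y' → Tw G y y'
  · right; right
    have hex : ∃ y, Link G h y := by
      by_contra hcon
      push Not at hcon
      have all : ∀ v, Tw G h v := mem_of_connected hG.connected (Tw.refl h) fun u w t huw => by
        by_contra t'
        exact hcon w (Link.congr_left ⟨huw, fun t2 => t' (t.trans t2)⟩ t.symm)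
      obtain ⟨u, v, huv, hadj⟩ := hN
      exact hadj (((all u).symm.trans (all v)).adj huv)
    refine HeavyStar.classify ⟨hG, wh, fun y hy => hII h y hy wh, fun y hy w hw => ?_,
      fun y hy => ?_⟩ hex
    · exact (wt_eq_one_or w).resolve_right fun ww => hw.2 (hB y h w hy.symm hw.1 wh ww)
    · by_contra hcon
      push Not at hcon
      exact hG.no_heavy_leaf hN hII hB hy wh hcon
  · push Not at hB
    obtain ⟨c, y, y', hy, hy', wy, wy', t⟩ := hB
    have := hG.classify_two_heavy hN hII hy hy' t wy wy'
    tauto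

/-! ### Graphs without twins -/

variable {P : V → Prop}

/-- The structural form of type (i): a complete bipartite graph without a perfect matching. -/
structure IsBipComplement (G : SimpleGraph V) (P : V → Prop) : Prop where
  bip : ∀ u v, G.Adj u v → (P u ↔ ¬ P v)
  matching : ∀ u, ∃! v, (P v ↔ ¬ P u) ∧ ¬ G.Adj u v
  card : 3 ≤ num P

/-- The structural form of the first graph of type (iv): `w` and `y` are joined to all vertices of the
other side, and the other vertices are perfectly matched by four edges. -/
structure IsWindmill (G : SimpleGraph V) (P : V → Prop) (w y : V) : Prop where
  bip : ∀ u v, G.Adj u v → (P u ↔ ¬ P v)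
  memP : P w
  not_memP : ¬ P y
  adj_w : ∀ v, ¬ P v → G.Adj w v
  adj_y : ∀ v, P v → G.Adj y v
  matchP : ∀ u, P u ∧ u ≠ w → ∃! v, (¬ P v ∧ v ≠ y) ∧ G.Adj u v
  matchQ : ∀ v, ¬ P v ∧ v ≠ y → ∃! u, (P u ∧ u ≠ w) ∧ G.Adj u v
  card : num (fun u => P u ∧ u ≠ w) = 4

/-- The structural form of the second graph of type (iv). The set `F` consists of the vertices of
degree five; on opposite sides, two vertices in `F` are adjacent, two vertices outside `F` are not,
and between `F` and its complement one perfect matching is missing. -/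
structure IsDoubleStep (G : SimpleGraph V) (P F : V → Prop) : Prop where
  bip : ∀ u v, G.Adj u v → (P u ↔ ¬ P v)
  adj_F : ∀ u v, P u → ¬ P v → F u → F v → G.Adj u v
  not_adj : ∀ u v, P u → ¬ P v → ¬ F u → ¬ F v → ¬ G.Adj u v
  match_F : ∀ u, F u → ∃! v, (P v ↔ ¬ P u) ∧ ¬ F v ∧ ¬ G.Adj u v
  match_nF : ∀ u, ¬ F u → ∃! v, (P v ↔ ¬ P u) ∧ F v ∧ ¬ G.Adj u v
  card_P : num (fun v => P v ∧ F v) = 3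
  card_Q : num (fun v => ¬ P v ∧ F v) = 3

/-- An admissible bipartite graph with side `P` and parallel vectors on each side. -/
structure Sided (G : SimpleGraph V) (P : V → Prop) : Prop where
  adm : Admissible G
  bip : ∀ u v, G.Adj u v → (P u ↔ ¬ P v)
  parallel : ∀ u v, u ≠ v → (P u ↔ P v) → cn G u v ^ 2 = (cn G u u - 1) * (cn G v v - 1)

namespace Sided

theorem compl (H : Sided G P) : Sided G (fun v => ¬ P v) :=
  ⟨H.adm, fun u v h => not_congr (H.bip u v h), fun u v h e => H.parallel u v h (not_iff_not.1 e)⟩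

/-- Parallel vectors of the side: the degrees are equal, or they are two and five. -/
theorem degree_cases (H : Sided G P) {u v : V} (huv : u ≠ v) (hP : P u ↔ P v) :
    (cn G u u = cn G v v ∧ cn G u v = cn G u u - 1) ∨
      (cn G u u = 2 ∧ cn G v v = 5 ∧ cn G u v = 2) ∨
        (cn G u u = 5 ∧ cn G v v = 2 ∧ cn G u v = 2) := by
  have e := H.parallel u v huv hP
  have h1 := H.adm.two_le_degree u
  have h2 := H.adm.two_le_degree v
  have h3 := cn_nonneg (G := G) u v
  have h4 : cn G u v ≤ cn G u u := num_mono fun w hw => ⟨hw.1, hw.1⟩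
  have h5 : cn G u v ≤ cn G v v := num_mono fun w hw => ⟨hw.2, hw.2⟩
  generalize cn G u u = a at *
  generalize cn G v v = b at *
  generalize cn G u v = c at *
  have key : ∀ {a b : ℤ}, c ^ 2 = (a - 1) * (b - 1) → 2 ≤ a → a < b → c ≤ a →
      a = 2 ∧ b = 5 ∧ c = 2 := by
    intro a b e h1 hab h4
    have h6 : a - 1 < c := by
      by_contra hcon
      nlinarith
    have h7 : c = a := by omega
    subst h7
    have h8 : (c - 1) * (b - c - 2) = 1 := by linear_combination -e
    have h9 : 1 ≤ b - c - 2 := by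
      by_contra hcon
      nlinarith
    have h10 : c - 1 = 1 := by nlinarith
    rw [h10] at h8
    refine ⟨?_, ?_, ?_⟩ <;> linarith
  rcases lt_trichotomy a b with h | h | h
  · exact Or.inr (Or.inl (key e h1 h h4))
  · left
    refine ⟨h, ?_⟩
    rw [← h] at e
    have : (c - (a - 1)) * (c + (a - 1)) = 0 := by linear_combination e
    rcases mul_eq_zero.1 this with h' | h' <;> linarith
  · obtain ⟨h6, h7, h8⟩ := key (by rw [e]; ring) h2 h h5
    exact Or.inr (Or.inr ⟨h7, h6, h8⟩)

theorem num_adj (v : V) : num (fun w => G.Adj v w) = cn G v v := num_congr fun _ => by tauto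

theorem num_diff (u v : V) : num (fun w => G.Adj u w ∧ ¬ G.Adj v w) = cn G u u - cn G u v := by
  have := num_split (fun w => G.Adj u w) (fun w => G.Adj v w)
  rw [num_adj] at this
  unfold cn at this ⊢
  linarith

theorem cn_same (H : Sided G P) {u v : V} (huv : u ≠ v) (hP : P u ↔ P v)
    (e : cn G u u = cn G v v) : cn G u v = cn G u u - 1 := by
  rcases H.degree_cases huv hP with h | h | h
  · exact h.2
  · omega
  · omega

/-- Vertices of the same degree on one side have neighbourhoods that differ by exchanging one
element. -/
theorem exchange (H : Sided G P) {u v : V} (huv : u ≠ v) (hP : P u ↔ P v)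
    (e : cn G u u = cn G v v) : num (fun w => G.Adj u w ∧ ¬ G.Adj v w) = 1 := by
  rw [num_diff, H.cn_same huv hP e]; ring

/-- The neighbours of a vertex of degree two are neighbours of every vertex of degree five on its
side. -/
theorem nested (H : Sided G P) {u v w : V} (hP : P u ↔ P v) (h2 : cn G u u = 2)
    (h5 : cn G v v = 5) (hw : G.Adj u w) : G.Adj v w := by
  have huv : u ≠ v := by rintro rfl; omega
  have e : num (fun w => G.Adj u w ∧ ¬ G.Adj v w) = 0 := by
    rw [num_diff]
    rcases H.degree_cases huv hP with h | h | h <;> omega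
  by_contra hcon
  exact not_of_num_eq_zero e w ⟨hw, hcon⟩

theorem exists_adj (H : Sided G P) (v : V) : ∃ w, G.Adj v w :=
  exists_of_num_pos (by rw [num_adj]; linarith [H.adm.two_le_degree v])

theorem exists_adj_ne (H : Sided G P) (v u : V) : ∃ w, G.Adj v w ∧ w ≠ u := by
  by_contra hcon
  push Not at hcon
  have : num (fun w => G.Adj v w) ≤ 1 := by
    rw [← num_single u]
    exact num_mono hcon
  rw [num_adj] at this
  linarith [H.adm.two_le_degree v]

/-- If one side is regular, its neighbourhoods are obtained from the other side by removing one
vertex each. -/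
theorem of_constant (H : Sided G P) (hc : ∀ u v, P u → P v → cn G u u = cn G v v)
    (hne : ∃ u, P u) : IsBipComplement G P := by
  obtain ⟨x, hx⟩ := hne
  rcases exchange_family (S := P) (O := G.Adj)
    (fun i j hi hj hij => H.exchange hij (iff_of_true hi hj) (hc i j hi hj)) with h1 | h1
  · exfalso
    obtain ⟨w0, hw0⟩ := H.exists_adj x
    obtain ⟨x', hx', hne'⟩ := H.exists_adj_ne w0 x
    have hPx' : P x' := by
      have := H.bip _ _ hw0; have := H.bip _ _ hx'; tauto
    have e := H.exchange hne'.symm (iff_of_true hx hPx') (hc x x' hx hPx')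
    obtain ⟨w, hw⟩ := exists_of_num_pos (e ▸ one_pos)
    obtain ⟨k, hk, hkx⟩ := H.exists_adj_ne w x
    have hPk : P k := by
      have := H.bip _ _ hw.1; have := H.bip _ _ hk; tauto
    exact h1 x x' w hx hPx' hw.1 hw.2 k hPk hkx hk.symm
  obtain ⟨W, hW1, hW2, hW3⟩ := h1
  have hWQ : ∀ w, W w ↔ ¬ P w := by
    intro w
    constructor
    · intro hw
      obtain ⟨i, hi, hiw⟩ := hW1 w hw
      have := H.bip _ _ hiw; tauto
    · intro hw
      obtain ⟨k, hk⟩ := H.exists_adj w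
      have hPk : P k := by have := H.bip _ _ hk; tauto
      exact hW2 k hPk w hk.symm
  have miss : ∀ u, P u → num (fun w => ¬ P w ∧ ¬ G.Adj u w) = 1 := by
    intro u hu
    rw [← hW3 u hu]
    exact num_congr fun w => by rw [hWQ]
  have uniq : ∀ {u v w}, P u → P v → ¬ P w → ¬ G.Adj u w → ¬ G.Adj v w → u = v := by
    intro u v w hu hv hw h1 h2
    by_contra huv
    obtain ⟨z, hz⟩ := exists_of_num_pos
      ((H.exchange huv (iff_of_true hu hv) (hc u v hu hv)) ▸ one_pos)
    have hPz : ¬ P z := by have := H.bip _ _ hz.1; tauto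
    exact h1 (eq_of_num_eq_one (miss v hv) ⟨hw, h2⟩ ⟨hPz, hz.2⟩ ▸ hz.1)
  have deg : ∀ w, ¬ P w → num P = cn G w w + num (fun u => P u ∧ ¬ G.Adj u w) := by
    intro w hw
    rw [num_split P (fun u => G.Adj u w), ← num_adj]
    congr 1
    refine num_congr fun u => ⟨fun h => h.2.symm, fun h => ⟨?_, h.symm⟩⟩
    have := H.bip _ _ h; tauto
  obtain ⟨q, hq, hxq⟩ := exists_of_num_pos ((miss x hx) ▸ one_pos)
  have all : ∀ w, ¬ P w → ∃ u, P u ∧ ¬ G.Adj u w := by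
    intro w hw
    by_contra hcon
    push Not at hcon
    have e1 := deg w hw
    have e2 := deg q hq
    rw [num_eq_zero (p := fun u => P u ∧ ¬ G.Adj u w) (fun u hu => hu.2 (hcon u hu.1))] at e1
    rw [num_eq_one (p := fun u => P u ∧ ¬ G.Adj u q) (w := x) ⟨hx, hxq⟩
      (fun u hu => uniq hu.1 hx hq hu.2 hxq)] at e2
    have hqw : q ≠ w := by
      rintro rfl
      exact hxq (hcon x hx)
    rcases H.degree_cases hqw (iff_of_false hq hw) with h | h | h <;> omega
  refine ⟨H.bip, fun u => ?_, ?_⟩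
  · by_cases hu : P u
    · obtain ⟨w, hw⟩ := exists_of_num_pos ((miss u hu) ▸ one_pos)
      exact ⟨w, ⟨by tauto, hw.2⟩, fun z hz => eq_of_num_eq_one (miss u hu) ⟨by tauto, hz.2⟩ hw⟩
    · obtain ⟨w, hw⟩ := all u hu
      exact ⟨w, ⟨by tauto, fun h => hw.2 h.symm⟩, fun z hz => uniq (by tauto) hw.1 hu
        (fun h => hz.2 h.symm) hw.2⟩
  · rw [deg q hq]
    have := H.adm.two_le_degree q
    have := one_le_num (p := fun u => P u ∧ ¬ G.Adj u q) ⟨hx, hxq⟩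
    linarith

theorem two_or_five (H : Sided G P) (hm : ¬ ∀ u v, P u → P v → cn G u u = cn G v v) :
    (∀ v, P v → cn G v v = 2 ∨ cn G v v = 5) ∧ (∃ v, P v ∧ cn G v v = 2) ∧
      ∃ v, P v ∧ cn G v v = 5 := by
  push Not at hm
  obtain ⟨u, v, hu, hv, huv⟩ := hm
  have h25 : (cn G u u = 2 ∧ cn G v v = 5) ∨ (cn G u u = 5 ∧ cn G v v = 2) := by
    rcases H.degree_cases (u := u) (v := v) (by rintro rfl; exact huv rfl) (iff_of_true hu hv)
      with h | h | h
    · exact absurd h.1 huv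
    · exact Or.inl ⟨h.1, h.2.1⟩
    · exact Or.inr ⟨h.1, h.2.1⟩
  refine ⟨fun w hw => ?_, ?_, ?_⟩
  · by_cases e : w = u
    · rw [e]; omega
    · rcases H.degree_cases e (iff_of_true hw hu) with h | h | h <;> omega
  · rcases h25 with h | h
    · exact ⟨u, hu, h.1⟩
    · exact ⟨v, hv, h.2⟩
  · rcases h25 with h | h
    · exact ⟨v, hv, h.2⟩
    · exact ⟨u, hu, h.1⟩

/-- Both degrees that are possible on a mixed side, two and five, occur on both sides. -/
structure Mixed (G : SimpleGraph V) (P : V → Prop) : Prop where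
  sided : Sided G P
  degP : ∀ v, cn G v v = 2 ∨ cn G v v = 5
  exP2 : ∃ v, P v ∧ cn G v v = 2
  exP5 : ∃ v, P v ∧ cn G v v = 5
  exQ2 : ∃ v, ¬ P v ∧ cn G v v = 2
  exQ5 : ∃ v, ¬ P v ∧ cn G v v = 5

theorem Mixed.compl (M : Mixed G P) : Mixed G (fun v => ¬ P v) :=
  ⟨M.sided.compl, M.degP, M.exQ2, M.exQ5, by simpa using M.exP2, by simpa using M.exP5⟩

/-- Two vertices of degree two have at most one common neighbour. -/
theorem Mixed.not_two_common (M : Mixed G P) {u v a b : V} (hP : P u ↔ P v) (huv : u ≠ v)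
    (hu : cn G u u = 2) (hv : cn G v v = 2) (ha : G.Adj u a ∧ G.Adj v a)
    (hb : G.Adj u b ∧ G.Adj v b) : a = b := by
  have e := M.sided.cn_same huv hP (by rw [hu, hv])
  rw [hu] at e
  exact eq_of_num_eq_one e ha hb

theorem num_ne {p : V → Prop} {a : V} (ha : p a) : num (fun v => p v ∧ v ≠ a) = num p - 1 := by
  rw [num_split p (fun v => v = a), num_eq_one (p := fun v => p v ∧ v = a) ⟨ha, rfl⟩ fun u hu => hu.2]
  ring

theorem exists_ne_of_two_le {p : V → Prop} (h : 2 ≤ num p) (a : V) : ∃ b, p b ∧ b ≠ a := by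
  by_contra hcon
  push Not at hcon
  have : num p ≤ 1 := by
    rw [← num_single a]
    exact num_mono hcon
  linarith

/-- If there is only one vertex of degree five on a side, the graph is the first one of type (iv).
-/
theorem Mixed.windmill (M : Mixed G P) {w : V} (hw : P w) (hw5 : cn G w w = 5)
    (hu : ∀ v, P v → cn G v v = 5 → v = w) : ∃ y, IsWindmill G P w y := by
  have H := M.sided
  obtain ⟨y, hy, hy5⟩ := M.exQ5
  have two : ∀ v, P v → v ≠ w → cn G v v = 2 := fun v hv hne =>
    (M.degP v).resolve_right fun h => hne (hu v hv h)
  have adjw : ∀ v, ¬ P v → G.Adj w v := by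
    intro v hv
    obtain ⟨u, hvu⟩ := H.exists_adj v
    have hPu : P u := by have := H.bip _ _ hvu; tauto
    by_cases e : u = w
    · rw [← e]; exact hvu.symm
    · exact H.nested (iff_of_true hPu hw) (two u hPu e) hw5 hvu.symm
  have huy : ∀ v, ¬ P v → cn G v v = 5 → v = y := by
    intro v hv hv5
    by_contra hne
    have e := H.cn_same hne (iff_of_false hv hy) (by rw [hv5, hy5])
    rw [hv5] at e
    have e2 := num_ne (p := fun u => G.Adj v u ∧ G.Adj y u) (a := w) ⟨(adjw v hv).symm, (adjw y hy).symm⟩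
    change _ = cn G v y - 1 at e2
    rw [e] at e2
    obtain ⟨a, ha, haw⟩ := exists_of_num_pos (by rw [e2]; norm_num)
    obtain ⟨b, ⟨hb, hbw⟩, hba⟩ := exists_ne_of_two_le (by rw [e2]; norm_num) a
    have hPa : P a := by have := H.bip _ _ ha.1; tauto
    have hPb : P b := by have := H.bip _ _ hb.1; tauto
    exact hne (M.not_two_common (iff_of_true hPa hPb) hba.symm (two a hPa haw) (two b hPb hbw)
      ⟨ha.1.symm, hb.1.symm⟩ ⟨ha.2.symm, hb.2.symm⟩)
  have two' : ∀ v, ¬ P v → v ≠ y → cn G v v = 2 := fun v hv hne =>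
    (M.degP v).resolve_right fun h => hne (huy v hv h)
  have adjy : ∀ v, P v → G.Adj y v := by
    intro v hv
    obtain ⟨u, hvu⟩ := H.exists_adj v
    have hPu : ¬ P u := by have := H.bip _ _ hvu; tauto
    by_cases e : u = y
    · rw [← e]; exact hvu.symm
    · exact H.nested (iff_of_false hPu hy) (two' u hPu e) hy5 hvu.symm
  have other : ∀ {u y}, G.Adj u y → cn G u u = 2 → ∃! v, v ≠ y ∧ G.Adj u v := by
    intro u y ha h2
    have e := num_ne (p := fun v => G.Adj u v) ha
    rw [num_adj, h2] at e
    obtain ⟨v, hv⟩ := exists_of_num_pos (by rw [e]; norm_num)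
    exact ⟨v, ⟨hv.2, hv.1⟩, fun z hz => eq_of_num_eq_one e ⟨hz.2, hz.1⟩ hv⟩
  refine ⟨y, H.bip, hw, hy, adjw, adjy, ?_, ?_, ?_⟩
  · rintro u ⟨hPu, hne⟩
    obtain ⟨v, hv, huniq⟩ := other (adjy u hPu).symm (two u hPu hne)
    refine ⟨v, ⟨⟨?_, hv.1⟩, hv.2⟩, fun z hz => huniq z ⟨hz.1.2, hz.2⟩⟩
    have := H.bip _ _ hv.2; tauto
  · rintro u ⟨hPu, hne⟩
    obtain ⟨v, hv, huniq⟩ := other (adjw u hPu).symm (two' u hPu hne)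
    refine ⟨v, ⟨⟨?_, hv.1⟩, hv.2.symm⟩, fun z hz => huniq z ⟨hz.1.2, hz.2.symm⟩⟩
    have := H.bip _ _ hv.2; tauto
  · rw [num_ne hw]
    have : num P = cn G y y := by
      rw [← num_adj]
      refine num_congr fun u => ⟨adjy u, fun h => ?_⟩
      have := H.bip _ _ h; tauto
    rw [this, hy5]; norm_num

/-- At least two vertices of degree five on each side. -/
structure Many (G : SimpleGraph V) (P : V → Prop) : Prop where
  mixed : Mixed G P
  twoP : ∀ w, ∃ v, P v ∧ cn G v v = 5 ∧ v ≠ w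
  twoQ : ∀ w, ∃ v, ¬ P v ∧ cn G v v = 5 ∧ v ≠ w

theorem Many.compl (M : Many G P) : Many G (fun v => ¬ P v) :=
  ⟨M.mixed.compl, M.twoQ, by simpa using M.twoP⟩

theorem Many.not_adj_two (M : Many G P) {u q : V} (hu : P u) (hu2 : cn G u u = 2)
    (hq2 : cn G q q = 2) : ¬ G.Adj u q := by
  intro h
  obtain ⟨w, hw, hw5, -⟩ := M.twoP u
  obtain ⟨w', hw', hw5', hne⟩ := M.twoP w
  have e1 := M.mixed.sided.nested (iff_of_true hu hw) hu2 hw5 h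
  have e2 := M.mixed.sided.nested (iff_of_true hu hw') hu2 hw5' h
  have e := num_ne (p := fun v => G.Adj q v) h.symm
  rw [num_adj, hq2] at e
  refine hne (eq_of_num_eq_one (e.trans (by norm_num)) ⟨e2.symm, ?_⟩ ⟨e1.symm, ?_⟩)
  · rintro rfl; omega
  · rintro rfl; omega

theorem Many.five_of_adj_two (M : Many G P) {u q : V} (hu : P u) (hu2 : cn G u u = 2)
    (h : G.Adj u q) : cn G q q = 5 := by
  exact (M.mixed.degP q).resolve_left fun hq2 => M.not_adj_two hu hu2 hq2 h

/-- A neighbour of a vertex of degree two is adjacent to all vertices of degree five. -/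
theorem Many.adj_five (M : Many G P) {w q y : V} (hw : P w) (h : G.Adj w q) (hq2 : cn G q q = 2)
    (hy : ¬ P y) (hy5 : cn G y y = 5) : G.Adj w y := by
  have hq : ¬ P q := by have := M.mixed.sided.bip _ _ h; tauto
  exact (M.mixed.sided.nested (iff_of_false hq hy) hq2 hy5 h.symm).symm

theorem Many.card_five (M : Many G P) : num (fun v => ¬ P v ∧ cn G v v = 5) = 3 := by
  have H := M.mixed.sided
  obtain ⟨q, hq, hq2⟩ := M.mixed.exQ2
  obtain ⟨w, hw⟩ := H.exists_adj q
  obtain ⟨w', hw', hne⟩ := H.exists_adj_ne q w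
  have hPw : P w := by have := H.bip _ _ hw; tauto
  have hPw' : P w' := by have := H.bip _ _ hw'; tauto
  have w5 := M.compl.five_of_adj_two hq hq2 hw
  have w5' := M.compl.five_of_adj_two hq hq2 hw'
  have e := H.cn_same hne (iff_of_true hPw' hPw) (by rw [w5, w5'])
  rw [w5'] at e
  have e2 := num_ne (p := fun u => G.Adj w' u ∧ G.Adj w u) (a := q) ⟨hw'.symm, hw.symm⟩
  change _ = cn G w' w - 1 at e2
  rw [e] at e2
  refine (num_congr fun v => ⟨?_, ?_⟩).trans (e2.trans (by norm_num))
  · rintro ⟨hv, hv5⟩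
    refine ⟨⟨M.adj_five hPw' hw'.symm hq2 hv hv5, M.adj_five hPw hw.symm hq2 hv hv5⟩, ?_⟩
    rintro rfl; omega
  · rintro ⟨⟨h1, h2⟩, h3⟩
    have hv : ¬ P v := by have := H.bip _ _ h1; tauto
    refine ⟨hv, (M.mixed.degP v).resolve_left fun hv2 => hne ?_⟩
    exact M.mixed.not_two_common (iff_of_false hv hq) h3 hv2 hq2 ⟨h1.symm, hw'⟩ ⟨h2.symm, hw⟩

theorem Many.exists_two (M : Many G P) {w : V} (hw : P w) (hw5 : cn G w w = 5) :
    ∃ q, G.Adj w q ∧ cn G q q = 2 := by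
  by_contra hcon
  push Not at hcon
  have : num (fun q => G.Adj w q) ≤ 3 := by
    rw [← M.card_five]
    refine num_mono fun v hv => ⟨?_, (M.mixed.degP v).resolve_left (hcon v hv)⟩
    have := M.mixed.sided.bip _ _ hv; tauto
  rw [num_adj] at this
  omega

theorem Many.adj_of_five (M : Many G P) {w y : V} (hw : P w) (hw5 : cn G w w = 5)
    (hy : ¬ P y) (hy5 : cn G y y = 5) : G.Adj w y := by
  obtain ⟨q, hq, hq2⟩ := M.exists_two hw hw5
  exact M.adj_five hw hq hq2 hy hy5

theorem Many.match_two (M : Many G P) {q : V} (hq : ¬ P q) (hq2 : cn G q q = 2) :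
    num (fun w => (P w ∧ cn G w w = 5) ∧ ¬ G.Adj q w) = 1 := by
  have e := num_split (fun w => P w ∧ cn G w w = 5) (fun w => G.Adj q w)
  have e1 : num (fun w => (P w ∧ cn G w w = 5) ∧ G.Adj q w) = 2 := by
    rw [← hq2, ← num_adj]
    refine num_congr fun w => ⟨fun h => h.2, fun h => ⟨⟨?_, M.compl.five_of_adj_two hq hq2 h⟩, h⟩⟩
    have := M.mixed.sided.bip _ _ h; tauto
  have e2 := M.compl.card_five
  simp only [not_not] at e2
  linarith

theorem Many.match_five (M : Many G P) {w : V} (hw : P w) (hw5 : cn G w w = 5) :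
    ∃! q, (¬ P q ∧ cn G q q = 2) ∧ ¬ G.Adj w q := by
  have H := M.mixed.sided
  obtain ⟨w', hw', hw5', hne⟩ := M.twoP w
  obtain ⟨q, hq⟩ := exists_of_num_pos
    ((H.exchange hne (iff_of_true hw' hw) (by rw [hw5, hw5'])) ▸ one_pos)
  have hPq : ¬ P q := by have := H.bip _ _ hq.1; tauto
  have hq2 : cn G q q = 2 := (M.mixed.degP q).resolve_right fun h =>
    hq.2 (M.adj_of_five hw hw5 hPq h)
  refine ⟨q, ⟨⟨hPq, hq2⟩, hq.2⟩, ?_⟩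
  rintro z ⟨⟨hz, hz2⟩, hwz⟩
  by_contra hzq
  -- two vertices of degree two missing the same vertex have the same neighbours
  obtain ⟨a, ha⟩ := exists_of_num_pos
    ((H.exchange hzq (iff_of_false hz hPq) (by rw [hz2, hq2])) ▸ one_pos)
  have hPa : P a := by have := H.bip _ _ ha.1; tauto
  have := eq_of_num_eq_one (M.match_two hPq hq2) ⟨⟨hw, hw5⟩, fun h => hq.2 h.symm⟩
    ⟨⟨hPa, M.compl.five_of_adj_two hz hz2 ha.1⟩, ha.2⟩
  rw [this] at hwz
  exact hwz ha.1.symm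

/-- With several vertices of degree five on each side, the graph is the second one of type (iv). -/
theorem Many.doubleStep (M : Many G P) : IsDoubleStep G P (fun v => cn G v v = 5) := by
  have two : ∀ {v}, ¬ cn G v v = 5 ↔ cn G v v = 2 := fun {v} =>
    ⟨fun h => (M.mixed.degP v).resolve_right h, fun h => by omega⟩
  have nn : ∀ v, ¬ ¬ P v ↔ P v := fun v => not_not
  refine ⟨M.mixed.sided.bip, fun u v hu hv h1 h2 => M.adj_of_five hu h1 hv h2,
    fun u v hu _ h1 h2 => M.not_adj_two hu (two.1 h1) (two.1 h2), fun u hu => ?_,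
    fun u hu => ?_, ?_, M.card_five⟩
  · simp only [two]
    by_cases hP : P u
    · obtain ⟨q, hq, huq⟩ := M.match_five hP hu
      exact ⟨q, ⟨by tauto, hq.1.2, hq.2⟩, fun z hz => huq z ⟨⟨by tauto, hz.2.1⟩, hz.2.2⟩⟩
    · obtain ⟨q, hq, huq⟩ := M.compl.match_five hP hu
      exact ⟨q, ⟨by tauto, hq.1.2, hq.2⟩, fun z hz => huq z ⟨⟨by tauto, hz.2.1⟩, hz.2.2⟩⟩
  · rw [two] at hu
    by_cases hP : P u
    · have e := M.compl.match_two (q := u) (by tauto) hu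
      obtain ⟨q, hq⟩ := exists_of_num_pos (e ▸ one_pos)
      exact ⟨q, ⟨by tauto, hq.1.2, hq.2⟩,
        fun z hz => eq_of_num_eq_one e ⟨⟨by tauto, hz.2.1⟩, hz.2.2⟩ hq⟩
    · have e := M.match_two (q := u) hP hu
      obtain ⟨q, hq⟩ := exists_of_num_pos (e ▸ one_pos)
      exact ⟨q, ⟨by tauto, hq.1.2, hq.2⟩,
        fun z hz => eq_of_num_eq_one e ⟨⟨by tauto, hz.2.1⟩, hz.2.2⟩ hq⟩
  · have := M.compl.card_five
    simpa only [not_not] using this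

theorem classify (H : Sided G P) (hP : ∃ v, P v) (hQ : ∃ v, ¬ P v) :
    (∃ P, IsBipComplement G P) ∨ (∃ P w y, IsWindmill G P w y) ∨ ∃ P F, IsDoubleStep G P F := by
  by_cases c1 : ∀ u v, P u → P v → cn G u u = cn G v v
  · exact Or.inl ⟨_, H.of_constant c1 hP⟩
  by_cases c2 : ∀ u v, ¬ P u → ¬ P v → cn G u u = cn G v v
  · exact Or.inl ⟨_, H.compl.of_constant c2 hQ⟩
  obtain ⟨a1, a2, a3⟩ := H.two_or_five c1
  obtain ⟨b1, b2, b3⟩ := H.compl.two_or_five c2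
  have M : Mixed G P := ⟨H, fun v => (em (P v)).elim (a1 v) (b1 v), a2, a3, b2, b3⟩
  right
  by_cases d1 : ∃ w, P w ∧ cn G w w = 5 ∧ ∀ v, P v → cn G v v = 5 → v = w
  · obtain ⟨w, hw, hw5, hu⟩ := d1
    obtain ⟨y, hy⟩ := M.windmill hw hw5 hu
    exact Or.inl ⟨P, w, y, hy⟩
  by_cases d2 : ∃ w, ¬ P w ∧ cn G w w = 5 ∧ ∀ v, ¬ P v → cn G v v = 5 → v = w
  · obtain ⟨w, hw, hw5, hu⟩ := d2
    obtain ⟨y, hy⟩ := M.compl.windmill hw hw5 hu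
    exact Or.inl ⟨_, w, y, hy⟩
  right
  have many : ∀ {P : V → Prop}, (∃ v, P v ∧ cn G v v = 5) →
      (¬ ∃ w, P w ∧ cn G w w = 5 ∧ ∀ v, P v → cn G v v = 5 → v = w) →
      ∀ w, ∃ v, P v ∧ cn G v v = 5 ∧ v ≠ w := by
    intro P hex hno w
    by_contra hcon
    push Not at hcon
    obtain ⟨v, hv, hv5⟩ := hex
    have e := hcon v hv hv5
    subst e
    exact hno ⟨v, hv, hv5, hcon⟩
  exact ⟨P, _, Many.doubleStep ⟨M, many a3 d1, many b3 d2⟩⟩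

end Sided

/-- Without twins the graph is triangle-free, so adjacent vectors are perpendicular; in the plane
this makes the graph bipartite. -/
theorem Admissible.exists_sided (hG : Admissible G) (h1 : ∀ v, wt G v = 1) (v0 : V) :
    ∃ P, Sided G P ∧ P v0 := by
  obtain ⟨x, y, hxy⟩ := hG.gram
  have nt : ∀ {u v}, G.Adj u v → ¬ Tw G u v := fun {u v} h t => h.ne (eq_of_tw (h1 u) t).symm
  have perp : ∀ {u v}, G.Adj u v → x u * x v + y u * y v = 0 := by
    intro u v h
    have e := hG.cn_link ⟨h, nt h⟩
    rw [h1, h1] at e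
    have := hxy u v
    rw [e, if_neg h.ne] at this
    rw [← this]; norm_num
  have pos : ∀ u, 0 < x u * x u + y u * y u := by
    intro u
    rw [← hxy u u, if_pos rfl]
    have : (2 : ℝ) ≤ cn G u u := by exact_mod_cast hG.two_le_degree u
    linarith
  have excl : ∀ v, ¬ (x v0 * y v - y v0 * x v = 0 ∧ x v0 * x v + y v0 * y v = 0) := by
    rintro v ⟨e1, e2⟩
    have := mul_pos (pos v0) (pos v)
    have e : (x v0 * x v0 + y v0 * y v0) * (x v * x v + y v * y v)
      = (x v0 * y v - y v0 * x v) ^ 2 + (x v0 * x v + y v0 * y v) ^ 2 := by ring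
    rw [e, e1, e2] at this
    norm_num at this
  have perp_of_parallel : ∀ {u w}, G.Adj u w → x v0 * y u - y v0 * x u = 0 →
      x v0 * x w + y v0 * y w = 0 := by
    intro u w h e
    have p := perp h
    have : (x u * x u + y u * y u) * (x v0 * x w + y v0 * y w) = 0 := by
      linear_combination (x v0 * x u + y v0 * y u) * p + (x w * y u - y w * x u) * e
    exact (mul_eq_zero.1 this).resolve_left (pos u).ne'
  have parallel_of_perp : ∀ {u w}, G.Adj u w → x v0 * x u + y v0 * y u = 0 →
      x v0 * y w - y v0 * x w = 0 := by
    intro u w h e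
    have p := perp h
    have : (x u * x u + y u * y u) * (x v0 * y w - y v0 * x w) = 0 := by
      linear_combination (x v0 * y u - y v0 * x u) * p + (x u * y w - y u * x w) * e
    exact (mul_eq_zero.1 this).resolve_left (pos u).ne'
  have cov : ∀ v, x v0 * y v - y v0 * x v = 0 ∨ x v0 * x v + y v0 * y v = 0 := fun v =>
    mem_of_connected hG.connected
      (P := fun v => x v0 * y v - y v0 * x v = 0 ∨ x v0 * x v + y v0 * y v = 0) (v := v0)
      (Or.inl (by ring)) (fun u w hu huw => hu.elim (fun e => Or.inr (perp_of_parallel huw e))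
        fun e => Or.inl (parallel_of_perp huw e)) v
  refine ⟨fun v => x v0 * y v - y v0 * x v = 0, ⟨hG, fun u v huv => ⟨fun e e' => ?_, fun e => ?_⟩,
    fun u v huv hP => ?_⟩, by ring⟩
  · exact excl v ⟨e', perp_of_parallel huv e⟩
  · exact parallel_of_perp huv.symm ((cov v).resolve_left e)
  · have par : x u * y v - y u * x v = 0 := by
      by_cases e : x v0 * y u - y v0 * x u = 0
      · have e' := hP.1 e
        have : (x v0 * x v0 + y v0 * y v0) * (x u * y v - y u * x v) = 0 := by
          linear_combination (x v0 * x u + y v0 * y u) * e' - (x v0 * x v + y v0 * y v) * e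
        exact (mul_eq_zero.1 this).resolve_left (pos v0).ne'
      · have f := (cov u).resolve_left e
        have f' := (cov v).resolve_left fun h => e (hP.2 h)
        have : (x v0 * x v0 + y v0 * y v0) * (x u * y v - y u * x v) = 0 := by
          linear_combination (x v0 * y v - y v0 * x v) * f - (x v0 * y u - y v0 * x u) * f'
        exact (mul_eq_zero.1 this).resolve_left (pos v0).ne'
    have a := hxy u v
    have b := hxy u u
    have c := hxy v v
    rw [if_neg huv, sub_zero] at a
    rw [if_pos rfl] at b c
    have : (cn G u v : ℝ) ^ 2 = (cn G u u - 1) * (cn G v v - 1) := by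
      rw [a, b, c]
      linear_combination -(x u * y v - y u * x v) * par
    exact_mod_cast this

/-- The classification in structural form. -/
theorem Admissible.classify (hG : Admissible G) (hN : ∃ u v, u ≠ v ∧ ¬ G.Adj u v) :
    (∃ P, IsCone G P) ∨ (∃ P, IsMatchingJoin G P) ∨
      (∃ P Q z, IsCliquePath G P Q z ∧
        ((num P = 8 ∧ num Q = 3) ∨ (num P = 6 ∧ num Q = 4) ∨ (num P = 5 ∧ num Q = 6))) ∨
      (∃ P Y W, IsTail G P Y W ∧ ((num P = 3 ∧ num Y = 5) ∨ (num P = 4 ∧ num Y = 4))) ∨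
      (∃ P, IsBipComplement G P) ∨ (∃ P w y, IsWindmill G P w y) ∨ ∃ P F, IsDoubleStep G P F := by
  by_cases c1 : ∃ u v, Link G u v ∧ 2 ≤ wt G u ∧ 2 ≤ wt G v
  · obtain ⟨u, v, h, wu, wv⟩ := c1
    rcases hG.classify_link_heavy hN h wu wv with h | h | h
    · exact Or.inl h
    · exact Or.inr (Or.inl h)
    · exact Or.inr (Or.inr (Or.inl h))
  by_cases c2 : ∃ h, 2 ≤ wt G h
  · obtain ⟨h, wh⟩ := c2
    have hII : ∀ u v, Link G u v → 2 ≤ wt G u → wt G v = 1 := fun u v l wu =>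
      (wt_eq_one_or v).resolve_right fun wv => c1 ⟨u, v, l, wu, wv⟩
    rcases hG.classify_heavy_star hN hII wh with h | h | h
    · exact Or.inl h
    · exact Or.inr (Or.inl h)
    · exact Or.inr (Or.inr (Or.inr (Or.inl h)))
  have h1 : ∀ v, wt G v = 1 := fun v => (wt_eq_one_or v).resolve_right fun h => c2 ⟨v, h⟩
  obtain ⟨v0, -⟩ := hN
  obtain ⟨P, H, h0⟩ := hG.exists_sided h1 v0
  obtain ⟨w, hw⟩ := H.exists_adj v0
  exact Or.inr (Or.inr (Or.inr (Or.inr (H.classify ⟨v0, h0⟩ ⟨w, (H.bip _ _ hw).1 h0⟩))))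

end Combinatorics

/-! ### From structure to adjacency matrices -/

section Involutions

theorem card_of_involution {W : Type*} [Fintype W] [DecidableEq W] {σ : Equiv.Perm W}
    (h2 : σ ^ 2 = 1) (hσ : ∀ w, σ w ≠ w) : Fintype.card W = 2 * σ.cycleType.card := by
  have h := Equiv.Perm.cycleType_of_pow_prime_eq_one (p := 2) h2
  have hs := σ.sum_cycleType
  rw [h, Multiset.sum_replicate] at hs
  have : σ.support = Finset.univ := by
    ext w; simp [hσ w]
  rw [this, Finset.card_univ] at hs
  rw [← hs, smul_eq_mul, mul_comm]

/-- Fixed-point-free involutions of sets of the same size are conjugate. -/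
theorem exists_conj_of_involution {W W' : Type*} [Fintype W] [Fintype W']
    (hc : Fintype.card W = Fintype.card W') {σ : Equiv.Perm W} {τ : Equiv.Perm W'}
    (hσ2 : ∀ w, σ (σ w) = w) (hσ : ∀ w, σ w ≠ w) (hτ2 : ∀ w, τ (τ w) = w) (hτ : ∀ w, τ w ≠ w) :
    ∃ e : W ≃ W', ∀ w, e (σ w) = τ (e w) := by
  classical
  let e0 : W ≃ W' := Fintype.equivOfCardEq hc
  have s2 : (e0.permCongr σ) ^ 2 = 1 := by
    ext w
    simp [pow_two, hσ2]
  have t2 : τ ^ 2 = 1 := by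
    ext w
    simp [pow_two, hτ2]
  have s1 : ∀ w, e0.permCongr σ w ≠ w := by
    intro w h
    apply hσ (e0.symm w)
    rw [Equiv.permCongr_apply] at h
    exact (Equiv.eq_symm_apply e0).2 h
  have c1 := card_of_involution s2 s1
  have c2 := card_of_involution t2 hτ
  have hcyc : (e0.permCongr σ).cycleType = τ.cycleType := by
    rw [Equiv.Perm.cycleType_of_pow_prime_eq_one (p := 2) s2,
      Equiv.Perm.cycleType_of_pow_prime_eq_one (p := 2) t2]
    congr 1
    omega
  obtain ⟨c, hc⟩ := isConj_iff.1 (Equiv.Perm.isConj_iff_cycleType_eq.2 hcyc)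
  refine ⟨e0.trans c, fun w => ?_⟩
  rw [← hc]
  simp [Equiv.permCongr_apply]

/-- A symmetric irreflexive relation relating each element to exactly one other comes from a
fixed-point-free involution. -/
theorem exists_involution {W : Type*} {r : W → W → Prop} (hs : ∀ v w, r v w → r w v)
    (hi : ∀ v, ¬ r v v) (h : ∀ v, ∃! w, r v w) :
    ∃ σ : Equiv.Perm W, (∀ w, σ (σ w) = w) ∧ (∀ w, σ w ≠ w) ∧ ∀ v w, r v w ↔ w = σ v := by
  choose f hf hf' using h
  have hff : Function.Involutive f := fun v => (hf' (f v) v (hs _ _ (hf v))).symm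
  refine ⟨hff.toPerm, hff, fun w e => hi w ?_, fun v w => ⟨fun h => hf' v w h, fun e => ?_⟩⟩
  · have := hf w
    rwa [show f w = w from e] at this
  · rw [e]; exact hf v

theorem rev_ne (k : ℕ) (i : Fin (2 * k)) : i.rev ≠ i := by
  intro h
  have := congrArg Fin.val h
  rw [Fin.val_rev] at this
  omega

/-- A relation as above is, in a suitable numbering, the reversal of `Fin (2 * k)`. -/
theorem exists_equiv_rev {W : Type*} [Fintype W] {r : W → W → Prop} (hs : ∀ v w, r v w → r w v)
    (hi : ∀ v, ¬ r v v) (h : ∀ v, ∃! w, r v w) :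
    ∃ (k : ℕ) (e : Fin (2 * k) ≃ W), ∀ i j, r (e i) (e j) ↔ j = i.rev := by
  classical
  obtain ⟨σ, h2, h1, hr⟩ := exists_involution hs hi h
  have hc := card_of_involution (σ := σ) (by ext w; simp [pow_two, h2]) h1
  obtain ⟨e, he⟩ := exists_conj_of_involution (W := Fin (2 * σ.cycleType.card)) (W' := W)
    (σ := Fin.revPerm) (τ := σ) (by rw [hc, Fintype.card_fin]) (fun i => by simp)
    (fun i => rev_ne _ i) h2 h1
  refine ⟨_, e, fun i j => ?_⟩
  rw [hr, ← he, e.apply_eq_iff_eq, Fin.revPerm_apply]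

end Involutions

section Matrices
open scoped Classical
open Function

variable {V : Type*} [Fintype V]
set_option linter.unusedSectionVars false
variable {G : SimpleGraph V} {P Q Y W F : V → Prop}

/-- The real number `x` is the truth value of the proposition `a`. -/
def Entry (a : Prop) (x : ℝ) : Prop := (a ∧ x = 1) ∨ (¬ a ∧ x = 0)

theorem hasAdjMatrix_of_bijective {ι : Type*} {M : Matrix ι ι ℝ} {f : ι → V} (hf : Bijective f)
    (h : ∀ i j, Entry (G.Adj (f i) (f j)) (M i j)) : HasAdjMatrix G M := by
  refine ⟨(Equiv.ofBijective f hf).symm, ?_⟩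
  ext u v
  obtain ⟨i, rfl⟩ := hf.2 u
  obtain ⟨j, rfl⟩ := hf.2 v
  rw [Matrix.submatrix_apply, Equiv.ofBijective_symm_apply_apply,
    Equiv.ofBijective_symm_apply_apply, SimpleGraph.adjMatrix_apply]
  rcases h i j with h | h
  · rw [if_pos h.1, h.2]
  · rw [if_neg h.1, h.2]

theorem entry_JI {n : ℕ} {i j : Fin n} {a : Prop} (h : a ↔ i ≠ j) : Entry a (JI n i j) := by
  by_cases e : i = j
  · refine Or.inr ⟨fun ha => h.1 ha e, ?_⟩
    change (1 : ℝ) - (1 : Matrix _ _ ℝ) i j = 0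
    rw [e, Matrix.one_apply_eq, sub_self]
  · refine Or.inl ⟨h.2 e, ?_⟩
    change (1 : ℝ) - (1 : Matrix _ _ ℝ) i j = 1
    rw [Matrix.one_apply_ne e, sub_zero]

theorem entry_J {a : Prop} {x : ℝ} (h : a) (hx : x = 1 := by rfl) : Entry a x := Or.inl ⟨h, hx⟩

theorem entry_zero {a : Prop} (h : ¬ a) : Entry a 0 := Or.inr ⟨h, rfl⟩

theorem entry_R {n : ℕ} {i j : Fin n} {a : Prop} (h : a ↔ j = i.rev) : Entry a (R n i j) := by
  by_cases e : j = i.rev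
  · exact Or.inl ⟨h.2 e, by simp [R, e]⟩
  · exact Or.inr ⟨fun ha => e (h.1 ha), by simp [R, e]⟩

theorem entry_one {n : ℕ} {i j : Fin n} {a : Prop} (h : a ↔ i = j) :
    Entry a ((1 : Matrix (Fin n) (Fin n) ℝ) i j) := by
  by_cases e : i = j
  · exact Or.inl ⟨h.2 e, by rw [e, Matrix.one_apply_eq]⟩
  · exact Or.inr ⟨fun ha => e (h.1 ha), Matrix.one_apply_ne e⟩

theorem exists_equiv_fin {p : V → Prop} {n : ℕ} (h : num p = n) :
    Nonempty (Fin n ≃ {v // p v}) := by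
  refine ⟨(Fintype.equivFinOfCardEq ?_).symm⟩
  rw [Fintype.card_subtype]
  unfold num at h
  exact_mod_cast h

theorem exists_num (p : V → Prop) : ∃ n : ℕ, num p = n := ⟨_, rfl⟩

theorem exists_equiv_of_bij {p q : V → Prop} {r : V → V → Prop}
    (h1 : ∀ v, p v → ∃! w, q w ∧ r v w) (h2 : ∀ w, q w → ∃! v, p v ∧ r v w) :
    ∃ f : {v // p v} ≃ {w // q w},
      ∀ (v : {v // p v}) (w : {w // q w}), r v w ↔ f v = w := by
  choose f hf hf' using h1
  let g : {v // p v} → {w // q w} := fun v => ⟨f v v.2, (hf v v.2).1⟩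
  have hg : Bijective g := by
    constructor
    · intro u v e
      have e' : f u u.2 = f v v.2 := congrArg Subtype.val e
      exact Subtype.ext ((h2 _ (hf u u.2).1).unique ⟨u.2, (hf u u.2).2⟩
        ⟨v.2, e' ▸ (hf v v.2).2⟩)
    · intro w
      obtain ⟨v, hv, -⟩ := h2 w w.2
      exact ⟨⟨v, hv.1⟩, Subtype.ext (hf' v hv.1 w ⟨w.2, hv.2⟩).symm⟩
  refine ⟨Equiv.ofBijective g hg, fun v w => ⟨fun h => ?_, fun h => ?_⟩⟩
  · exact Subtype.ext (hf' v v.2 w ⟨w.2, h⟩).symm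
  · rw [← h]; exact (hf v v.2).2

/-- The bijection assembled from bijections onto two complementary sets. -/
theorem bijective_sum {ι κ : Type*} {p q : V → Prop} (e : ι ≃ {v // p v}) (e' : κ ≃ {v // q v})
    (hc : ∀ v, p v ∨ q v) (hd : ∀ v, p v → ¬ q v) :
    Bijective (Sum.elim (fun i => (e i : V)) (fun j => (e' j : V))) := by
  constructor
  · rintro (i | i) (j | j) h
    · exact congrArg Sum.inl (e.injective (Subtype.ext h))
    · exact (hd _ (e i).2 (by
        have h' : (e i : V) = e' j := h
        rw [h']; exact (e' j).2)).elim
    · exact (hd _ (e j).2 (by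
        have h' : (e' i : V) = e j := h
        rw [← h']; exact (e' i).2)).elim
    · exact congrArg Sum.inr (e'.injective (Subtype.ext h))
  · intro v
    rcases hc v with hv | hv
    · exact ⟨Sum.inl (e.symm ⟨v, hv⟩), by simp⟩
    · exact ⟨Sum.inr (e'.symm ⟨v, hv⟩), by simp⟩

/-- A bijection onto a disjoint union of two sets. -/
theorem exists_equiv_sum {ι κ : Type*} {p q s : V → Prop} (e : ι ≃ {v // p v})
    (e' : κ ≃ {v // q v}) (hs : ∀ v, s v ↔ p v ∨ q v) (hd : ∀ v, p v → ¬ q v) :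
    ∃ f : ι ⊕ κ ≃ {v // s v}, (∀ i, (f (Sum.inl i) : V) = e i) ∧
      ∀ j, (f (Sum.inr j) : V) = e' j := by
  let g : ι ⊕ κ → {v // s v} := Sum.elim (fun i => ⟨e i, (hs _).2 (Or.inl (e i).2)⟩)
    (fun j => ⟨e' j, (hs _).2 (Or.inr (e' j).2)⟩)
  have hg : Bijective g := by
    constructor
    · rintro (i | i) (j | j) h
      · exact congrArg Sum.inl (e.injective (Subtype.ext (congrArg Subtype.val h :)))
      · exact (hd _ (e i).2 (by
          have h' : (e i : V) = e' j := congrArg Subtype.val h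
          rw [h']; exact (e' j).2)).elim
      · exact (hd _ (e j).2 (by
          have h' : (e' i : V) = e j := congrArg Subtype.val h
          rw [← h']; exact (e' i).2)).elim
      · exact congrArg Sum.inr (e'.injective (Subtype.ext (congrArg Subtype.val h :)))
    · rintro ⟨v, hv⟩
      rcases (hs v).1 hv with hv | hv
      · exact ⟨Sum.inl (e.symm ⟨v, hv⟩), Subtype.ext (by simp [g])⟩
      · exact ⟨Sum.inr (e'.symm ⟨v, hv⟩), Subtype.ext (by simp [g])⟩
  exact ⟨Equiv.ofBijective g hg, fun i => rfl, fun j => rfl⟩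

theorem adj_iff_ne {n : ℕ} {p : V → Prop} (e : Fin n ≃ {v // p v})
    (h : ∀ u v, p u → p v → u ≠ v → G.Adj u v) (i j : Fin n) : G.Adj (e i) (e j) ↔ i ≠ j := by
  constructor
  · rintro ha rfl
    exact G.irrefl ha
  · intro hne
    exact h _ _ (e i).2 (e j).2 fun h => hne (e.injective (Subtype.ext h))

theorem exists_equiv_matching {p : V → Prop} (h : ∀ v, p v → ∃! w, p w ∧ G.Adj v w) :
    ∃ (k : ℕ) (e : Fin (2 * k) ≃ {v // p v}), ∀ i j, G.Adj (e i) (e j) ↔ j = i.rev := by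
  refine exists_equiv_rev (r := fun u v : {v // p v} => G.Adj u v) (fun v w h => h.symm)
    (fun v => G.irrefl) fun v => ?_
  obtain ⟨w, hw, hu⟩ := h v v.2
  exact ⟨⟨w, hw.1⟩, hw.2, fun u hu' => Subtype.ext (hu u ⟨u.2, hu'⟩)⟩

/-- A matching with two vertices that are not adjacent has at least two edges. -/
theorem two_le_of_not_rev {k : ℕ} {i j : Fin (2 * k)} (hij : i ≠ j) (h : j ≠ i.rev) : 2 ≤ k := by
  by_contra hk
  have h1 := i.2
  have h2 := j.2
  have h3 : (i : ℕ) ≠ j := fun e => hij (Fin.ext e)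
  have h4 : (j : ℕ) ≠ i.rev := fun e => h (Fin.ext e)
  rw [Fin.val_rev] at h4
  omega

theorem IsCone.isTypeII (H : IsCone G P) (hN : ∃ u v, u ≠ v ∧ ¬ G.Adj u v) :
    ∃ a k, IsTypeII a k G := by
  obtain ⟨a, ha⟩ := exists_num P
  obtain ⟨e⟩ := exists_equiv_fin ha
  obtain ⟨k, e', he'⟩ := exists_equiv_matching (p := fun v => ¬ P v) H.matching
  have ha1 : 1 ≤ a := by
    obtain ⟨v, hv⟩ := H.nonempty
    have := one_le_num hv
    rw [ha] at this
    exact_mod_cast this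
  have hk : 2 ≤ k := by
    obtain ⟨u, v, huv, hadj⟩ := hN
    have hu : ¬ P u := fun hu => hadj (H.join u v hu huv)
    have hv : ¬ P v := fun hv => hadj (H.join v u hv huv.symm).symm
    refine two_le_of_not_rev (i := e'.symm ⟨u, hu⟩) (j := e'.symm ⟨v, hv⟩) ?_ ?_
    · intro h
      exact huv (congrArg Subtype.val (e'.symm.injective h))
    · intro h
      apply hadj
      have := (he' _ _).2 h
      simpa using this
  refine ⟨a, k, ha1, hk, hasAdjMatrix_of_bijective
    (bijective_sum e e' (fun v => em _) (fun v h h' => h' h)) ?_⟩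
  have jn : ∀ i j, G.Adj (e i) (e' j) := fun i j =>
    H.join _ _ (e i).2 fun h => (e' j).2 (h ▸ (e i).2)
  rintro (i | i) (j | j)
  · exact entry_JI (adj_iff_ne e (fun u v hu _ hne => H.join u v hu hne) i j)
  · exact entry_J (jn i j)
  · exact entry_J (jn j i).symm
  · exact entry_R (he' i j)

theorem IsMatchingJoin.isTypeIII (H : IsMatchingJoin G P) : ∃ l m, IsTypeIII l m G := by
  obtain ⟨l, e, he⟩ := exists_equiv_matching (G := G) (p := P) fun v hv => by
    obtain ⟨w, hw, hu⟩ := H.matching v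
    exact ⟨w, ⟨hw.1.2 hv, hw.2⟩, fun u h => hu u ⟨iff_of_true h.1 hv, h.2⟩⟩
  obtain ⟨m, e', he'⟩ := exists_equiv_matching (G := G) (p := fun v => ¬ P v) fun v hv => by
    obtain ⟨w, hw, hu⟩ := H.matching v
    exact ⟨w, ⟨fun h => hv (hw.1.1 h), hw.2⟩, fun u h => hu u ⟨iff_of_false h.1 hv, h.2⟩⟩
  have two : ∀ {k : ℕ} {p : V → Prop} (e : Fin (2 * k) ≃ {v // p v}),
      (∀ i j, G.Adj (e i) (e j) ↔ j = i.rev) → (∃ u v, p u ∧ p v ∧ u ≠ v ∧ ¬ G.Adj u v) →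
      2 ≤ k := by
    rintro k p e he ⟨u, v, hu, hv, huv, hadj⟩
    refine two_le_of_not_rev (i := e.symm ⟨u, hu⟩) (j := e.symm ⟨v, hv⟩) ?_ ?_
    · intro h
      exact huv (congrArg Subtype.val (e.symm.injective h))
    · intro h
      apply hadj
      have := (he _ _).2 h
      simpa using this
  have hl := two e he H.left
  have hm := two e' he' H.right
  have jn : ∀ i j, G.Adj (e i) (e' j) := fun i j => H.join _ _ (e i).2 (e' j).2
  rcases le_total m l with hml | hlm
  · refine ⟨l, m, hml, hm, hasAdjMatrix_of_bijective
      (bijective_sum e e' (fun v => em _) (fun v h h' => h' h)) ?_⟩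
    rintro (i | i) (j | j)
    · exact entry_R (he i j)
    · exact entry_J (jn i j)
    · exact entry_J (jn j i).symm
    · exact entry_R (he' i j)
  · refine ⟨m, l, hlm, hl, hasAdjMatrix_of_bijective
      (bijective_sum e' e (fun v => (em _).symm) (fun v h h' => h h')) ?_⟩
    rintro (i | i) (j | j)
    · exact entry_R (he' i j)
    · exact entry_J (jn j i).symm
    · exact entry_J (jn i j)
    · exact entry_R (he i j)

theorem IsBipComplement.isTypeI (H : IsBipComplement G P) : ∃ m, IsTypeI m G := by
  obtain ⟨m, hm⟩ := exists_num P
  obtain ⟨e⟩ := exists_equiv_fin hm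
  obtain ⟨f, hf⟩ := exists_equiv_of_bij (p := P) (q := fun v => ¬ P v) (r := fun u v => ¬ G.Adj u v)
    (fun v hv => by
      obtain ⟨w, hw, hu⟩ := H.matching v
      exact ⟨w, ⟨by tauto, hw.2⟩, fun z hz => hu z ⟨by tauto, hz.2⟩⟩)
    (fun v hv => by
      obtain ⟨w, hw, hu⟩ := H.matching v
      exact ⟨w, ⟨by tauto, fun h => hw.2 h.symm⟩, fun z hz => hu z ⟨by tauto, fun h => hz.2 h.symm⟩⟩)
  have adj : ∀ i j, G.Adj (e i) ((e.trans f) j) ↔ i ≠ j := by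
    intro i j
    have := hf (e i) ((e.trans f) j)
    rw [← not_iff_not, this]
    simp
  refine ⟨m, ?_, hasAdjMatrix_of_bijective
    (bijective_sum e (e.trans f) (fun v => em _) (fun v h h' => h' h)) ?_⟩
  · have := H.card
    rw [hm] at this
    exact_mod_cast this
  rintro (i | i) (j | j)
  · refine entry_zero fun h => ?_
    exact (H.bip _ _ h).1 (e i).2 (e j).2
  · exact entry_JI (adj i j)
  · exact entry_JI (((G.adj_comm _ _).trans (adj j i)).trans ne_comm)
  · refine entry_zero fun h => ?_
    exact (e.trans f i).2 ((H.bip _ _ h).2 (e.trans f j).2)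

theorem IsTail.isTypeVI (H : IsTail G P Y W)
    (h : (num P = 3 ∧ num Y = 5) ∨ (num P = 4 ∧ num Y = 4)) :
    IsTypeVI 3 5 G ∨ IsTypeVI 4 4 G := by
  have key : ∀ a m : ℕ, num P = a → num Y = m → HasAdjMatrix G
      (Matrix.fromBlocks
        (Matrix.fromBlocks (JI a) (J a m) (J m a) 0)
        (Matrix.fromRows (0 : Matrix (Fin a) (Fin m) ℝ) (JI m))
        (Matrix.fromCols (0 : Matrix (Fin m) (Fin a) ℝ) (JI m)) 0) := by
    intro a m ha hm
    obtain ⟨e1⟩ := exists_equiv_fin ha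
    obtain ⟨e2⟩ := exists_equiv_fin hm
    obtain ⟨f, hf⟩ := exists_equiv_of_bij (p := Y) (q := W) (r := fun u v => ¬ G.Adj u v)
      H.matchY H.matchW
    obtain ⟨e12, h1, h2⟩ := exists_equiv_sum (s := fun v => P v ∨ Y v) e1 e2 (fun v => Iff.rfl)
      H.disj_PY
    have adj : ∀ i j, G.Adj (e2 i) ((e2.trans f) j) ↔ i ≠ j := by
      intro i j
      have := hf (e2 i) ((e2.trans f) j)
      rw [← not_iff_not, this]
      simp
    refine hasAdjMatrix_of_bijective (bijective_sum e12 (e2.trans f)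
      (fun v => (or_assoc.2 (H.cover v))) fun v h h' => h.elim (fun h => H.disj_PW v h h')
        fun h => H.disj_YW v h h') ?_
    rintro ((i | i) | i) ((j | j) | j) <;> simp only [Sum.elim_inl, Sum.elim_inr, h1, h2]
    · exact entry_JI (adj_iff_ne e1 H.adj_P i j)
    · exact entry_J (H.adj_PY _ _ (e1 i).2 (e2 j).2)
    · exact entry_zero (H.not_adj_PW _ _ (e1 i).2 (e2.trans f j).2)
    · exact entry_J (H.adj_PY _ _ (e1 j).2 (e2 i).2).symm
    · exact entry_zero (H.not_adj_Y _ _ (e2 i).2 (e2 j).2)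
    · exact entry_JI (adj i j)
    · exact entry_zero fun h => H.not_adj_PW _ _ (e1 j).2 (e2.trans f i).2 h.symm
    · exact entry_JI (((G.adj_comm _ _).trans (adj j i)).trans ne_comm)
    · exact entry_zero (H.not_adj_W _ _ (e2.trans f i).2 (e2.trans f j).2)
  rcases h with h | h
  · exact Or.inl ⟨Or.inl ⟨rfl, rfl⟩, key 3 5 (by exact_mod_cast h.1) (by exact_mod_cast h.2)⟩
  · exact Or.inr ⟨Or.inr ⟨rfl, rfl⟩, key 4 4 (by exact_mod_cast h.1) (by exact_mod_cast h.2)⟩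

/-- The path of three cliques of sizes `a`, `c`, `1`, consecutive ones being completely joined. -/
def cliquePath (a c : ℕ) : Matrix ((Fin a ⊕ Fin c) ⊕ Fin 1) ((Fin a ⊕ Fin c) ⊕ Fin 1) ℝ :=
  Matrix.fromBlocks
    (Matrix.fromBlocks (JI a) (J a c) (J c a) (JI c))
    (Matrix.fromRows (0 : Matrix (Fin a) (Fin 1) ℝ) (J c 1))
    (Matrix.fromCols (0 : Matrix (Fin 1) (Fin a) ℝ) (J 1 c)) 0

theorem num_eq_single (z : V) : num (fun v => v = z) = (1 : ℕ) := by
  rw [num_single]; norm_num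

theorem IsCliquePath.hasAdjMatrix {z : V} (H : IsCliquePath G P Q z) {a c : ℕ} (ha : num P = a)
    (hc : num Q = c) : HasAdjMatrix G (cliquePath a c) := by
  obtain ⟨e1⟩ := exists_equiv_fin ha
  obtain ⟨e2⟩ := exists_equiv_fin hc
  obtain ⟨e3⟩ := exists_equiv_fin (num_eq_single z)
  obtain ⟨e12, h1, h2⟩ := exists_equiv_sum (s := fun v => P v ∨ Q v) e1 e2 (fun v => Iff.rfl)
    H.disj
  refine hasAdjMatrix_of_bijective (bijective_sum e12 e3
    (fun v => (or_assoc.2 (H.cover v))) fun v h h' => h.elim (fun h => H.notP (h' ▸ h))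
      fun h => H.notQ (h' ▸ h)) ?_
  rintro ((i | i) | i) ((j | j) | j) <;> simp only [Sum.elim_inl, Sum.elim_inr, h1, h2, (e3 _).2]
  · exact entry_JI (adj_iff_ne e1 H.adj_P i j)
  · exact entry_J (H.adj_PQ _ _ (e1 i).2 (e2 j).2)
  · exact entry_zero (H.not_adj_Pz _ (e1 i).2)
  · exact entry_J (H.adj_PQ _ _ (e1 j).2 (e2 i).2).symm
  · exact entry_JI (adj_iff_ne e2 H.adj_Q i j)
  · exact entry_J (H.adj_Qz _ (e2 i).2)
  · exact entry_zero fun h => H.not_adj_Pz _ (e1 j).2 h.symm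
  · exact entry_J (H.adj_Qz _ (e2 j).2).symm
  · exact entry_zero G.irrefl

theorem IsWindmill.isTypeIVFirst {w y : V} (H : IsWindmill G P w y) : IsTypeIVFirst G := by
  obtain ⟨ew⟩ := exists_equiv_fin (num_eq_single w)
  obtain ⟨ey⟩ := exists_equiv_fin (num_eq_single y)
  obtain ⟨e⟩ := exists_equiv_fin (n := 4) H.card
  obtain ⟨f, hf⟩ := exists_equiv_of_bij (r := fun u v => G.Adj u v) H.matchP H.matchQ
  obtain ⟨e1, h1, h2⟩ := exists_equiv_sum (s := P) ew e
    (fun v => ⟨fun h => (em _).imp_right fun h' => ⟨h, h'⟩,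
      fun h => h.elim (fun h => h ▸ H.memP) fun h => h.1⟩) fun v h h' => h'.2 h
  obtain ⟨e2, h3, h4⟩ := exists_equiv_sum (s := fun v => ¬ P v) ey (e.trans f)
    (fun v => ⟨fun h => (em _).imp_right fun h' => ⟨h, h'⟩,
      fun h => h.elim (fun h => h ▸ H.not_memP) fun h => h.1⟩) fun v h h' => h'.2 h
  have adj : ∀ i j, G.Adj (e i) ((e.trans f) j) ↔ i = j := by
    intro i j
    rw [hf (e i) ((e.trans f) j)]
    simp
  have N : ∀ i j, Entry (G.Adj (e1 i) (e2 j)) (Matrix.fromBlocks (J 1 1) (J 1 4) (J 4 1)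
      (1 : Matrix (Fin 4) (Fin 4) ℝ) i j) := by
    rintro (i | i) (j | j) <;> simp only [h1, h2, h3, h4, (ew _).2, (ey _).2]
    · exact entry_J (H.adj_w _ H.not_memP)
    · exact entry_J (H.adj_w _ (e.trans f j).2.1)
    · exact entry_J (H.adj_y _ (e i).2.1).symm
    · exact entry_one (adj i j)
  refine hasAdjMatrix_of_bijective (bijective_sum e1 e2 (fun v => em _) fun v h h' => h' h) ?_
  rintro (i | i) (j | j)
  · refine entry_zero fun h => ?_
    exact (H.bip _ _ h).1 (e1 i).2 (e1 j).2
  · exact N i j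
  · have := N j i
    rw [G.adj_comm] at this
    exact this
  · refine entry_zero fun h => ?_
    exact (e2 i).2 ((H.bip _ _ h).2 (e2 j).2)

theorem IsDoubleStep.isTypeIVSecond (H : IsDoubleStep G P F) : IsTypeIVSecond G := by
  obtain ⟨eP⟩ := exists_equiv_fin (n := 3) H.card_P
  obtain ⟨eQ⟩ := exists_equiv_fin (n := 3) H.card_Q
  obtain ⟨f, hf⟩ := exists_equiv_of_bij (p := fun v => P v ∧ F v) (q := fun v => ¬ P v ∧ ¬ F v)
    (r := fun u v => ¬ G.Adj u v)
    (fun v hv => by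
      obtain ⟨w, hw, hu⟩ := H.match_F v hv.2
      exact ⟨w, ⟨by tauto, hw.2.2⟩, fun z hz => hu z ⟨by tauto, by tauto⟩⟩)
    (fun v hv => by
      obtain ⟨w, hw, hu⟩ := H.match_nF v hv.2
      exact ⟨w, ⟨by tauto, fun h => hw.2.2 h.symm⟩,
        fun z hz => hu z ⟨by tauto, by tauto, fun h => hz.2 h.symm⟩⟩)
  obtain ⟨g, hg⟩ := exists_equiv_of_bij (p := fun v => ¬ P v ∧ F v) (q := fun v => P v ∧ ¬ F v)
    (r := fun u v => ¬ G.Adj u v)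
    (fun v hv => by
      obtain ⟨w, hw, hu⟩ := H.match_F v hv.2
      exact ⟨w, ⟨by tauto, hw.2.2⟩, fun z hz => hu z ⟨by tauto, by tauto⟩⟩)
    (fun v hv => by
      obtain ⟨w, hw, hu⟩ := H.match_nF v hv.2
      exact ⟨w, ⟨by tauto, fun h => hw.2.2 h.symm⟩,
        fun z hz => hu z ⟨by tauto, by tauto, fun h => hz.2 h.symm⟩⟩)
  obtain ⟨e1, h1, h2⟩ := exists_equiv_sum (s := P) eP (eQ.trans g)
    (fun v => by tauto) fun v h h' => h'.2 h.2
  obtain ⟨e2, h3, h4⟩ := exists_equiv_sum (s := fun v => ¬ P v) (eP.trans f) eQ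
    (fun v => by tauto) fun v h h' => h.2 h'.2
  have adjf : ∀ i j, G.Adj (eP i) ((eP.trans f) j) ↔ i ≠ j := by
    intro i j
    rw [← not_iff_not, hf (eP i) ((eP.trans f) j)]
    simp
  have adjg : ∀ i j, G.Adj ((eQ.trans g) i) (eQ j) ↔ i ≠ j := by
    intro i j
    rw [G.adj_comm, ← not_iff_not, hg (eQ j) ((eQ.trans g) i)]
    simp [eq_comm]
  have N : ∀ i j, Entry (G.Adj (e1 i) (e2 j)) (Matrix.fromBlocks (JI 3) (J 3 3) 0 (JI 3) i j) := by
    rintro (i | i) (j | j) <;> simp only [h1, h2, h3, h4]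
    · exact entry_JI (adjf i j)
    · exact entry_J (H.adj_F _ _ (eP i).2.1 (eQ j).2.1 (eP i).2.2 (eQ j).2.2)
    · exact entry_zero (H.not_adj _ _ (eQ.trans g i).2.1 (eP.trans f j).2.1 (eQ.trans g i).2.2
        (eP.trans f j).2.2)
    · exact entry_JI (adjg i j)
  refine hasAdjMatrix_of_bijective (bijective_sum e1 e2 (fun v => em _) fun v h h' => h' h) ?_
  rintro (i | i) (j | j)
  · refine entry_zero fun h => ?_
    exact (H.bip _ _ h).1 (e1 i).2 (e1 j).2
  · exact N i j
  · have := N j i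
    rw [G.adj_comm] at this
    exact this
  · refine entry_zero fun h => ?_
    exact (e2 i).2 ((H.bip _ _ h).2 (e2 j).2)

/-- The types that occur, with the paths of cliques as an additional one. -/
theorem Admissible.types (hG : Admissible G) (hN : ∃ u v, u ≠ v ∧ ¬ G.Adj u v) :
    (∃ m, IsTypeI m G) ∨ (∃ a k, IsTypeII a k G) ∨ (∃ l m, IsTypeIII l m G) ∨ IsTypeIVFirst G ∨
      IsTypeIVSecond G ∨ HasAdjMatrix G (cliquePath 8 3) ∨ HasAdjMatrix G (cliquePath 6 4) ∨
      HasAdjMatrix G (cliquePath 5 6) ∨ IsTypeVI 3 5 G ∨ IsTypeVI 4 4 G := by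
  rcases hG.classify hN with ⟨P, H⟩ | ⟨P, H⟩ | ⟨P, Q, z, H, h⟩ | ⟨P, Y, W, H, h⟩ | ⟨P, H⟩ |
    ⟨P, w, y, H⟩ | ⟨P, F, H⟩
  · exact Or.inr (Or.inl (H.isTypeII hN))
  · exact Or.inr (Or.inr (Or.inl H.isTypeIII))
  · have : HasAdjMatrix G (cliquePath 8 3) ∨ HasAdjMatrix G (cliquePath 6 4) ∨
        HasAdjMatrix G (cliquePath 5 6) := by
      rcases h with h | h | h
      · exact Or.inl (H.hasAdjMatrix (by exact_mod_cast h.1) (by exact_mod_cast h.2))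
      · exact Or.inr (Or.inl (H.hasAdjMatrix (by exact_mod_cast h.1) (by exact_mod_cast h.2)))
      · exact Or.inr (Or.inr (H.hasAdjMatrix (by exact_mod_cast h.1) (by exact_mod_cast h.2)))
    tauto
  · have := H.isTypeVI h
    tauto
  · exact Or.inl H.isTypeI
  · have := H.isTypeIVFirst
    tauto
  · have := H.isTypeIVSecond
    tauto

end Matrices

/-! ### Eigenbases and the Gram matrix -/

section Spectral
open scoped Classical
open Finset

variable {V : Type*} [Fintype V]
set_option linter.unusedSectionVars false
variable {G : SimpleGraph V} {μ : V → ℝ} {E : V → V → ℝ}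

/-- The truth value of adjacency, as a real number. -/
noncomputable def adj (G : SimpleGraph V) (u v : V) : ℝ := if G.Adj u v then 1 else 0

/-- The Kronecker delta. -/
noncomputable def dl (u v : V) : ℝ := if u = v then 1 else 0

/-- The vectors `E i` form an orthonormal basis of eigenvectors of the adjacency matrix, with
eigenvalues `μ i`. -/
structure IsEigenbasis (G : SimpleGraph V) (μ : V → ℝ) (E : V → V → ℝ) : Prop where
  eigen : ∀ i u, ∑ v, adj G u v * E i v = μ i * E i u
  complete : ∀ u v, ∑ i, E i u * E i v = dl u v
  orthonormal : ∀ i j, ∑ u, E i u * E j u = dl i j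
  spectrum : adjSpectrum G = univ.val.map μ

theorem adj_comm (u v : V) : adj G u v = adj G v u := by
  unfold adj; simp only [G.adj_comm]

theorem adj_of {u v : V} (h : G.Adj u v) : adj G u v = 1 := if_pos h
theorem adj_of_not {u v : V} (h : ¬ G.Adj u v) : adj G u v = 0 := if_neg h
theorem dl_self (u : V) : dl u u = 1 := if_pos rfl
theorem dl_of_ne {u v : V} (h : u ≠ v) : dl u v = 0 := if_neg h

theorem exists_isEigenbasis (G : SimpleGraph V) : ∃ μ E, IsEigenbasis G μ E := by
  have hA : (G.adjMatrix ℝ).IsHermitian := by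
    rw [Matrix.IsHermitian, Matrix.conjTranspose_eq_transpose_of_trivial]
    exact G.isSymm_adjMatrix
  let U : Matrix V V ℝ := hA.eigenvectorUnitary
  have h1 : U * U.transpose = 1 := by
    have := (Matrix.mem_unitaryGroup_iff.1 hA.eigenvectorUnitary.2)
    rwa [Matrix.star_eq_conjTranspose, Matrix.conjTranspose_eq_transpose_of_trivial] at this
  have h2 : U.transpose * U = 1 := by
    have := (Matrix.mem_unitaryGroup_iff'.1 hA.eigenvectorUnitary.2)
    rwa [Matrix.star_eq_conjTranspose, Matrix.conjTranspose_eq_transpose_of_trivial] at this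
  refine ⟨hA.eigenvalues, fun i u => U u i, fun i u => ?_, fun u v => ?_, fun i j => ?_, ?_⟩
  · have := congrFun (hA.mulVec_eigenvectorBasis i) u
    simp only [Matrix.mulVec, dotProduct, SimpleGraph.adjMatrix_apply, Pi.smul_apply,
      smul_eq_mul] at this
    exact this
  · have := congrFun (congrFun h1 u) v
    rwa [Matrix.mul_apply, Matrix.one_apply] at this
  · have := congrFun (congrFun h2 i) j
    rwa [Matrix.mul_apply, Matrix.one_apply] at this
  · unfold adjSpectrum
    rw [hA.roots_charpoly_eq_eigenvalues]
    rfl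

theorem sum_dl (v : V) (f : V → ℝ) : ∑ w, f w * dl w v = f v := by
  simp [dl]

theorem cn_eq_sum (u v : V) : (cn G u v : ℝ) = ∑ w, adj G u w * adj G w v := by
  unfold cn num
  rw [Finset.card_filter]
  push_cast
  refine sum_congr rfl fun w _ => ?_
  rw [adj_comm w v]
  unfold adj
  by_cases h1 : G.Adj u w <;> by_cases h2 : G.Adj v w <;> simp [h1, h2]

namespace IsEigenbasis

theorem adj_eq (H : IsEigenbasis G μ E) (u v : V) : adj G u v = ∑ i, μ i * (E i u * E i v) := by
  calc adj G u v = ∑ w, adj G u w * ∑ i, E i w * E i v := by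
        simp only [H.complete]; rw [sum_dl]
    _ = ∑ i, (∑ w, adj G u w * E i w) * E i v := by
        simp only [mul_sum, sum_mul]
        rw [sum_comm]
        exact sum_congr rfl fun i _ => sum_congr rfl fun w _ => by ring
    _ = _ := sum_congr rfl fun i _ => by rw [H.eigen]; ring

/-- The matrices `∑ f i • E i (E i)ᵀ` multiply like the functions `f`. -/
theorem mul_eq (H : IsEigenbasis G μ E) (f g : V → ℝ) (u v : V) :
    ∑ i, f i * g i * (E i u * E i v) =
      ∑ w, (∑ i, f i * (E i u * E i w)) * ∑ j, g j * (E j w * E j v) := by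
  symm
  calc ∑ w, (∑ i, f i * (E i u * E i w)) * ∑ j, g j * (E j w * E j v)
      = ∑ i, ∑ j, (f i * E i u * (g j * E j v)) * ∑ w, E i w * E j w := by
        simp only [mul_sum, sum_mul]
        rw [sum_comm]
        refine (sum_congr rfl fun j _ => sum_comm).trans ?_
        rw [sum_comm]
        exact sum_congr rfl fun i _ => sum_congr rfl fun j _ => sum_congr rfl fun w _ => by ring
    _ = ∑ i, f i * g i * (E i u * E i v) := by
        refine sum_congr rfl fun i _ => ?_
        simp only [H.orthonormal]
        simp [dl]
        ring

theorem cn_eq (H : IsEigenbasis G μ E) (u v : V) :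
    (cn G u v : ℝ) = ∑ i, μ i * μ i * (E i u * E i v) := by
  rw [cn_eq_sum, H.mul_eq]
  simp only [H.adj_eq]

theorem form_eq (f s t : V → ℝ) :
    ∑ i, f i * ((∑ u, E i u * s u) * ∑ v, E i v * t v) =
      ∑ u, ∑ v, (∑ i, f i * (E i u * E i v)) * (s u * t v) := by
  simp only [mul_sum, sum_mul]
  rw [sum_comm]
  refine (sum_congr rfl fun v _ => sum_comm).trans ?_
  rw [sum_comm]
  exact sum_congr rfl fun i _ => sum_congr rfl fun j _ => sum_congr rfl fun w _ => by ring

theorem add_const (H : IsEigenbasis G μ E) (c : ℝ) (u v : V) :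
    ∑ i, (μ i + c) * (E i u * E i v) = adj G u v + c * dl u v := by
  rw [H.adj_eq, ← H.complete, mul_sum, ← sum_add_distrib]
  exact sum_congr rfl fun i _ => by ring

/-- The quadratic form of `A + c` at an eigenvector. -/
theorem form_eigen (H : IsEigenbasis G μ E) (c : ℝ) (j : V) :
    ∑ u, ∑ v, (adj G u v + c * dl u v) * (E j u * E j v) = μ j + c := by
  have h := form_eq (E := E) (fun i => μ i + c) (E j) (E j)
  simp only [H.add_const, H.orthonormal] at h
  rw [← h]
  have : ∀ i, (μ i + c) * (dl i j * dl i j) = (μ i + c) * dl i j := by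
    intro i
    unfold dl
    split_ifs <;> ring
  simp only [this]
  rw [sum_dl]

/-- An eigenvalue below `-1` forces one above `1`, as the largest absolute value of an eigenvalue is
an eigenvalue. -/
theorem exists_one_lt (H : IsEigenbasis G μ E) {j : V} (hj : μ j < -1) : ∃ i, 1 < μ i := by
  by_contra hcon
  push Not at hcon
  -- Rayleigh quotient of the vector of absolute values
  have h1 := form_eq (E := E) (fun i => μ i + (-1)) (fun u => |E j u|) (fun u => |E j u|)
  simp only [H.add_const] at h1
  have h2 : ∑ i, (μ i + (-1)) * ((∑ u, E i u * |E j u|) * ∑ v, E i v * |E j v|) ≤ 0 :=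
    sum_nonpos fun i _ => mul_nonpos_of_nonpos_of_nonneg (by linarith [hcon i]) (mul_self_nonneg _)
  have h3 := H.form_eigen 1 j
  have h4 : -(∑ u, ∑ v, (adj G u v + 1 * dl u v) * (E j u * E j v))
      ≤ ∑ u, ∑ v, (adj G u v + (-1) * dl u v) * (|E j u| * |E j v|) := by
    rw [← sum_neg_distrib]
    refine sum_le_sum fun u _ => ?_
    rw [← sum_neg_distrib]
    refine sum_le_sum fun v _ => ?_
    by_cases e : u = v
    · subst e
      rw [dl_self, adj_of_not G.irrefl, abs_mul_abs_self]
      apply le_of_eq; ring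
    · rw [dl_of_ne e]
      have : 0 ≤ adj G u v := by unfold adj; split_ifs <;> norm_num
      rw [← abs_mul]
      nlinarith [neg_abs_le (E j u * E j v)]
  linarith

/-- Spectra without an eigenvalue below `-1` come from disjoint unions of complete graphs. -/
theorem trans_of_neg_one_le (H : IsEigenbasis G μ E) (h : ∀ i, -1 ≤ μ i) {u v w : V}
    (huv : G.Adj u v) (hvw : G.Adj v w) (huw : u ≠ w) : G.Adj u w := by
  by_contra hn
  have e : ∑ i, (μ i + 1) * (E i u + E i w - 2 * E i v) ^ 2 = -2 := by
    have : ∑ i, (μ i + 1) * (E i u + E i w - 2 * E i v) ^ 2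
        = (adj G u u + 1 * dl u u) + (adj G w w + 1 * dl w w) + 4 * (adj G v v + 1 * dl v v)
          + 2 * (adj G u w + 1 * dl u w) - 4 * (adj G u v + 1 * dl u v)
          - 4 * (adj G v w + 1 * dl v w) := by
      simp only [← H.add_const, mul_sum, ← sum_add_distrib, ← sum_sub_distrib]
      exact sum_congr rfl fun i _ => by ring
    rw [this, adj_of huv, adj_of hvw, adj_of_not hn]
    simp only [adj_of_not G.irrefl, dl_self, dl_of_ne huw, dl_of_ne huv.ne, dl_of_ne hvw.ne]
    norm_num
  have : 0 ≤ ∑ i, (μ i + 1) * (E i u + E i w - 2 * E i v) ^ 2 :=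
    sum_nonneg fun i _ => mul_nonneg (by linarith [h i]) (sq_nonneg _)
  linarith

end IsEigenbasis

/-- A diagonal form with at most one positive entry is not positive definite on a plane. -/
theorem not_posDef_plane {ν p q : V → ℝ} {k : V} (hν : ∀ i, i ≠ k → ν i ≤ 0)
    (hp : 0 < ∑ i, ν i * (p i * p i))
    (hpq : (∑ i, ν i * (p i * q i)) ^ 2 < (∑ i, ν i * (p i * p i)) * ∑ i, ν i * (q i * q i)) :
    False := by
  have nonpos : ∀ z : V → ℝ, z k = 0 → ∑ i, ν i * (z i * z i) ≤ 0 := by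
    intro z hz
    refine sum_nonpos fun i _ => ?_
    by_cases e : i = k
    · rw [e, hz]; simp
    · exact mul_nonpos_of_nonpos_of_nonneg (hν i e) (mul_self_nonneg _)
  have h := nonpos (fun i => q k * p i - p k * q i) (by ring)
  have e : ∑ i, ν i * ((q k * p i - p k * q i) * (q k * p i - p k * q i)) =
      q k ^ 2 * (∑ i, ν i * (p i * p i)) - 2 * q k * p k * (∑ i, ν i * (p i * q i))
        + p k ^ 2 * ∑ i, ν i * (q i * q i) := by
    simp only [mul_sum, ← sum_add_distrib, ← sum_sub_distrib]
    exact sum_congr rfl fun i _ => by ring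
  rw [e] at h
  generalize ∑ i, ν i * (p i * q i) = b at *
  generalize ∑ i, ν i * (q i * q i) = c at *
  by_cases hk : p k = 0
  · exact absurd (nonpos p hk) (not_le.2 hp)
  · generalize ∑ i, ν i * (p i * p i) = a at *
    have h1 : 0 < p k ^ 2 := by positivity
    have h2 : a * (q k ^ 2 * a - 2 * q k * p k * b + p k ^ 2 * c)
      = (q k * a - p k * b) ^ 2 + p k ^ 2 * (a * c - b ^ 2) := by ring
    have h3 : 0 < p k ^ 2 * (a * c - b ^ 2) := mul_pos h1 (by linarith)
    have h4 : a * (q k ^ 2 * a - 2 * q k * p k * b + p k ^ 2 * c) ≤ 0 :=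
      mul_nonpos_of_nonneg_of_nonpos hp.le h
    nlinarith [sq_nonneg (q k * a - p k * b)]

/-- The eigenvalues are `±1` except for `μ i > 1` and `μ j < -1`. -/
structure TwoExceptional (G : SimpleGraph V) (μ : V → ℝ) (E : V → V → ℝ) (i j : V) : Prop where
  basis : IsEigenbasis G μ E
  one_lt : 1 < μ i
  lt_neg_one : μ j < -1
  others : ∀ k, k ≠ i → k ≠ j → μ k = 1 ∨ μ k = -1

theorem IsEigenbasis.exceptional_eq (H : IsEigenbasis G μ E) :
    exceptionalEigenvalues G = (univ.filter fun i => μ i ≠ 1 ∧ μ i ≠ -1).val.map μ := by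
  unfold exceptionalEigenvalues
  rw [H.spectrum, Multiset.filter_map]
  rfl

theorem IsEigenbasis.twoExceptional (H : IsEigenbasis G μ E) {r s : ℝ} (hr : 1 < r) (hs : s < -1)
    (h : exceptionalEigenvalues G = {r, s}) :
    ∃ i j, μ i = r ∧ μ j = s ∧ TwoExceptional G μ E i j := by
  rw [H.exceptional_eq] at h
  have hr' : r ∈ (univ.filter fun i => μ i ≠ 1 ∧ μ i ≠ -1).val.map μ := by rw [h]; simp
  have hs' : s ∈ (univ.filter fun i => μ i ≠ 1 ∧ μ i ≠ -1).val.map μ := by rw [h]; simp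
  rw [Multiset.mem_map] at hr' hs'
  obtain ⟨i, hi, rfl⟩ := hr'
  obtain ⟨j, hj, rfl⟩ := hs'
  have hij : i ≠ j := by rintro rfl; linarith
  refine ⟨i, j, rfl, rfl, H, hr, hs, fun k hki hkj => ?_⟩
  by_contra hcon
  rw [not_or] at hcon
  have hc : #(univ.filter fun i => μ i ≠ 1 ∧ μ i ≠ -1) = 2 := by
    have := congrArg Multiset.card h
    rwa [Multiset.card_map, Multiset.card_pair] at this
  have hsub : ({i, j, k} : Finset V) ⊆ univ.filter fun i => μ i ≠ 1 ∧ μ i ≠ -1 := by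
    intro l hl
    simp only [mem_insert, mem_singleton] at hl
    rcases hl with rfl | rfl | rfl
    · exact hi
    · exact hj
    · simpa using hcon
  have := card_le_card hsub
  rw [hc, card_eq_three.2 ⟨i, j, k, hij, hki.symm, hkj.symm, rfl⟩] at this
  omega

/-- With at most two exceptional eigenvalues, one below `-1` is accompanied by exactly one above
`1`. -/
theorem IsEigenbasis.exists_twoExceptional (H : IsEigenbasis G μ E)
    (hc : (exceptionalEigenvalues G).card ≤ 2) {j : V} (hj : μ j < -1) :
    ∃ i, TwoExceptional G μ E i j ∧ exceptionalEigenvalues G = {μ i, μ j} := by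
  obtain ⟨i, hi⟩ := H.exists_one_lt hj
  have hij : i ≠ j := by rintro rfl; linarith
  rw [H.exceptional_eq, Multiset.card_map] at hc
  have hsub : ({i, j} : Finset V) ⊆ univ.filter fun i => μ i ≠ 1 ∧ μ i ≠ -1 := by
    intro l hl
    simp only [mem_insert, mem_singleton] at hl
    rcases hl with rfl | rfl
    · simp only [mem_filter, mem_univ, true_and]; constructor <;> linarith
    · simp only [mem_filter, mem_univ, true_and]; constructor <;> linarith
  have heq := eq_of_subset_of_card_le hsub (by rw [card_pair hij]; exact hc)
  refine ⟨i, ⟨H, hi, hj, fun k hki hkj => ?_⟩, ?_⟩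
  · by_contra hcon
    rw [not_or] at hcon
    have : k ∈ ({i, j} : Finset V) := by rw [heq]; simpa using hcon
    simp only [mem_insert, mem_singleton] at this
    tauto
  · rw [H.exceptional_eq, ← heq]
    rw [Finset.insert_val_of_notMem (by simpa using hij)]
    simp

namespace TwoExceptional

variable {i j : V}

theorem ne (H : TwoExceptional G μ E i j) : i ≠ j := by
  rintro rfl; linarith [H.one_lt, H.lt_neg_one]

/-- The matrix `A² - 1` has rank two. -/
theorem gram (H : TwoExceptional G μ E i j) : ∃ x y : V → ℝ,
    ∀ u v, (cn G u v : ℝ) - (if u = v then 1 else 0) = x u * x v + y u * y v := by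
  have h1 : 0 ≤ μ i * μ i - 1 := by nlinarith [H.one_lt]
  have h2 : 0 ≤ μ j * μ j - 1 := by nlinarith [H.lt_neg_one]
  refine ⟨fun u => √(μ i * μ i - 1) * E i u, fun u => √(μ j * μ j - 1) * E j u, fun u v => ?_⟩
  have e : (cn G u v : ℝ) - (if u = v then 1 else 0) = ∑ k, (μ k * μ k - 1) * (E k u * E k v) := by
    change _ - dl u v = _
    rw [H.basis.cn_eq, ← H.basis.complete, ← sum_sub_distrib]
    exact sum_congr rfl fun i _ => by ring
  rw [e, sum_eq_add i j H.ne]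
  · have s1 := Real.mul_self_sqrt h1
    have s2 := Real.mul_self_sqrt h2
    linear_combination -(E i u * E i v) * s1 - (E j u * E j v) * s2
  · rintro k - ⟨hki, hkj⟩
    rcases H.others k hki hkj with h | h <;> rw [h] <;> ring
  · simp
  · simp

/-- A pair of adjacent vertices with two nonadjacent common neighbours consists of closed twins,
since `A + 1` has only one negative eigenvalue. -/
theorem diamond (H : TwoExceptional G μ E i j) (u v a b c : V) (huv : G.Adj u v) (hua : G.Adj u a)
    (hva : G.Adj v a) (hub : G.Adj u b) (hvb : G.Adj v b) (hab : a ≠ b) (nab : ¬ G.Adj a b)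
    (huc : G.Adj u c) (hcv : c ≠ v) : G.Adj v c := by
  by_contra hvc
  have hca : c ≠ a := by rintro rfl; exact hvc hva
  have hcb : c ≠ b := by rintro rfl; exact hvc hvb
  -- two vectors spanning a plane on which `A + 1` is negative definite
  have e : ∀ x y, ∑ k, -(μ k + 1) * (E k x * E k y) = -(adj G x y + 1 * dl x y) := by
    intro x y
    rw [← H.basis.add_const, ← sum_neg_distrib]
    exact sum_congr rfl fun i _ => by ring
  have pp : ∑ k, -(μ k + 1) * ((E k a + E k b - 2 * E k u) * (E k a + E k b - 2 * E k u)) = 2 := by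
    have : ∑ k, -(μ k + 1) * ((E k a + E k b - 2 * E k u) * (E k a + E k b - 2 * E k u))
        = -(adj G a a + 1 * dl a a) + -(adj G b b + 1 * dl b b) + 4 * -(adj G u u + 1 * dl u u)
          + 2 * -(adj G a b + 1 * dl a b) - 4 * -(adj G u a + 1 * dl u a)
          - 4 * -(adj G u b + 1 * dl u b) := by
      simp only [← e, mul_sum, ← sum_add_distrib, ← sum_sub_distrib]
      exact sum_congr rfl fun i _ => by ring
    rw [this, adj_of hua, adj_of hub, adj_of_not nab]
    simp only [adj_of_not G.irrefl, dl_self, dl_of_ne hab, dl_of_ne hua.ne, dl_of_ne hub.ne]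
    norm_num
  have qq : ∑ k, -(μ k + 1) * ((2 * E k v + E k c - 3 * E k u) * (2 * E k v + E k c - 3 * E k u))
      = 4 := by
    have : ∑ k, -(μ k + 1) * ((2 * E k v + E k c - 3 * E k u) * (2 * E k v + E k c - 3 * E k u))
        = 4 * -(adj G v v + 1 * dl v v) + -(adj G c c + 1 * dl c c)
          + 9 * -(adj G u u + 1 * dl u u)
          + 4 * -(adj G v c + 1 * dl v c) - 12 * -(adj G u v + 1 * dl u v)
          - 6 * -(adj G u c + 1 * dl u c) := by
      simp only [← e, mul_sum, ← sum_add_distrib, ← sum_sub_distrib]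
      exact sum_congr rfl fun i _ => by ring
    rw [this, adj_of huv, adj_of huc, adj_of_not hvc]
    simp only [adj_of_not G.irrefl, dl_self, dl_of_ne hcv.symm, dl_of_ne huv.ne, dl_of_ne huc.ne]
    norm_num
  have pq : ∑ k, -(μ k + 1) * ((E k a + E k b - 2 * E k u) * (2 * E k v + E k c - 3 * E k u))
      = 2 - adj G a c - adj G b c := by
    have : ∑ k, -(μ k + 1) * ((E k a + E k b - 2 * E k u) * (2 * E k v + E k c - 3 * E k u))
        = 2 * -(adj G v a + 1 * dl v a) + -(adj G a c + 1 * dl a c)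
          - 3 * -(adj G u a + 1 * dl u a) + 2 * -(adj G v b + 1 * dl v b)
          + -(adj G b c + 1 * dl b c) - 3 * -(adj G u b + 1 * dl u b)
          - 4 * -(adj G u v + 1 * dl u v) - 2 * -(adj G u c + 1 * dl u c)
          + 6 * -(adj G u u + 1 * dl u u) := by
      simp only [← e, mul_sum, ← sum_add_distrib, ← sum_sub_distrib]
      exact sum_congr rfl fun i _ => by ring
    rw [this, adj_of huv, adj_of huc, adj_of hva, adj_of hvb, adj_of hua, adj_of hub]
    simp only [adj_of_not G.irrefl, dl_self, dl_of_ne hca.symm, dl_of_ne hcb.symm,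
      dl_of_ne huv.ne, dl_of_ne huc.ne, dl_of_ne hva.ne, dl_of_ne hvb.ne, dl_of_ne hua.ne,
      dl_of_ne hub.ne]
    ring
  refine not_posDef_plane (ν := fun k => -(μ k + 1)) (p := fun k => E k a + E k b - 2 * E k u)
    (q := fun k => 2 * E k v + E k c - 3 * E k u) (k := j) (fun k hk => ?_) (by rw [pp]; norm_num) ?_
  · by_cases hki : k = i
    · rw [hki]; linarith [H.one_lt]
    · rcases H.others k hki hk with h | h <;> rw [h] <;> norm_num
  · rw [pp, qq, pq]
    unfold adj
    split_ifs <;> norm_num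

theorem not_complete (H : TwoExceptional G μ E i j) : ∃ u v, u ≠ v ∧ ¬ G.Adj u v := by
  by_contra hcon
  push Not at hcon
  have h := H.basis.form_eigen 1 j
  have e : ∀ u v, adj G u v + 1 * dl u v = 1 := by
    intro u v
    by_cases huv : u = v
    · subst huv; rw [adj_of_not G.irrefl, dl_self]; norm_num
    · rw [adj_of (hcon u v huv), dl_of_ne huv]; norm_num
  simp only [e] at h
  simp only [one_mul] at h
  rw [← Fintype.sum_mul_sum] at h
  have := H.lt_neg_one
  have := mul_self_nonneg (∑ u, E j u)
  linarith

theorem one_le_degree (H : TwoExceptional G μ E i j) (v : V) : 1 ≤ cn G v v := by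
  obtain ⟨x, y, hxy⟩ := H.gram
  have := hxy v v
  rw [if_pos rfl] at this
  have : (1 : ℝ) ≤ cn G v v := by nlinarith [mul_self_nonneg (x v), mul_self_nonneg (y v)]
  exact_mod_cast this

/-- The only neighbour of a vertex of degree one has degree one. -/
theorem eq_of_degree_one (H : TwoExceptional G μ E i j) {u v w : V} (hv : cn G v v = 1)
    (huv : G.Adj v u) (huw : G.Adj u w) : w = v := by
  by_contra hne
  obtain ⟨x, y, hxy⟩ := H.gram
  have h1 := hxy v v
  rw [if_pos rfl, hv] at h1
  have hx : x v = 0 := by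
    push_cast at h1
    nlinarith [mul_self_nonneg (x v), mul_self_nonneg (y v)]
  have hy : y v = 0 := by
    push_cast at h1
    nlinarith [mul_self_nonneg (x v), mul_self_nonneg (y v)]
  have h2 := hxy v w
  rw [if_neg (Ne.symm hne), hx, hy] at h2
  have h3 : 1 ≤ cn G v w := one_le_num (w := u) ⟨huv, huw.symm⟩
  have h4 : (1 : ℝ) ≤ cn G v w := by exact_mod_cast h3
  linarith

theorem admissible (H : TwoExceptional G μ E i j) (hc : G.Connected) : Admissible G := by
  refine ⟨hc, H.gram, H.diamond, fun v => ?_⟩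
  by_contra hlt
  have hv : cn G v v = 1 := by have := H.one_le_degree v; omega
  obtain ⟨u, hu⟩ := exists_of_num_pos (show 0 < cn G v v by rw [hv]; norm_num)
  have uniq : ∀ w, G.Adj v w → w = u := fun w hw => eq_of_num_eq_one hv ⟨hw, hw⟩ hu
  have cov : ∀ w, w = v ∨ w = u := mem_of_connected hc (P := fun w => w = v ∨ w = u) (Or.inl rfl)
    fun a b ha hab => by
      rcases ha with rfl | rfl
      · exact Or.inr (uniq b hab)
      · exact Or.inl (H.eq_of_degree_one hv hu.1 hab)
  obtain ⟨a, b, hab, hadj⟩ := H.not_complete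
  apply hadj
  rcases cov a with rfl | rfl <;> rcases cov b with rfl | rfl
  · exact absurd rfl hab
  · exact hu.1
  · exact hu.1.symm
  · exact absurd rfl hab

/-- With all degrees at least two, each component carries an eigenvalue above one, so there is only
one component. -/
theorem connected (H : TwoExceptional G μ E i j) (hd : ∀ v, 2 ≤ cn G v v) : G.Connected := by
  have : Nonempty V := ⟨i⟩
  refine ⟨fun u v => ?_⟩
  by_contra huv
  let s : V → V → ℝ := fun u w => if G.Reachable u w then 1 else 0
  have e : ∀ a b, ∑ k, (μ k + (-1)) * ((∑ w, E k w * s a w) * ∑ w, E k w * s b w)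
      = ∑ w, s a w * s b w * ((cn G w w : ℝ) - 1) := by
    intro a b
    rw [IsEigenbasis.form_eq (E := E)]
    simp only [H.basis.add_const]
    refine sum_congr rfl fun w _ => ?_
    have h1 : ∀ x, (adj G w x + (-1) * dl w x) * (s a w * s b x)
        = s a w * s b w * (adj G w x * adj G x w) - s a w * s b x * dl x w := by
      intro x
      have hd : dl w x = dl x w := by unfold dl; simp only [eq_comm]
      by_cases hwx : G.Adj w x
      · have hs : s b x = s b w := by
          have : G.Reachable b x ↔ G.Reachable b w :=
            ⟨fun h => h.trans hwx.symm.reachable, fun h => h.trans hwx.reachable⟩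
          simp only [s, this]
        rw [adj_of hwx, adj_of hwx.symm, hs, hd]; ring
      · rw [adj_of_not hwx, hd]; ring
    simp only [h1]
    rw [sum_sub_distrib, ← mul_sum, ← cn_eq_sum, sum_dl w (fun x => s a w * s b x)]
    ring
  have s01 : ∀ a w, 0 ≤ s a w * s a w := fun a w => mul_self_nonneg _
  have pos : ∀ a, 0 < ∑ w, s a w * s a w * ((cn G w w : ℝ) - 1) := by
    intro a
    have h2 : ∀ w, (1 : ℝ) ≤ (cn G w w : ℝ) - 1 := fun w => by
      have : (2 : ℝ) ≤ cn G w w := by exact_mod_cast hd w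
      linarith
    have h3 : s a a * s a a * ((cn G a a : ℝ) - 1)
        ≤ ∑ w, s a w * s a w * ((cn G w w : ℝ) - 1) :=
      single_le_sum (f := fun w => s a w * s a w * ((cn G w w : ℝ) - 1))
        (fun w _ => mul_nonneg (s01 a w) (by linarith [h2 w])) (mem_univ a)
    have h4 : s a a = 1 := if_pos (SimpleGraph.Reachable.refl a)
    rw [h4] at h3
    linarith [h2 a]
  have zero : ∑ w, s u w * s v w * ((cn G w w : ℝ) - 1) = 0 := by
    refine sum_eq_zero fun w _ => ?_
    by_cases h1 : G.Reachable u w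
    · have : s v w = 0 := if_neg fun h2 => huv (h1.trans h2.symm)
      rw [this]; ring
    · have : s u w = 0 := if_neg h1
      rw [this]; ring
  refine not_posDef_plane (ν := fun k => μ k + (-1)) (p := fun k => ∑ w, E k w * s u w)
    (q := fun k => ∑ w, E k w * s v w) (k := i) (fun k hk => ?_) ?_ ?_
  · by_cases hkj : k = j
    · rw [hkj]; linarith [H.lt_neg_one]
    · rcases H.others k hk hkj with h | h <;> rw [h] <;> norm_num
  · rw [e]; exact pos u
  · rw [e, e, e, zero]
    have := mul_pos (pos u) (pos v)
    simpa using this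

end TwoExceptional

theorem InClassG.admissible (h : InClassG G) : Admissible G ∧ ∃ u v, u ≠ v ∧ ¬ G.Adj u v := by
  obtain ⟨hc, r, s, hr, hs, he⟩ := h
  obtain ⟨μ, E, H⟩ := exists_isEigenbasis G
  obtain ⟨i, j, -, -, T⟩ := H.twoExceptional hr hs he
  exact ⟨T.admissible hc, T.not_complete⟩

end Spectral

/-! ### Disjoint unions of complete graphs and of edges -/

section Reduction
open scoped Classical
open Finset

variable {V V' : Type*} [Fintype V] [Fintype V']
set_option linter.unusedSectionVars false
variable {G : SimpleGraph V} {G' : SimpleGraph V'} {μ : V → ℝ} {E : V → V → ℝ}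

theorem num_eq_card (p : V → Prop) [DecidablePred p] : num p = (#{v | p v} : ℤ) := by
  unfold num
  congr

/-- Two maps with fibres of the same sizes differ by a bijection of their domains. -/
theorem exists_equiv_over {X Y K : Type*} [Fintype X] [Fintype Y] {f : X → K} {g : Y → K}
    (h : ∀ k, num (fun x => f x = k) = num fun y => g y = k) : ∃ e : X ≃ Y, ∀ x, g (e x) = f x := by
  have h' : ∀ k, Nonempty ({x // f x = k} ≃ {y // g y = k}) := fun k =>
    ⟨Fintype.equivOfCardEq (by
      have := h k
      rw [num_eq_card, num_eq_card] at this
      rw [Fintype.card_subtype, Fintype.card_subtype]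
      exact_mod_cast this)⟩
  let e := fun k => (h' k).some
  refine ⟨(Equiv.sigmaFiberEquiv f).symm.trans ((Equiv.sigmaCongrRight e).trans
    (Equiv.sigmaFiberEquiv g)), fun x => ?_⟩
  exact (e (f x) ⟨x, rfl⟩).2

/-- The size of the closed neighbourhood of `v`. -/
noncomputable def closedDegree (G : SimpleGraph V) (v : V) : ℕ := #{w | v = w ∨ G.Adj v w}

/-- A graph without induced path on three vertices: a disjoint union of complete graphs. -/
def IsCluster (G : SimpleGraph V) : Prop :=
  ∀ u v w, G.Adj u v → G.Adj v w → u ≠ w → G.Adj u w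

/-- The partition of such a graph into its complete components. -/
def IsCluster.setoid (h : IsCluster G) : Setoid V where
  r u v := u = v ∨ G.Adj u v
  iseqv := ⟨fun u => Or.inl rfl, fun h => h.imp Eq.symm fun h => h.symm, fun {u v w} h1 h2 => by
    rcases h1 with rfl | h1
    · exact h2
    · rcases h2 with rfl | h2
      · exact Or.inr h1
      · by_cases e : u = w
        · exact Or.inl e
        · exact Or.inr (h u v w h1 h2 e)⟩

theorem IsCluster.card_fibre (h : IsCluster G) (v : V) :
    #{w | (Quotient.mk h.setoid w) = Quotient.mk h.setoid v} = closedDegree G v := by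
  unfold closedDegree
  congr 1
  ext w
  simp only [mem_filter, mem_univ, true_and]
  exact ⟨fun e => h.setoid.symm (Quotient.exact e), fun e => Quotient.sound (h.setoid.symm e)⟩

/-- The size of a component. -/
noncomputable def IsCluster.size (h : IsCluster G) (c : Quotient h.setoid) : ℕ :=
  #{w | Quotient.mk h.setoid w = c}

theorem IsCluster.card_mul (h : IsCluster G) (k : ℕ) :
    num (fun v => closedDegree G v = k) = num (fun c => h.size c = k) * k := by
  rw [num_eq_card, num_eq_card]
  norm_cast
  rw [card_eq_sum_card_fiberwise (f := Quotient.mk h.setoid) (t := {c | h.size c = k})]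
  · rw [sum_const_nat]
    intro c hc
    simp only [mem_filter, mem_univ, true_and] at hc
    conv_rhs => rw [← hc]
    unfold IsCluster.size
    congr 1
    ext v
    simp only [mem_filter, mem_univ, true_and]
    refine ⟨fun e => e.2, fun e => ⟨?_, e⟩⟩
    rw [← hc, ← h.card_fibre, e]
    rfl
  · intro v hv
    simp only [coe_filter, mem_univ, true_and, Set.mem_ofPred_eq] at hv ⊢
    rw [← hv]
    exact h.card_fibre v

theorem IsCluster.size_pos (h : IsCluster G) (c : Quotient h.setoid) : 0 < h.size c := by
  induction c using Quotient.inductionOn with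
  | h v => exact card_pos.2 ⟨v, by simp⟩

/-- Disjoint unions of complete graphs are isomorphic if their degrees agree. -/
theorem IsCluster.nonempty_iso (h : IsCluster G) (h' : IsCluster G')
    (hc : ∀ k, num (fun v => closedDegree G v = k) = num fun v => closedDegree G' v = k) :
    Nonempty (G ≃g G') := by
  obtain ⟨q, hq⟩ := exists_equiv_over (f := h.size) (g := h'.size) fun k => by
    rcases Nat.eq_zero_or_pos k with rfl | hk
    · rw [num_eq_zero fun c => (h.size_pos c).ne', num_eq_zero fun c => (h'.size_pos c).ne']
    · have := hc k
      rw [h.card_mul, h'.card_mul] at this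
      exact mul_right_cancel₀ (by exact_mod_cast hk.ne') this
  obtain ⟨e, he⟩ := exists_equiv_over (f := fun v => q (Quotient.mk h.setoid v))
    (g := Quotient.mk h'.setoid) fun c => by
      obtain ⟨c, rfl⟩ := q.surjective c
      have e1 : num (fun y => Quotient.mk h'.setoid y = q c) = h'.size (q c) := num_eq_card _
      have e2 : num (fun v => Quotient.mk h.setoid v = c) = h.size c := num_eq_card _
      simp only [q.apply_eq_iff_eq]
      rw [e1, e2, hq]
  refine ⟨⟨e, fun {u v} => ?_⟩⟩
  have key : (e u = e v ∨ G'.Adj (e u) (e v)) ↔ (u = v ∨ G.Adj u v) := by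
    have h1 : (e u = e v ∨ G'.Adj (e u) (e v)) ↔
        Quotient.mk h'.setoid (e u) = Quotient.mk h'.setoid (e v) :=
      ⟨fun h => Quotient.sound h, fun h => Quotient.exact h⟩
    have h2 : (u = v ∨ G.Adj u v) ↔ Quotient.mk h.setoid u = Quotient.mk h.setoid v :=
      ⟨fun h => Quotient.sound h, fun h => Quotient.exact h⟩
    rw [h1, h2, he, he, q.apply_eq_iff_eq]
  by_cases huv : u = v
  · subst huv
    exact iff_of_false G'.irrefl G.irrefl
  · rw [e.apply_eq_iff_eq] at key
    tauto

theorem IsEigenbasis.isCluster (H : IsEigenbasis G μ E) (h : ∀ i, -1 ≤ μ i) : IsCluster G :=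
  fun _ _ _ huv hvw huw => H.trans_of_neg_one_le h huv hvw huw

theorem IsEigenbasis.trace (H : IsEigenbasis G μ E) (f : V → ℝ) :
    ∑ i, f i = ∑ u, ∑ i, f i * (E i u * E i u) := by
  rw [sum_comm]
  refine sum_congr rfl fun i _ => ?_
  rw [← mul_sum, H.orthonormal, dl_self, mul_one]

/-- For a disjoint union of complete graphs, `A + 1` is a block diagonal matrix with all-one blocks,
so the diagonal entries of its powers are powers of the block sizes. -/
theorem IsCluster.power_sum (h : IsCluster G) (H : IsEigenbasis G μ E) (k : ℕ) :
    ∑ i, (μ i + 1) ^ (k + 1) = ∑ u, (closedDegree G u : ℝ) ^ k := by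
  have hb : ∀ u v, adj G u v + 1 * dl u v = if u = v ∨ G.Adj u v then 1 else 0 := by
    intro u v
    by_cases huv : u = v
    · subst huv; rw [adj_of_not G.irrefl, dl_self]; simp
    · rw [dl_of_ne huv]; unfold adj; simp [huv]
  have step : ∀ k u v, ∑ i, (μ i + 1) ^ (k + 1) * (E i u * E i v) =
      (closedDegree G u : ℝ) ^ k * if u = v ∨ G.Adj u v then 1 else 0 := by
    intro k
    induction k with
    | zero =>
      intro u v
      simp only [zero_add, pow_one, pow_zero, one_mul]
      rw [H.add_const, hb]
    | succ k ih =>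
      intro u v
      simp only [pow_succ _ (k + 1)]
      rw [H.mul_eq]
      simp only [ih, H.add_const, hb]
      have : ∀ w, ((closedDegree G u : ℝ) ^ k * if u = w ∨ G.Adj u w then 1 else 0) *
          (if w = v ∨ G.Adj w v then 1 else 0) = (closedDegree G u : ℝ) ^ k *
            ((if u = v ∨ G.Adj u v then 1 else 0) * if u = w ∨ G.Adj u w then 1 else 0) := by
        intro w
        by_cases h1 : u = w ∨ G.Adj u w
        · have h2 : (w = v ∨ G.Adj w v) ↔ (u = v ∨ G.Adj u v) :=
            ⟨fun h2 => h.setoid.trans h1 h2, fun h2 => h.setoid.trans (h.setoid.symm h1) h2⟩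
          simp only [h2, if_pos h1]; ring
        · simp only [if_neg h1]; ring
      simp only [this]
      rw [← mul_sum, ← mul_sum, sum_boole, pow_succ]
      unfold closedDegree
      ring
  rw [H.trace]
  refine sum_congr rfl fun u _ => ?_
  rw [step]
  simp

/-- Power sums determine how often each value is taken. -/
theorem card_eq_of_power_sums {f : V → ℕ} {g : V' → ℕ}
    (h : ∀ k : ℕ, ∑ u, (f u : ℝ) ^ k = ∑ u, (g u : ℝ) ^ k) (k : ℕ) :
    num (fun u => f u = k) = num fun u => g u = k := by
  have poly : ∀ p : Polynomial ℝ, ∑ u, p.eval (f u : ℝ) = ∑ u, p.eval (g u : ℝ) := by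
    intro p
    simp only [Polynomial.eval_eq_sum_range]
    rw [sum_comm, sum_comm (s := univ (α := V'))]
    refine sum_congr rfl fun n _ => ?_
    rw [← mul_sum, ← mul_sum, h]
  -- an interpolation polynomial that singles out the value `k`
  let s : Finset ℕ := insert k (univ.image f ∪ univ.image g)
  have hinj : Set.InjOn (fun n : ℕ => (n : ℝ)) s := fun a _ b _ e => Nat.cast_injective e
  have hk : k ∈ s := mem_insert_self _ _
  have ev : ∀ n ∈ s, (Lagrange.basis s (fun n : ℕ => (n : ℝ)) k).eval (n : ℝ)
      = if n = k then 1 else 0 := by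
    intro n hn
    by_cases e : n = k
    · rw [e, if_pos rfl]
      exact Lagrange.eval_basis_self hinj hk
    · rw [if_neg e]
      exact Lagrange.eval_basis_of_ne (v := fun n : ℕ => (n : ℝ)) (Ne.symm e) hn
  have := poly (Lagrange.basis s (fun n : ℕ => (n : ℝ)) k)
  rw [sum_congr rfl fun u _ => ev (f u) (by simp [s]),
    sum_congr rfl fun u _ => ev (g u) (by simp [s]), sum_boole, sum_boole] at this
  rw [num_eq_card, num_eq_card]
  exact_mod_cast this

/-- Cospectral graphs whose eigenvalues are at least `-1` are isomorphic. -/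
theorem nonempty_iso_of_neg_one_le (hc : Cospectral G G') (h : ∀ x ∈ adjSpectrum G, -1 ≤ x) :
    Nonempty (G ≃g G') := by
  obtain ⟨μ, E, H⟩ := exists_isEigenbasis G
  obtain ⟨μ', E', H'⟩ := exists_isEigenbasis G'
  have hc' : univ.val.map μ = univ.val.map μ' := by rw [← H.spectrum, ← H'.spectrum]; exact hc
  have C : IsCluster G := H.isCluster fun i => h _ (by
    rw [H.spectrum]; exact Multiset.mem_map_of_mem _ (mem_univ i))
  have C' : IsCluster G' := H'.isCluster fun i => h _ (by
    rw [H.spectrum, hc']; exact Multiset.mem_map_of_mem _ (mem_univ i))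
  refine C.nonempty_iso C' (card_eq_of_power_sums fun k => ?_)
  rw [← C.power_sum H, ← C'.power_sum H']
  have := congrArg (fun s : Multiset ℝ => (s.map fun x => (x + 1) ^ (k + 1)).sum) hc'
  simp only [Multiset.map_map] at this
  exact this

theorem adjSpectrum_congr (e : G ≃g G') : adjSpectrum G = adjSpectrum G' := by
  unfold adjSpectrum
  have : G'.adjMatrix ℝ = Matrix.reindex e.toEquiv e.toEquiv (G.adjMatrix ℝ) := by
    ext u v
    simp only [Matrix.reindex_apply, Matrix.submatrix_apply, SimpleGraph.adjMatrix_apply]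
    have : G.Adj (e.toEquiv.symm u) (e.toEquiv.symm v) ↔ G'.Adj u v := e.symm.map_adj_iff
    simp only [this]
  rw [this, Matrix.charpoly_reindex]

theorem adjSpectrum_sum (G : SimpleGraph V) (G' : SimpleGraph V') :
    adjSpectrum (SimpleGraph.sum G G') = adjSpectrum G + adjSpectrum G' := by
  unfold adjSpectrum
  have : (SimpleGraph.sum G G').adjMatrix ℝ =
      Matrix.fromBlocks (G.adjMatrix ℝ) 0 0 (G'.adjMatrix ℝ) := by
    ext (u | u) (v | v) <;> simp [SimpleGraph.adjMatrix_apply]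
  rw [this]
  have h := Matrix.charpoly_fromBlocks_zero₁₂ (M₁₁ := G.adjMatrix ℝ) (M₂₁ := 0)
    (M₂₂ := G'.adjMatrix ℝ)
  have h' : (Matrix.fromBlocks (G.adjMatrix ℝ) 0 0 (G'.adjMatrix ℝ)).charpoly.roots =
      (G.adjMatrix ℝ).charpoly.roots + (G'.adjMatrix ℝ).charpoly.roots := by
    rw [h, Polynomial.roots_mul]
    exact mul_ne_zero (Matrix.charpoly_monic _).ne_zero (Matrix.charpoly_monic _).ne_zero
  convert h'

/-- The case `A² = 1`. -/
theorem exceptional_eq_zero (h : ∀ u v, cn G u v = if u = v then 1 else 0) :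
    exceptionalEigenvalues G = 0 := by
  obtain ⟨μ, E, H⟩ := exists_isEigenbasis G
  rw [H.exceptional_eq, filter_false_of_mem]
  · rfl
  rintro i - ⟨h1, h2⟩
  have e : ∀ u, μ i * μ i * E i u = E i u := by
    intro u
    calc μ i * μ i * E i u = ∑ w, adj G u w * (μ i * E i w) := by
          rw [mul_assoc, ← H.eigen, mul_sum]
          exact sum_congr rfl fun w _ => by ring
      _ = ∑ v, (∑ w, adj G u w * adj G w v) * E i v := by
          simp only [← H.eigen, mul_sum, sum_mul]
          rw [sum_comm]
          exact sum_congr rfl fun v _ => sum_congr rfl fun w _ => by ring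
      _ = E i u := by
          simp only [← cn_eq_sum, h]
          simp
  have h3 : (μ i * μ i - 1) * ∑ u, E i u * E i u = 0 := by
    rw [mul_sum]
    exact sum_eq_zero fun u _ => by linear_combination E i u * e u
  rw [H.orthonormal, dl_self, mul_one] at h3
  rcases mul_eq_zero.1 (show (μ i - 1) * (μ i + 1) = 0 by linarith) with h4 | h4
  · exact h1 (by linarith)
  · exact h2 (by linarith)

theorem exceptional_copiesK2 (α : ℕ) : exceptionalEigenvalues (copiesK2 α) = 0 := by
  refine exceptional_eq_zero fun u v => ?_
  have key : ∀ a b c : Fin 2, a ≠ c → b ≠ c → a = b := by decide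
  have rev : ∀ a : Fin 2, a ≠ a.rev := by decide
  split_ifs with h
  · subst h
    refine num_eq_one (w := (u.1, u.2.rev)) ⟨⟨rfl, ?_⟩, ⟨rfl, ?_⟩⟩ ?_
    · exact rev _
    · exact rev _
    · rintro ⟨x, y⟩ ⟨⟨h1, h2⟩, -⟩
      exact Prod.ext h1.symm (key _ _ u.2 (Ne.symm h2) (rev _).symm)
  · refine num_eq_zero fun w hw => h (Prod.ext (hw.1.1.trans hw.2.1.symm) (key _ _ w.2 hw.1.2 hw.2.2))

theorem num_equiv {X : Type*} [Fintype X] {p : V → Prop} (e : X ≃ {v // p v}) (q : V → Prop) :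
    num (fun x => q (e x)) = num (fun v => p v ∧ q v) := by
  unfold num
  norm_cast
  refine card_bij (fun x _ => (e x : V)) (fun x hx => ?_) (fun x _ y _ h => ?_) fun v hv => ?_
  · simp only [mem_filter, mem_univ, true_and] at hx ⊢
    exact ⟨(e x).2, hx⟩
  · exact e.injective (Subtype.ext h)
  · simp only [mem_filter, mem_univ, true_and] at hv
    exact ⟨e.symm ⟨v, hv.1⟩, by simpa using hv.2, by simp⟩

/-- Splitting off the components `K₂`: they consist of the vertices of degree one, and the remaining
vertices form a single component. -/
theorem exists_reduction {r s : ℝ} (hr : 1 < r) (hs : s < -1)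
    (he : exceptionalEigenvalues G = {r, s}) :
    ∃ (n α : ℕ) (H : SimpleGraph (Fin n)), Nonempty (G ≃g SimpleGraph.sum H (copiesK2 α)) ∧
      H.Connected ∧ exceptionalEigenvalues H = {r, s} := by
  obtain ⟨μ, E, B⟩ := exists_isEigenbasis G
  obtain ⟨i, j, -, -, T⟩ := B.twoExceptional hr hs he
  let D : V → Prop := fun v => 2 ≤ cn G v v
  have one : ∀ {v}, ¬ D v → cn G v v = 1 := fun {v} h => by
    have := T.one_le_degree v
    have : ¬ 2 ≤ cn G v v := h
    omega
  have closed : ∀ {u v}, ¬ D u → G.Adj u v → ¬ D v := by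
    intro u v hu huv hv
    have : cn G v v ≤ 1 := by
      rw [← num_single u]
      exact num_mono fun w hw => T.eq_of_degree_one (one hu) huv hw.1
    have : 2 ≤ cn G v v := hv
    omega
  obtain ⟨n, hn⟩ := exists_num D
  obtain ⟨e1⟩ := exists_equiv_fin hn
  obtain ⟨σ, h2, h1, hσ⟩ := exists_involution (r := fun u v : {v // ¬ D v} => G.Adj u v)
    (fun v w h => h.symm) (fun v => G.irrefl) fun v => by
      obtain ⟨w, hw⟩ := exists_of_num_pos (show 0 < cn G v v by rw [one v.2]; norm_num)
      exact ⟨⟨w, closed v.2 hw.1⟩, hw.1, fun u hu =>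
        Subtype.ext (eq_of_num_eq_one (one v.2) ⟨hu, hu⟩ hw)⟩
  have hcard := card_of_involution (σ := σ) (by ext w; simp [pow_two, h2]) h1
  let τ : Equiv.Perm (Fin σ.cycleType.card × Fin 2) := Equiv.prodCongr (Equiv.refl _) Fin.revPerm
  have hτ : ∀ x y, (copiesK2 σ.cycleType.card).Adj x y ↔ y = τ x := by
    rintro ⟨x, a⟩ ⟨y, b⟩
    change (x = y ∧ a ≠ b) ↔ (y, b) = (x, a.rev)
    have : ∀ a b : Fin 2, a ≠ b ↔ b = a.rev := by decide
    rw [this, Prod.mk.injEq, eq_comm (a := x)]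
  obtain ⟨e2, he2⟩ := exists_conj_of_involution (σ := τ) (τ := σ)
    (by rw [hcard, Fintype.card_prod, Fintype.card_fin, Fintype.card_fin, mul_comm])
    (fun ⟨x, a⟩ => by simp [τ]) (fun ⟨x, a⟩ h => by
      have h' := congrArg Prod.snd h
      have : ∀ a : Fin 2, a.rev ≠ a := by decide
      exact this a h') h2 h1
  let H : SimpleGraph (Fin n) := G.comap fun i => (e1 i : V)
  have hiso : Nonempty (G ≃g SimpleGraph.sum H (copiesK2 σ.cycleType.card)) := by
    let f := Equiv.ofBijective _ (bijective_sum e1 e2 (fun v => em _) fun v h h' => h' h)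
    refine ⟨SimpleGraph.Iso.symm ⟨f, fun {x y} => ?_⟩⟩
    rcases x with x | x <;> rcases y with y | y
    · exact Iff.rfl
    · refine iff_of_false (fun h => ?_) (by simp)
      exact closed (e2 y).2 h.symm (e1 x).2
    · refine iff_of_false (fun h => ?_) (by simp)
      exact closed (e2 x).2 h (e1 y).2
    · rw [SimpleGraph.sum_adj_inr, hτ]
      change G.Adj (e2 x) (e2 y) ↔ _
      rw [hσ, ← he2, e2.apply_eq_iff_eq]
  have hH : exceptionalEigenvalues H = {r, s} := by
    obtain ⟨φ⟩ := hiso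
    rw [← he]
    have h0 := exceptional_copiesK2 σ.cycleType.card
    unfold exceptionalEigenvalues at h0 ⊢
    rw [adjSpectrum_congr φ, adjSpectrum_sum, Multiset.filter_add, h0, add_zero]
  refine ⟨n, _, H, hiso, ?_, hH⟩
  obtain ⟨μ', E', B'⟩ := exists_isEigenbasis H
  obtain ⟨i', j', -, -, T'⟩ := B'.twoExceptional hr hs hH
  refine T'.connected fun x => ?_
  have h3 : cn H x x = cn G (e1 x) (e1 x) := by
    have := num_equiv e1 (fun w => G.Adj (e1 x) w ∧ G.Adj (e1 x) w)
    refine Eq.trans (num_congr fun w => Iff.rfl) (this.trans (num_congr fun w => ?_))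
    refine ⟨fun h => h.2, fun h => ⟨?_, h⟩⟩
    by_contra hw
    exact closed hw h.1.symm (e1 x).2
  rw [h3]
  exact (e1 x).2

end Reduction

/-! ### Eigenvalues of the families and coincidences -/

section Cospectrality
open scoped Classical
open Finset Matrix

variable {V V' : Type*} [Fintype V] [Fintype V']
set_option linter.unusedSectionVars false
variable {G : SimpleGraph V} {G' : SimpleGraph V'}

theorem HasAdjMatrix.nonempty_iso {ι : Type*} {M : Matrix ι ι ℝ} (h : HasAdjMatrix G M)
    (h' : HasAdjMatrix G' M) : Nonempty (G ≃g G') := by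
  obtain ⟨e, he⟩ := h
  obtain ⟨f, hf⟩ := h'
  refine ⟨⟨e.trans f.symm, fun {u v} => ?_⟩⟩
  have h1 := congrFun (congrFun he u) v
  have h2 := congrFun (congrFun hf (f.symm (e u))) (f.symm (e v))
  simp only [SimpleGraph.adjMatrix_apply, Matrix.submatrix_apply, Equiv.apply_symm_apply] at h1 h2
  rw [← h1] at h2
  simp only [Equiv.trans_apply]
  by_cases a : G.Adj u v <;> by_cases b : G'.Adj (f.symm (e u)) (f.symm (e v)) <;>
    simp [a, b] at h2 ⊢

/-- An eigenvalue of the matrix is an eigenvalue of the graph. -/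
theorem HasAdjMatrix.mem_adjSpectrum {ι : Type*} [Fintype ι] {M : Matrix ι ι ℝ}
    (h : HasAdjMatrix G M) {x : ι → ℝ} {t : ℝ} (hx : x ≠ 0) (hM : M *ᵥ x = t • x) :
    t ∈ adjSpectrum G := by
  obtain ⟨e, he⟩ := h
  unfold adjSpectrum
  rw [Polynomial.mem_roots (Matrix.charpoly_monic _).ne_zero, Polynomial.IsRoot,
    Matrix.eval_charpoly, ← Matrix.exists_mulVec_eq_zero_iff]
  refine ⟨x ∘ e, fun h0 => hx ?_, ?_⟩
  · funext i
    have := congrFun h0 (e.symm i)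
    simpa using this
  · have h1 : G.adjMatrix ℝ *ᵥ (x ∘ e) = t • (x ∘ e) := by
      rw [he, Matrix.submatrix_mulVec_equiv, Function.comp_assoc, Equiv.self_comp_symm,
        Function.comp_id, hM]
      rfl
    rw [Matrix.sub_mulVec, h1, Matrix.scalar_apply, ← Matrix.smul_one_eq_diagonal,
      Matrix.smul_mulVec, Matrix.one_mulVec, sub_self]

/-- If both roots of a quadratic polynomial are eigenvalues and differ from `1` and `-1`, they are
the two exceptional ones. -/
theorem add_mul_of_roots {r s σ π : ℝ} (he : exceptionalEigenvalues G = {r, s}) (h0 : π < 0)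
    (h1 : 1 - σ + π ≠ 0) (h2 : 1 + σ + π ≠ 0)
    (h : ∀ t : ℝ, t * t = σ * t - π → t ∈ adjSpectrum G) : r + s = σ ∧ r * s = π := by
  have hd : 0 < σ ^ 2 - 4 * π := by nlinarith [sq_nonneg σ]
  set d := √(σ ^ 2 - 4 * π) with hdd
  have hd0 : 0 < d := Real.sqrt_pos.2 hd
  have hd2 : d * d = σ ^ 2 - 4 * π := Real.mul_self_sqrt hd.le
  have key : ∀ t : ℝ, t * t = σ * t - π → t = r ∨ t = s := by
    intro t ht
    have hm : t ∈ exceptionalEigenvalues G := by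
      refine Multiset.mem_filter.2 ⟨h t ht, ?_, ?_⟩
      · rintro rfl; exact h1 (by linarith)
      · rintro rfl; exact h2 (by linarith)
    rw [he] at hm
    simpa using hm
  have ha := key ((σ + d) / 2) (by linear_combination hd2 / 4)
  have hb := key ((σ - d) / 2) (by linear_combination hd2 / 4)
  rcases ha with ha | ha <;> rcases hb with hb | hb
  · linarith
  · subst ha hb
    exact ⟨by ring, by linear_combination -hd2 / 4⟩
  · subst ha hb
    exact ⟨by ring, by linear_combination -hd2 / 4⟩
  · linarith

theorem J_mulVec (p q : ℕ) (c : ℝ) : J p q *ᵥ (fun _ => c) = fun _ => q * c := by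
  funext i
  simp [Matrix.mulVec, dotProduct, J]

theorem JI_mulVec (n : ℕ) (c : ℝ) : JI n *ᵥ (fun _ => c) = fun _ => (n - 1) * c := by
  unfold JI
  rw [Matrix.sub_mulVec, J_mulVec, Matrix.one_mulVec]
  funext i
  simp only [Pi.sub_apply]
  ring

theorem R_mulVec (n : ℕ) (c : ℝ) : R n *ᵥ (fun _ => c) = fun _ => c := by
  funext i
  simp [Matrix.mulVec, dotProduct, R]

theorem J_transpose (p q : ℕ) : (J p q)ᵀ = J q p := rfl

theorem JI_transpose (n : ℕ) : (JI n)ᵀ = JI n := by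
  unfold JI
  rw [Matrix.transpose_sub, J_transpose, Matrix.transpose_one]

variable {r s : ℝ} {H : SimpleGraph V}

theorem IsTypeI.add_mul {m : ℕ} (h : IsTypeI m H) (he : exceptionalEigenvalues H = {r, s}) :
    r + s = 0 ∧ r * s = -((m - 1) * (m - 1)) := by
  obtain ⟨hm, hM⟩ := h
  have hm' : (3 : ℝ) ≤ m := by exact_mod_cast hm
  refine add_mul_of_roots he (by nlinarith) (by nlinarith) (by nlinarith) fun t ht => ?_
  refine hM.mem_adjSpectrum (x := Sum.elim (fun _ => (m : ℝ) - 1) fun _ => t) (fun h => ?_) ?_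
  · have := congrFun h (Sum.inl ⟨0, by omega⟩)
    simp only [Sum.elim_inl, Pi.zero_apply] at this
    linarith
  · simp only [Matrix.fromBlocks_mulVec, Sum.elim_comp_inl, Sum.elim_comp_inr, JI_mulVec,
      Matrix.zero_mulVec, zero_add, add_zero]
    funext x
    rcases x with x | x <;> simp only [Sum.elim_inl, Sum.elim_inr, Pi.smul_apply, smul_eq_mul] <;>
      linarith

theorem IsTypeII.add_mul {a k : ℕ} (h : IsTypeII a k H) (he : exceptionalEigenvalues H = {r, s}) :
    r + s = a ∧ r * s = a - 1 - 2 * (a * k) := by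
  obtain ⟨ha, hk, hM⟩ := h
  have ha' : (1 : ℝ) ≤ a := by exact_mod_cast ha
  have hk' : (2 : ℝ) ≤ k := by exact_mod_cast hk
  refine add_mul_of_roots he (by nlinarith) (by nlinarith) (by nlinarith) fun t ht => ?_
  refine hM.mem_adjSpectrum (x := Sum.elim (fun _ => t - 1) fun _ => (a : ℝ)) (fun h => ?_) ?_
  · have := congrFun h (Sum.inr ⟨0, by omega⟩)
    simp only [Sum.elim_inr, Pi.zero_apply] at this
    linarith
  · simp only [Matrix.fromBlocks_mulVec, Sum.elim_comp_inl, Sum.elim_comp_inr, JI_mulVec,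
      J_mulVec, R_mulVec]
    funext x
    rcases x with x | x <;> simp only [Sum.elim_inl, Sum.elim_inr, Pi.smul_apply, smul_eq_mul,
      Pi.add_apply] <;> push_cast <;> linarith

theorem IsTypeIII.add_mul {l m : ℕ} (h : IsTypeIII l m H)
    (he : exceptionalEigenvalues H = {r, s}) : r + s = 2 ∧ r * s = 1 - 4 * (l * m) := by
  obtain ⟨hl, hm, hM⟩ := h
  have hm' : (2 : ℝ) ≤ m := by exact_mod_cast hm
  have hl' : (2 : ℝ) ≤ l := by exact_mod_cast hm.trans hl
  refine add_mul_of_roots he (by nlinarith) (by nlinarith) (by nlinarith) fun t ht => ?_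
  refine hM.mem_adjSpectrum (x := Sum.elim (fun _ => 2 * (m : ℝ)) fun _ => t - 1)
    (fun h => ?_) ?_
  · have := congrFun h (Sum.inl ⟨0, by omega⟩)
    simp only [Sum.elim_inl, Pi.zero_apply] at this
    linarith
  · simp only [Matrix.fromBlocks_mulVec, Sum.elim_comp_inl, Sum.elim_comp_inr, J_mulVec, R_mulVec]
    funext x
    rcases x with x | x <;> simp only [Sum.elim_inl, Sum.elim_inr, Pi.smul_apply, smul_eq_mul,
      Pi.add_apply] <;> push_cast <;> linarith

theorem IsTypeIVFirst.add_mul (h : IsTypeIVFirst H) (he : exceptionalEigenvalues H = {r, s}) :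
    r + s = 0 ∧ r * s = -9 := by
  refine add_mul_of_roots he (by norm_num) (by norm_num) (by norm_num) fun t ht => ?_
  refine HasAdjMatrix.mem_adjSpectrum h (x := Sum.elim (Sum.elim (fun _ => 6) fun _ => 3)
    (Sum.elim (fun _ => 2 * t) fun _ => t)) (fun h => ?_) ?_
  · have := congrFun h (Sum.inl (Sum.inl 0))
    norm_num at this
  · simp only [bip, Matrix.fromBlocks_transpose, Matrix.fromBlocks_mulVec, Sum.elim_comp_inl,
      Sum.elim_comp_inr, J_transpose, J_mulVec, Matrix.zero_mulVec, Matrix.transpose_one,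
      Matrix.one_mulVec, zero_add, add_zero]
    funext x
    rcases x with (x | x) | (x | x) <;> simp only [Sum.elim_inl, Sum.elim_inr, Pi.smul_apply,
      smul_eq_mul, Pi.add_apply] <;> push_cast <;> linarith

theorem IsTypeIVSecond.add_mul (h : IsTypeIVSecond H) (he : exceptionalEigenvalues H = {r, s}) :
    r + s = 0 ∧ r * s = -16 := by
  refine add_mul_of_roots he (by norm_num) (by norm_num) (by norm_num) fun t ht => ?_
  refine HasAdjMatrix.mem_adjSpectrum h (x := Sum.elim (Sum.elim (fun _ => 2 * t) fun _ => t)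
    (Sum.elim (fun _ => 4) fun _ => 8)) (fun h => ?_) ?_
  · have := congrFun h (Sum.inr (Sum.inl 0))
    norm_num at this
  · simp only [bip, Matrix.fromBlocks_transpose, Matrix.fromBlocks_mulVec, Sum.elim_comp_inl,
      Sum.elim_comp_inr, J_transpose, JI_transpose, J_mulVec, JI_mulVec, Matrix.zero_mulVec,
      Matrix.transpose_zero, zero_add, add_zero]
    funext x
    rcases x with (x | x) | (x | x) <;> simp only [Sum.elim_inl, Sum.elim_inr, Pi.smul_apply,
      smul_eq_mul, Pi.add_apply] <;> push_cast <;> linarith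

/-- The vector that is `y t`, `t`, `c` on the three cliques is an eigenvector. -/
theorem add_mul_cliquePath {a c : ℕ} (h : HasAdjMatrix H (cliquePath a c))
    (he : exceptionalEigenvalues H = {r, s}) {σ π : ℝ} (hπ : π < 0) (h1 : 1 - σ + π ≠ 0)
    (h2 : 1 + σ + π ≠ 0) (hc : c ≠ 0) {y : ℝ → ℝ}
    (hy : ∀ t, t * t = σ * t - π → (a - 1) * y t + c * t = t * y t)
    (hy' : ∀ t, t * t = σ * t - π → a * y t + (c - 1) * t + c = t * t) :
    r + s = σ ∧ r * s = π := by
  refine add_mul_of_roots he hπ h1 h2 fun t ht => ?_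
  refine h.mem_adjSpectrum (x := Sum.elim (Sum.elim (fun _ => y t) fun _ => t) fun _ => (c : ℝ))
    (fun h => ?_) ?_
  · have := congrFun h (Sum.inr 0)
    simp only [Sum.elim_inr, Pi.zero_apply, Nat.cast_eq_zero] at this
    exact hc this
  · simp only [cliquePath, Matrix.fromBlocks_mulVec, Matrix.fromRows_mulVec,
      Matrix.fromCols_mulVec, Sum.elim_comp_inl, Sum.elim_comp_inr, J_mulVec, JI_mulVec,
      Matrix.zero_mulVec, zero_add, add_zero]
    funext x
    rcases x with (x | x) | x <;> simp only [Sum.elim_inl, Sum.elim_inr, Pi.smul_apply,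
      smul_eq_mul, Pi.add_apply, Pi.zero_apply, add_zero] <;> push_cast <;>
      linarith [hy t ht, hy' t ht]

/-- The vector that is `y t`, `t`, `m - 1` on the three parts is an eigenvector. -/
theorem add_mul_tail {a m : ℕ} (h : IsTypeVI a m H)
    (he : exceptionalEigenvalues H = {r, s}) {σ π : ℝ} (hπ : π < 0) (h1 : 1 - σ + π ≠ 0)
    (h2 : 1 + σ + π ≠ 0) {y : ℝ → ℝ}
    (hy : ∀ t, t * t = σ * t - π → (a - 1) * y t + m * t = t * y t)
    (hy' : ∀ t, t * t = σ * t - π → a * y t + (m - 1) * (m - 1) = t * t) :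
    r + s = σ ∧ r * s = π := by
  have hm : 4 ≤ m := by rcases h.1 with ⟨-, h⟩ | ⟨-, h⟩ <;> omega
  have hm' : (4 : ℝ) ≤ m := by exact_mod_cast hm
  refine add_mul_of_roots he hπ h1 h2 fun t ht => ?_
  refine h.2.mem_adjSpectrum
    (x := Sum.elim (Sum.elim (fun _ => y t) fun _ => t) fun _ => (m : ℝ) - 1) (fun h => ?_) ?_
  · have := congrFun h (Sum.inr ⟨0, by omega⟩)
    simp only [Sum.elim_inr, Pi.zero_apply] at this
    linarith
  · simp only [Matrix.fromBlocks_mulVec, Matrix.fromRows_mulVec,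
      Matrix.fromCols_mulVec, Sum.elim_comp_inl, Sum.elim_comp_inr, J_mulVec, JI_mulVec,
      Matrix.zero_mulVec, zero_add, add_zero]
    funext x
    rcases x with (x | x) | x <;> simp only [Sum.elim_inl, Sum.elim_inr, Pi.smul_apply,
      smul_eq_mul, Pi.add_apply, Pi.zero_apply, add_zero] <;>
      linarith [hy t ht, hy' t ht]

/-- The connected graphs with two exceptional eigenvalues, one case for each family; `σ` and `π` are
the sum and the product of these two eigenvalues. The cases `V₁`, `V₂`, `V₃` are paths of cliques;
they are not cospectral to any other graph in the list. -/
inductive Classified (H : SimpleGraph V) (σ π : ℤ) : Prop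
  | I (m : ℕ) (h : IsTypeI m H) (hσ : σ = 0) (hπ : π = -((m - 1) * (m - 1)))
  | II (a k : ℕ) (h : IsTypeII a k H) (hσ : σ = a) (hπ : π = a - 1 - 2 * (a * k))
  | III (l m : ℕ) (h : IsTypeIII l m H) (hσ : σ = 2) (hπ : π = 1 - 4 * (l * m))
  | IV₁ (h : IsTypeIVFirst H) (hσ : σ = 0) (hπ : π = -9)
  | IV₂ (h : IsTypeIVSecond H) (hσ : σ = 0) (hπ : π = -16)
  | V₁ (h : HasAdjMatrix H (cliquePath 8 3)) (hσ : σ = 8) (hπ : π = -21)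
  | V₂ (h : HasAdjMatrix H (cliquePath 6 4)) (hσ : σ = 7) (hπ : π = -20)
  | V₃ (h : HasAdjMatrix H (cliquePath 5 6)) (hσ : σ = 8) (hπ : π = -24)
  | VI₁ (h : IsTypeVI 3 5 H) (hσ : σ = 1) (hπ : π = -32)
  | VI₂ (h : IsTypeVI 4 4 H) (hσ : σ = 2) (hπ : π = -27)

theorem InClassG.classified (h : InClassG H) (he : exceptionalEigenvalues H = {r, s}) :
    ∃ σ π : ℤ, r + s = σ ∧ r * s = π ∧ Classified H σ π := by
  have e : ∀ {σ π : ℤ} {x y : ℝ}, r + s = x ∧ r * s = y → x = σ → y = π → Classified H σ π →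
      ∃ σ π : ℤ, r + s = σ ∧ r * s = π ∧ Classified H σ π :=
    fun h hx hy hc => ⟨_, _, h.1.trans hx, h.2.trans hy, hc⟩
  rcases h.admissible.1.types h.admissible.2 with
    ⟨m, h⟩ | ⟨a, k, h⟩ | ⟨l, m, h⟩ | h | h | h | h | h | h | h
  · exact e (h.add_mul he) (by simp) (by simp) (.I m h rfl rfl)
  · exact e (h.add_mul he) (by simp) (by simp) (.II a k h rfl rfl)
  · exact e (h.add_mul he) (by simp) (by simp) (.III l m h rfl rfl)
  · exact e (h.add_mul he) (by simp) (by simp) (.IV₁ h rfl rfl)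
  · exact e (h.add_mul he) (by simp) (by simp) (.IV₂ h rfl rfl)
  · refine e (add_mul_cliquePath h he (σ := 8) (π := -21) (y := fun t => 3 / 4 * (t + 3))
      (by norm_num) (by norm_num) (by norm_num) (by norm_num) (fun t ht => ?_) fun t ht => ?_)
      (by simp) (by simp) (.V₁ h rfl rfl)
    all_goals push_cast; linarith
  · refine e (add_mul_cliquePath h he (σ := 7) (π := -20) (y := fun t => 2 / 3 * (t + 4))
      (by norm_num) (by norm_num) (by norm_num) (by norm_num) (fun t ht => ?_) fun t ht => ?_)
      (by simp) (by simp) (.V₂ h rfl rfl)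
    all_goals push_cast; linarith
  · refine e (add_mul_cliquePath h he (σ := 8) (π := -24) (y := fun t => 3 / 5 * (t + 6))
      (by norm_num) (by norm_num) (by norm_num) (by norm_num) (fun t ht => ?_) fun t ht => ?_)
      (by simp) (by simp) (.V₃ h rfl rfl)
    all_goals push_cast; linarith
  · refine e (add_mul_tail h he (σ := 1) (π := -32) (y := fun t => 1 / 3 * (t + 16))
      (by norm_num) (by norm_num) (by norm_num) (fun t ht => ?_) fun t ht => ?_)
      (by simp) (by simp) (.VI₁ h rfl rfl)
    all_goals push_cast; linarith
  · refine e (add_mul_tail h he (σ := 2) (π := -27) (y := fun t => 1 / 2 * (t + 9))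
      (by norm_num) (by norm_num) (by norm_num) (fun t ht => ?_) fun t ht => ?_)
      (by simp) (by simp) (.VI₂ h rfl rfl)
    all_goals push_cast; linarith

theorem mul_ne_seven {l m : ℕ} (h : m ≤ l) (hm : 2 ≤ m) : l * m ≠ 7 := by
  intro h7
  have : m ≤ 2 := by nlinarith
  obtain rfl : m = 2 := by omega
  omega

/-- Equal sums and products of the exceptional eigenvalues leave only the listed coincidences. -/
theorem Classified.eq_or_listedPair {H' : SimpleGraph V'} {σ π : ℤ} (h : Classified H σ π)
    (h' : Classified H' σ π) :
    Nonempty (H ≃g H') ∨ ListedPair H H' ∨ ListedPair H' H := by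
  have eq_of_sq : ∀ {m n : ℕ}, 1 ≤ m → 1 ≤ n →
      -(((m : ℤ) - 1) * (m - 1)) = -((n - 1) * (n - 1)) → m = n := by
    intro m n hm hn h
    rcases mul_self_eq_mul_self_iff.1 (neg_injective h) with h | h <;> omega
  cases h with
  | I m h hσ hπ =>
    have := h.1
    cases h' with
    | I m' h' hσ' hπ' =>
      have := h'.1
      obtain rfl := eq_of_sq (m := m) (n := m') (by omega) (by omega) (hπ.symm.trans hπ')
      exact Or.inl (h.2.nonempty_iso h'.2)
    | II a k h' hσ' hπ' => have := h'.1; omega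
    | IV₁ h' hσ' hπ' =>
      obtain rfl := eq_of_sq (m := m) (n := 4) (by omega) (by omega) (by rw [← hπ, hπ']; norm_num)
      exact Or.inr (Or.inr (Or.inr (Or.inr (Or.inl ⟨h', h⟩))))
    | IV₂ h' hσ' hπ' =>
      obtain rfl := eq_of_sq (m := m) (n := 5) (by omega) (by omega) (by rw [← hπ, hπ']; norm_num)
      exact Or.inr (Or.inr (Or.inr (Or.inr (Or.inr (Or.inl ⟨h', h⟩)))))
    | _ => omega
  | II a k h hσ hπ =>
    have := h.1
    cases h' with
    | II a' k' h' hσ' hπ' =>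
      obtain rfl : a = a' := by omega
      obtain rfl : k = k' := by
        have : (a : ℤ) * k = a * k' := by linarith
        have := mul_left_cancel₀ (by omega) this
        omega
      exact Or.inl (h.2.2.nonempty_iso h'.2.2)
    | III l m h' hσ' hπ' =>
      obtain rfl : a = 2 := by omega
      obtain rfl : k = l * m := by zify; push_cast at hπ; linarith
      exact Or.inr (Or.inr (Or.inr (Or.inl ⟨l, m, h', h⟩)))
    | VI₁ h' hσ' hπ' =>
      obtain rfl : a = 1 := by omega
      obtain rfl : k = 16 := by push_cast at hπ; omega
      exact Or.inr (Or.inl (Or.inr (Or.inr (Or.inr (Or.inr (Or.inl ⟨h, h'⟩))))))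
    | VI₂ h' hσ' hπ' =>
      obtain rfl : a = 2 := by omega
      obtain rfl : k = 7 := by push_cast at hπ; omega
      exact Or.inr (Or.inl (Or.inr (Or.inr (Or.inr (Or.inr (Or.inr ⟨h, h'⟩))))))
    | V₁ h' hσ' hπ' =>
      obtain rfl : a = 8 := by omega
      push_cast at hπ; omega
    | V₂ h' hσ' hπ' =>
      obtain rfl : a = 7 := by omega
      push_cast at hπ; omega
    | V₃ h' hσ' hπ' =>
      obtain rfl : a = 8 := by omega
      push_cast at hπ; omega
    | _ => omega
  | III l m h hσ hπ =>
    cases h' with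
    | II a k h' hσ' hπ' =>
      obtain rfl : a = 2 := by omega
      obtain rfl : k = l * m := by zify; push_cast at hπ'; linarith
      exact Or.inr (Or.inl (Or.inr (Or.inl ⟨l, m, h, h'⟩)))
    | III l' m' h' hσ' hπ' =>
      have : l * m = l' * m' := by zify; linarith
      exact Or.inr (Or.inl (Or.inl ⟨l, m, l', m', h, h', this⟩))
    | VI₂ h' hσ' hπ' => exact (mul_ne_seven h.1 h.2.1 (by zify; linarith)).elim
    | _ => omega
  | IV₁ h hσ hπ =>
    cases h' with
    | I m h' hσ' hπ' =>
      have := h'.1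
      obtain rfl := eq_of_sq (m := m) (n := 4) (by omega) (by omega) (by rw [← hπ', hπ]; norm_num)
      exact Or.inr (Or.inl (Or.inr (Or.inr (Or.inl ⟨h, h'⟩))))
    | II a k h' hσ' hπ' => have := h'.1; omega
    | IV₁ h' hσ' hπ' => exact Or.inl (HasAdjMatrix.nonempty_iso h h')
    | _ => omega
  | IV₂ h hσ hπ =>
    cases h' with
    | I m h' hσ' hπ' =>
      have := h'.1
      obtain rfl := eq_of_sq (m := m) (n := 5) (by omega) (by omega) (by rw [← hπ', hπ]; norm_num)
      exact Or.inr (Or.inl (Or.inr (Or.inr (Or.inr (Or.inl ⟨h, h'⟩)))))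
    | II a k h' hσ' hπ' => have := h'.1; omega
    | IV₂ h' hσ' hπ' => exact Or.inl (HasAdjMatrix.nonempty_iso h h')
    | _ => omega
  | V₁ h hσ hπ =>
    cases h' with
    | II a k h' hσ' hπ' =>
      obtain rfl : a = 8 := by omega
      push_cast at hπ'; omega
    | V₁ h' hσ' hπ' => exact Or.inl (h.nonempty_iso h')
    | _ => omega
  | V₂ h hσ hπ =>
    cases h' with
    | II a k h' hσ' hπ' =>
      obtain rfl : a = 7 := by omega
      push_cast at hπ'; omega
    | V₂ h' hσ' hπ' => exact Or.inl (h.nonempty_iso h')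
    | _ => omega
  | V₃ h hσ hπ =>
    cases h' with
    | II a k h' hσ' hπ' =>
      obtain rfl : a = 8 := by omega
      push_cast at hπ'; omega
    | V₃ h' hσ' hπ' => exact Or.inl (h.nonempty_iso h')
    | _ => omega
  | VI₁ h hσ hπ =>
    cases h' with
    | II a k h' hσ' hπ' =>
      obtain rfl : a = 1 := by omega
      obtain rfl : k = 16 := by push_cast at hπ'; omega
      exact Or.inr (Or.inr (Or.inr (Or.inr (Or.inr (Or.inr (Or.inl ⟨h', h⟩))))))
    | VI₁ h' hσ' hπ' => exact Or.inl (h.2.nonempty_iso h'.2)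
    | _ => omega
  | VI₂ h hσ hπ =>
    cases h' with
    | II a k h' hσ' hπ' =>
      obtain rfl : a = 2 := by omega
      obtain rfl : k = 7 := by push_cast at hπ'; omega
      exact Or.inr (Or.inr (Or.inr (Or.inr (Or.inr (Or.inr (Or.inr ⟨h', h⟩))))))
    | III l m h' hσ' hπ' => exact (mul_ne_seven h'.1 h'.2.1 (by zify; linarith)).elim
    | VI₂ h' hσ' hπ' => exact Or.inl (h.2.nonempty_iso h'.2)
    | _ => omega

theorem card_adjSpectrum (G : SimpleGraph V) : (adjSpectrum G).card = Fintype.card V := by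
  obtain ⟨μ, E, B⟩ := exists_isEigenbasis G
  rw [B.spectrum, Multiset.card_map]
  rfl

end Cospectrality

end TwoEig

theorem mainTheorem3 {V V' : Type*} [Fintype V] [Fintype V']
    (G : SimpleGraph V) (G' : SimpleGraph V')
    (hniso : IsEmpty (G ≃g G'))
    (hcosp : TwoEig.Cospectral G G')
    (hG : (TwoEig.exceptionalEigenvalues G).card ≤ 2)
    (hG' : (TwoEig.exceptionalEigenvalues G').card ≤ 2) :
    ∃ (n n' α α' : ℕ) (H : SimpleGraph (Fin n)) (H' : SimpleGraph (Fin n')),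
      Nonempty (G ≃g SimpleGraph.sum H (TwoEig.copiesK2 α)) ∧
      Nonempty (G' ≃g SimpleGraph.sum H' (TwoEig.copiesK2 α')) ∧
      TwoEig.InClassG H ∧ TwoEig.InClassG H' ∧
      (TwoEig.ListedPair H H' ∨ TwoEig.ListedPair H' H) := by
  obtain ⟨μ, E, B⟩ := TwoEig.exists_isEigenbasis G
  by_cases hmin : ∀ x ∈ TwoEig.adjSpectrum G, -1 ≤ x
  · obtain ⟨e⟩ := TwoEig.nonempty_iso_of_neg_one_le hcosp hmin
    exact hniso.elim e
  · push Not at hmin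
    obtain ⟨x, hx, hlt⟩ := hmin
    rw [B.spectrum, Multiset.mem_map] at hx
    obtain ⟨j, -, rfl⟩ := hx
    obtain ⟨i, T, he⟩ := B.exists_twoExceptional hG hlt
    have he' : TwoEig.exceptionalEigenvalues G' = {μ i, μ j} := by
      rw [← he]
      unfold TwoEig.exceptionalEigenvalues
      rw [hcosp]
    obtain ⟨n, α, H, hiso, hconn, hH⟩ := TwoEig.exists_reduction T.one_lt T.lt_neg_one he
    obtain ⟨n', α', H', hiso', hconn', hH'⟩ := TwoEig.exists_reduction T.one_lt T.lt_neg_one he'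
    have hC : TwoEig.InClassG H := ⟨hconn, _, _, T.one_lt, T.lt_neg_one, hH⟩
    have hC' : TwoEig.InClassG H' := ⟨hconn', _, _, T.one_lt, T.lt_neg_one, hH'⟩
    refine ⟨n, n', α, α', H, H', hiso, hiso', hC, hC', ?_⟩
    obtain ⟨σ, π, hσ, hπ, c⟩ := hC.classified hH
    obtain ⟨σ', π', hσ', hπ', c'⟩ := hC'.classified hH'
    obtain rfl : σ = σ' := by exact_mod_cast hσ.symm.trans hσ'
    obtain rfl : π = π' := by exact_mod_cast hπ.symm.trans hπ'
    refine (c.eq_or_listedPair c').resolve_left ?_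
    -- Isomorphic graphs `H` and `H'` leave room for equally many edges beside them.
    rintro ⟨φ⟩
    obtain ⟨ψ⟩ := hiso
    obtain ⟨ψ'⟩ := hiso'
    have h1 := Fintype.card_congr ψ.toEquiv
    have h2 := Fintype.card_congr ψ'.toEquiv
    have h3 := Fintype.card_congr φ.toEquiv
    have h4 : Fintype.card V = Fintype.card V' := by
      rw [← TwoEig.card_adjSpectrum G, ← TwoEig.card_adjSpectrum G', hcosp]
    simp only [Fintype.card_sum, Fintype.card_prod, Fintype.card_fin] at h1 h2 h3
    obtain rfl : α = α' := by omega
    exact hniso.elim ((ψ.trans (SimpleGraph.Iso.sumCongr φ SimpleGraph.Iso.refl)).trans ψ'.symm)
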